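/- Let $\mathbb F$ be a field, $\prec$ an admissible ordering of the monomials of $\mathbb F[x_1,\dots,x_n]$, and $F=(f_1,\dots,f_m)$, $m\ge 1$, a list of nonzero homogeneous polynomials. Write $\mathrm{lt}$ and $\mathrm{lc}$ for head monomial and head coefficient. **The algorithm F5C.** Sort $F$ by total degree, breaking ties by head monomial. The algorithm keeps a list $r$ of labeled polynomials $r_k=(\mathrm{sig}(k),\mathrm{poly}(k))$, where a signature is a monomial multiple $\mu e_\nu$ of a module generator (ordered by $\nu$, then by $\mu$), and, for every $\nu$, a list $\mathrm{Rules}_\nu$ of pairs (monomial, index). Start with $r=\big((e_1,f_1/\mathrm{lc}(f_1))\big)$, $G_{prev}=\{1\}$, $B=\{f_1\}$. For $f=f_2,\dots,f_m$ run the following *stage*. 1. Append $(e_i,f/\mathrm{lc}(f))$ to $r$, where $i$ is its position in $r$, and an empty list to $\mathrm{Rules}$. Put $G_{curr}=G_{prev}\cup\{i\}$, and let $P$ consist of the results of *Crit_Pair*$(i,j)$, $j\in G_{prev}$. *Crit_Pair*$(k,\ell)$ puts $t=\mathrm{lcm}(\mathrm{lt}\,\mathrm{poly}(k),\mathrm{lt}\,\mathrm{poly}(\ell))$,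 $u=t/\mathrm{lt}\,\mathrm{poly}(k)$, $v=t/\mathrm{lt}\,\mathrm{poly}(\ell)$; it gives nothing if one of the two components $(u,k)$, $(v,\ell)$ has signature index $i$ and the monomial of $u\,\mathrm{sig}(k)$, resp. $v\,\mathrm{sig}(\ell)$, is top-reducible by $G_{prev}$ (divisible by $\mathrm{lt}\,\mathrm{poly}(b)$ for some $b\in G_{prev}$), and otherwise gives the pair $(t,k,u,\ell,v)$, with the two components swapped if $u\,\mathrm{sig}(k)\prec v\,\mathrm{sig}(\ell)$. 2. While $P\ne\emptyset$: remove from $P$ the pairs with $\deg t$ minimal and treat them in order of increasing $t$. Skip $(t,k,u,\ell,v)$ if $(u,k)$ or $(v,\ell)$ is rewritable; otherwise append $(u\,\mathrm{sig}(k),S)$ to $r$, where $S$ is the S-polynomial of $\mathrm{poly}(k)$ and $\mathrm{poly}(\ell)$, and record the rule (monomial of the signature, new index) in the list of its signature index. Here $(u,k)$ is *rewritable* if the most recent rule $(\mu,j)$ in $\mathrm{Rules}_\nu$ ($\nu$ the index of $\mathrm{sig}(k)$) whose $\mu$ divides the monomial of $u\,\mathrm{sig}(k)$ exists and has $j\neq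 k$. Then reduce the new nonzero polynomials: as long as some are left, take one, $r_k$, of minimal signature and replace $\mathrm{poly}(k)$ by a normal form modulo $B$. If this is $0$, discard $k$. Otherwise look for $j$ in $G_{curr}$ or among the completed indices such that $\mathrm{lt}\,\mathrm{poly}(j)$ divides $\mathrm{lt}\,\mathrm{poly}(k)$, with quotient $u$, such that $u\,\mathrm{sig}(j)\ne\mathrm{sig}(k)$, $(u,j)$ is not rewritable, and the monomial of $u\,\mathrm{sig}(j)$ is not top-reducible by $G_{prev}$. If there is none, make $\mathrm{poly}(k)$ monic; $k$ is completed. If there is one, let $p$ be the (monic) result of top-reducing $\mathrm{poly}(k)$ by $u\,\mathrm{poly}(j)$; if $u\,\mathrm{sig}(j)\prec\mathrm{sig}(k)$, replace $\mathrm{poly}(k)$ by $p$, otherwise append $(u\,\mathrm{sig}(j),p)$ to $r$, record the corresponding rule, and add the new index to those to be reduced; in both cases $k$ remains to be reduced. When none is left, for each completed $k$ add to $P$ the results of *Crit_Pair*$(k,j)$ for all $j\in G_{curr}$ and then add $k$ to $G_{curr}$. 3. If $\mathrm{poly}(k)=1$ for some $k\in G_{curr}$, return $\{1\}$. Otherwise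 let $B=\{B_1,\dots,B_s\}$ be the interreduction of $\{\mathrm{poly}(k):k\in G_{curr}\}$ and run *Setup_Reduced_Basis*: $r:=\big((e_j,B_j)\big)_{j=1}^s$, $G_{prev}:=\{1,\dots,s\}$, and $\mathrm{Rules}_k:=\big((\mathrm{lcm}(\mathrm{lt}B_j,\mathrm{lt}B_k)/\mathrm{lt}B_k,\,0)\big)_{j<k}$ for $k\le s$, where $0$ is the index of a phantom polynomial. After the last stage return $B$. Whatever this description leaves open (ties, the order in which sets are searched) may be decided arbitrarily. **The reformulation.** Change the algorithm as follows. Elements of $G_{prev}$ have no signatures and count as smaller than everything else in comparisons of signatures. $\mathrm{Rules}$ is a single list, empty at the start of each stage. Top-reducibility of a signature by $G_{prev}$ (in *Crit_Pair* and in the search for a reductor) and rewritability are checked only for components $(u,k)$ with $k\notin G_{prev}$. *Setup_Reduced_Basis* is dropped: $B$ is the interreduction of $\{\mathrm{poly}(k):k\in G_{curr}\}$, and in the next stage $G_{prev}$ indexes the elements of $B$, with no signatures or rules generated for them. (The following also holds for the variant in which $G_{prev}:=G_{curr}$ and $B$ is used only to compute normal forms.) **Claim.** (a) Whatever set the reformulated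 algorithm returns on input $F$ is a Gröbner basis of $\langle F\rangle$ with respect to $\prec$. (b) If F5C terminates on input $F$ (for some choice of what is left open), then the reformulated algorithm terminates on input $F$ (for every such choice), and so by (a) returns a Gröbner basis of $\langle F\rangle$. (c) Throughout the reformulated algorithm, every entry $(\mu,k)$ of $\mathrm{Rules}$ records the signature $\mu$ of a labeled polynomial $r_k$ created in the current stage, so $k\notin G_{prev}$; and whenever the head of the loop in step 2 is reached, $k\in G_{curr}\setminus G_{prev}$ or $\mathrm{poly}(k)=0$. -/

import Mathlib

open MvPolynomial

namespace F5C

/-! ### Polynomials, reduction, Gröbner bases -/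

/-- Monomials in `n` variables, written additively: the product is `+`, divisibility is `≤`,
the least common multiple is `⊔`, the quotient is `-`. -/
abbrev Mon (n : ℕ) := Fin n →₀ ℕ

abbrev Pol (n : ℕ) (K : Type*) [Field K] := MvPolynomial (Fin n) K

section Basics

variable {n : ℕ} {K : Type*} [Field K] (m : MonomialOrder (Fin n))

/-- `p · lc(p)⁻¹`. -/
noncomputable def monic (p : Pol n K) : Pol n K := C (m.leadingCoeff p)⁻¹ * p

/-- `G` is a Gröbner basis of the ideal `I`. -/
def IsGroebnerBasis (I : Ideal (Pol n K)) (G : Set (Pol n K)) : Prop :=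
  G.Finite ∧ G ⊆ I ∧ Ideal.span G = I ∧
    ∀ p ∈ I, p ≠ 0 → ∃ g ∈ G, g ≠ 0 ∧ m.degree g ≤ m.degree p

/-- One reduction step modulo `G`: some monomial `a` occurring in `p` is a multiple of the head
monomial of some `g ∈ G`, and is cancelled with the help of `g`. -/
def Red (G : Set (Pol n K)) (p q : Pol n K) : Prop :=
  ∃ g ∈ G, g ≠ 0 ∧ ∃ a ∈ p.support, m.degree g ≤ a ∧
    q = p - monomial (a - m.degree g) (coeff a p / m.leadingCoeff g) * g

/-- `h` is a normal form of `p` modulo `G` (complete reduction). -/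
def IsNormalForm (G : Set (Pol n K)) (p h : Pol n K) : Prop :=
  Relation.ReflTransGen (Red m G) p h ∧ ∀ q, ¬ Red m G h q

/-- One step of an interreduction: reduce an element by the others, drop `0`, or make an element
monic. -/
inductive InterStep : Set (Pol n K) → Set (Pol n K) → Prop
  | reduce (G : Set (Pol n K)) (g h : Pol n K) (hg : g ∈ G) (hr : Red m (G \ {g}) g h) :
      InterStep G (insert h (G \ {g}))
  | drop (G : Set (Pol n K)) (h0 : (0 : Pol n K) ∈ G) : InterStep G (G \ {0})
  | normalise (G : Set (Pol n K)) (g : Pol n K) (hg : g ∈ G) (hg0 : g ≠ 0) :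
      InterStep G (insert (monic m g) (G \ {g}))

/-- No element of `G` is reducible by the others, and all are nonzero with head coefficient `1`. -/
def IsInterreduced (G : Set (Pol n K)) : Prop :=
  ∀ g ∈ G, m.leadingCoeff g = 1 ∧ ∀ h, ¬ Red m (G \ {g}) g h

/-- `B` is an interreduction of `G`. -/
def IsInterreduction (G B : Set (Pol n K)) : Prop :=
  Relation.ReflTransGen (InterStep m) G B ∧ IsInterreduced m B

/-- The order in which the input is sorted: total degree first, then head monomial. -/
def InputLE (p q : Pol n K) : Prop :=
  p.totalDegree < q.totalDegree ∨
    (p.totalDegree = q.totalDegree ∧ m.toSyn (m.degree p) ≤ m.toSyn (m.degree q))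

end Basics

/-! ### Data structures

`S` is the type of signatures and `R` the type of the rule list; these differ between the two
versions of the algorithm. Indices of labeled polynomials start at `0`. -/

/-- A labeled polynomial. -/
structure Labeled (n : ℕ) (K : Type*) [Field K] (S : Type) where
  sig : S
  poly : Pol n K

/-- A critical pair `(t, k, u, ℓ, v)`: `t` is the least common multiple of the head monomials, and
`u · poly k`, `v · poly ℓ` are the components up to constants. -/
structure CritPair (n : ℕ) where
  t : Mon n
  k : ℕ
  u : Mon n
  l : ℕ
  v : Mon n

/-- The variables visible inside one call of Partial_Basis. -/
structure Stage (n : ℕ) (K : Type*) [Field K] (S R : Type) where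
  /-- the Gröbner basis of the previous ideal used for normal forms -/
  B : Set (Pol n K)
  /-- `G_prev` -/
  prev : Finset ℕ
  /-- the index in `r` of the new input polynomial -/
  idx : ℕ
  /-- the list of labeled polynomials -/
  r : List (Labeled n K S)
  rules : R
  /-- `G_curr` -/
  curr : Finset ℕ
  /-- the critical pairs that are still to be treated -/
  pairs : Finset (CritPair n)

section Access

variable {n : ℕ} {K : Type*} [Field K] {S R : Type} [Inhabited S]

noncomputable def Stage.poly (D : Stage n K S R) (k : ℕ) : Pol n K :=
  (D.r.getD k ⟨default, 0⟩).poly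

noncomputable def Stage.sig (D : Stage n K S R) (k : ℕ) : S :=
  (D.r.getD k ⟨default, 0⟩).sig

/-- The monomial `a` is top-reducible by `G_prev`. -/
def Stage.TopRedByPrev (m : MonomialOrder (Fin n)) (D : Stage n K S R) (a : Mon n) : Prop :=
  ∃ b ∈ D.prev, m.degree (D.poly b) ≤ a

end Access

/-- Everything in which the two versions of the algorithm differ. -/
structure Version {n : ℕ} (m : MonomialOrder (Fin n)) (K : Type*) [Field K] (S R : Type) where
  /-- multiplication of a signature by a monomial -/
  mul : Mon n → S → S
  /-- the strict order of signatures -/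
  lt : S → S → Prop
  /-- the signature of the first input polynomial, which makes up `G_prev` in the first stage -/
  first : S
  /-- the signature given to any later input polynomial, which is put at index `k` -/
  unit : ℕ → S
  /-- Add_Rule -/
  addRule : S → ℕ → R → R
  /-- the rule list of the first stage -/
  initRules : R
  /-- what Partial_Basis does to the rule list when it starts -/
  openRules : R → R
  /-- the condition under which Crit_Pair rejects a pair because of the component `u · poly k` -/
  critReject : Stage n K S R → Mon n → ℕ → Prop
  /-- the condition under which S_Pols rejects a pair because of the component `u · poly k` -/
  spolReject : Stage n K S R → Mon n → ℕ → Prop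
  /-- the condition under which Find_Reductor rejects the reductor `u · poly j`, apart from the
  comparison of its signature with that of the polynomial to be reduced -/
  reductorReject : Stage n K S R → Mon n → ℕ → Prop
  /-- how, from the data at the end of a stage and the interreduction `B` of the polynomials
  indexed by `G_curr`, the values of `G_prev`, `r` and the rule list for the next stage are
  obtained -/
  restart : Stage n K S R → Set (Pol n K) →
    Finset ℕ → List (Labeled n K S) → R → Prop

/-! ### The algorithm -/

section Algorithm

variable {n : ℕ} {K : Type*} [Field K] {S R : Type} [Inhabited S]
variable {m : MonomialOrder (Fin n)} (V : Version m K S R)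

open Classical in
/-- Crit_Pair. -/
noncomputable def critPair (D : Stage n K S R) (k l : ℕ) : Finset (CritPair n) :=
  let tk := m.degree (D.poly k)
  let tl := m.degree (D.poly l)
  let t := tk ⊔ tl
  let u₁ := t - tk
  let u₂ := t - tl
  if V.critReject D u₁ k ∨ V.critReject D u₂ l then ∅
  else if V.lt (V.mul u₁ (D.sig k)) (V.mul u₂ (D.sig l)) then {⟨t, l, u₂, k, u₁⟩}
  else {⟨t, k, u₁, l, u₂⟩}

/-- The condition of Find_Reductor for `u · poly j` to be a reductor of `poly k`; here `G` is the
set of indices that are searched. -/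
def IsReductor (D : Stage n K S R) (G : Finset ℕ) (k j : ℕ) (u : Mon n) : Prop :=
  j ∈ G ∧ m.degree (D.poly j) ≤ m.degree (D.poly k) ∧
    u = m.degree (D.poly k) - m.degree (D.poly j) ∧
    V.mul u (D.sig j) ≠ D.sig k ∧ ¬ V.reductorReject D u j

/-- `D` after `lp_k` has been replaced by `(sig k, p)`. -/
noncomputable def Stage.setPoly (D : Stage n K S R) (k : ℕ) (p : Pol n K) : Stage n K S R :=
  { D with r := D.r.set k ⟨D.sig k, p⟩ }

/-- `D` after `(s, p)` has been appended to `r`, and the corresponding rule added. -/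
noncomputable def Stage.append (D : Stage n K S R) (s : S) (p : Pol n K) : Stage n K S R :=
  { D with r := D.r ++ [⟨s, p⟩], rules := V.addRule s D.r.length D.rules }

open Classical in
/-- The values of the variables when Partial_Basis reaches its main loop for the first time, after
the input polynomial `f` has been appended to `r`. -/
noncomputable def enter (f : Pol n K) (B : Set (Pol n K)) (prev : Finset ℕ)
    (r : List (Labeled n K S)) (rules : R) : Stage n K S R :=
  let D : Stage n K S R :=
    { B := B, prev := prev, idx := r.length, r := r ++ [⟨V.unit r.length, monic m f⟩],
      rules := V.openRules rules, curr := insert r.length prev, pairs := ∅ }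
  { D with pairs := prev.biUnion fun j => critPair V D r.length j }

variable (n K S R) in
/-- Configurations of the algorithm: the program point together with the values of the variables.
The list `fs` always holds the input polynomials that have not been used yet. -/
inductive Config
  /-- before anything has been done -/
  | start (F : List (Pol n K))
  /-- head of the loop of the main procedure Basis -/
  | outer (fs : List (Pol n K)) (B : Set (Pol n K)) (prev : Finset ℕ)
      (r : List (Labeled n K S)) (rules : R)
  /-- head of the loop of Partial_Basis -/
  | loop (fs : List (Pol n K)) (D : Stage n K S R)
  /-- inside S_Pols: the pairs `P` are left, `new` has been collected -/
  | spol (fs : List (Pol n K)) (D : Stage n K S R) (P : Finset (CritPair n)) (new : Finset ℕ)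
  /-- inside Reduction -/
  | reduce (fs : List (Pol n K)) (D : Stage n K S R) (todo completed : Finset ℕ)
  /-- inside the loop of Partial_Basis over the output of Reduction, of which `Q` is left -/
  | update (fs : List (Pol n K)) (D : Stage n K S R) (Q : Finset ℕ)
  /-- the algorithm has returned `B` -/
  | done (B : Set (Pol n K))

open Classical in
/-- The steps of the algorithm. Where an order is left open by the algorithm (ties in sorting, the
order in which a set is searched), every order is allowed. -/
inductive Step : Config n K S R → Config n K S R → Prop
  | sort (F : List (Pol n K)) (f : Pol n K) (fs : List (Pol n K))
      (hperm : (f :: fs).Perm F) (hsort : (f :: fs).Pairwise (InputLE m)) :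
      Step (.start F) (.outer fs {f} {0} [⟨V.first, monic m f⟩] V.initRules)
  | ret (B : Set (Pol n K)) (prev : Finset ℕ) (r : List (Labeled n K S)) (rules : R) :
      Step (.outer [] B prev r rules) (.done B)
  | enter (f : Pol n K) (fs : List (Pol n K)) (B : Set (Pol n K)) (prev : Finset ℕ)
      (r : List (Labeled n K S)) (rules : R) :
      Step (.outer (f :: fs) B prev r rules) (.loop fs (enter V f B prev r rules))
  | retOne (fs : List (Pol n K)) (D : Stage n K S R) (hp : D.pairs = ∅)
      (h1 : ∃ k ∈ D.curr, D.poly k = 1) :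
      Step (.loop fs D) (.done {1})
  | leave (fs : List (Pol n K)) (D : Stage n K S R) (hp : D.pairs = ∅)
      (h1 : ∀ k ∈ D.curr, D.poly k ≠ 1) (B : Set (Pol n K)) (prev : Finset ℕ)
      (r : List (Labeled n K S)) (rules : R)
      (hB : IsInterreduction m {p | ∃ k ∈ D.curr, p = D.poly k} B)
      (hr : V.restart D B prev r rules) :
      Step (.loop fs D) (.outer fs B prev r rules)
  | select (fs : List (Pol n K)) (D : Stage n K S R) (c : CritPair n) (hc : c ∈ D.pairs)
      (hmin : ∀ c' ∈ D.pairs, c.t.degree ≤ c'.t.degree) :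
      Step (.loop fs D)
        (.spol fs { D with pairs := D.pairs.filter fun c' => c'.t.degree ≠ c.t.degree }
          (D.pairs.filter fun c' => c'.t.degree = c.t.degree) ∅)
  | spolSkip (fs : List (Pol n K)) (D : Stage n K S R) (P : Finset (CritPair n))
      (new : Finset ℕ) (c : CritPair n) (hc : c ∈ P)
      (hmin : ∀ c' ∈ P, m.toSyn c.t ≤ m.toSyn c'.t)
      (hrew : V.spolReject D c.u c.k ∨ V.spolReject D c.v c.l) :
      Step (.spol fs D P new) (.spol fs D (P.erase c) new)
  | spolAdd (fs : List (Pol n K)) (D : Stage n K S R) (P : Finset (CritPair n))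
      (new : Finset ℕ) (c : CritPair n) (hc : c ∈ P)
      (hmin : ∀ c' ∈ P, m.toSyn c.t ≤ m.toSyn c'.t)
      (hu : ¬ V.spolReject D c.u c.k) (hv : ¬ V.spolReject D c.v c.l)
      (s : Pol n K) (hs : s = m.sPolynomial (D.poly c.k) (D.poly c.l)) :
      Step (.spol fs D P new)
        (.spol fs (D.append V (V.mul c.u (D.sig c.k)) s) (P.erase c)
          (if s = 0 then new else insert D.r.length new))
  | spolEnd (fs : List (Pol n K)) (D : Stage n K S R) (new : Finset ℕ) :
      Step (.spol fs D ∅ new) (.reduce fs D new ∅)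
  /- In the next four steps `k` has minimal signature in the list of polynomials to be reduced, and
  `D'` is the state after `poly k` has been replaced by its normal form. -/
  | reduceZero (fs : List (Pol n K)) (D D' : Stage n K S R) (todo completed : Finset ℕ) (k : ℕ)
      (h : Pol n K) (hk : k ∈ todo) (hmin : ∀ k' ∈ todo, ¬ V.lt (D.sig k') (D.sig k))
      (hh : IsNormalForm m D.B (D.poly k) h) (hD' : D' = D.setPoly k h) (h0 : h = 0) :
      Step (.reduce fs D todo completed) (.reduce fs D' (todo.erase k) completed)
  | reduceDone (fs : List (Pol n K)) (D D' : Stage n K S R) (todo completed : Finset ℕ) (k : ℕ)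
      (h : Pol n K) (hk : k ∈ todo) (hmin : ∀ k' ∈ todo, ¬ V.lt (D.sig k') (D.sig k))
      (hh : IsNormalForm m D.B (D.poly k) h) (hD' : D' = D.setPoly k h) (h0 : h ≠ 0)
      (hJ : ∀ j u, ¬ IsReductor V D' (D.curr ∪ completed) k j u) :
      Step (.reduce fs D todo completed)
        (.reduce fs (D'.setPoly k (monic m h)) (todo.erase k) (insert k completed))
  | reduceSmaller (fs : List (Pol n K)) (D D' : Stage n K S R) (todo completed : Finset ℕ) (k : ℕ)
      (h : Pol n K) (hk : k ∈ todo) (hmin : ∀ k' ∈ todo, ¬ V.lt (D.sig k') (D.sig k))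
      (hh : IsNormalForm m D.B (D.poly k) h) (hD' : D' = D.setPoly k h) (h0 : h ≠ 0)
      (j : ℕ) (u : Mon n) (hJ : IsReductor V D' (D.curr ∪ completed) k j u) (p : Pol n K)
      (hp : p = h - monomial u (m.leadingCoeff h / m.leadingCoeff (D'.poly j)) * D'.poly j)
      (hsmall : V.lt (V.mul u (D'.sig j)) (D'.sig k)) :
      Step (.reduce fs D todo completed)
        (.reduce fs (D'.setPoly k (monic m p)) todo completed)
  | reduceLarger (fs : List (Pol n K)) (D D' : Stage n K S R) (todo completed : Finset ℕ) (k : ℕ)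
      (h : Pol n K) (hk : k ∈ todo) (hmin : ∀ k' ∈ todo, ¬ V.lt (D.sig k') (D.sig k))
      (hh : IsNormalForm m D.B (D.poly k) h) (hD' : D' = D.setPoly k h) (h0 : h ≠ 0)
      (j : ℕ) (u : Mon n) (hJ : IsReductor V D' (D.curr ∪ completed) k j u) (p : Pol n K)
      (hp : p = h - monomial u (m.leadingCoeff h / m.leadingCoeff (D'.poly j)) * D'.poly j)
      (hlarge : ¬ V.lt (V.mul u (D'.sig j)) (D'.sig k)) :
      Step (.reduce fs D todo completed)
        (.reduce fs (D'.append V (V.mul u (D'.sig j)) (monic m p))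
          (insert D'.r.length todo) completed)
  | reduceEnd (fs : List (Pol n K)) (D : Stage n K S R) (completed : Finset ℕ) :
      Step (.reduce fs D ∅ completed) (.update fs D completed)
  | update (fs : List (Pol n K)) (D : Stage n K S R) (Q : Finset ℕ) (k : ℕ) (hk : k ∈ Q) :
      Step (.update fs D Q)
        (.update fs
          { D with
            pairs := D.pairs ∪ D.curr.biUnion fun j => critPair V D k j
            curr := insert k D.curr }
          (Q.erase k))
  | updateEnd (fs : List (Pol n K)) (D : Stage n K S R) :
      Step (.update fs D ∅) (.loop fs D)

/-- The configuration `c` can occur in a run on the input `F`. -/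
def Reaches (F : List (Pol n K)) (c : Config n K S R) : Prop :=
  Relation.ReflTransGen (Step V) (.start F) c

/-- Some run on the input `F` returns `B`. -/
def Returns (F : List (Pol n K)) (B : Set (Pol n K)) : Prop :=
  Reaches V F (.done B)

/-- Every run on the input `F` comes to an end after finitely many steps, by returning a value. -/
def Terminates (F : List (Pol n K)) : Prop :=
  (¬ ∃ c : ℕ → Config n K S R, c 0 = .start F ∧ ∀ i, Step V (c i) (c (i + 1))) ∧
  ∀ c, Reaches V F c → (∀ c', ¬ Step V c c') → ∃ B, c = .done B

end Algorithm

/-- The data of the stage that a configuration is in, if it is inside Partial_Basis. -/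
def Config.stage? {n : ℕ} {K : Type*} [Field K] {S R : Type} :
    Config n K S R → Option (Stage n K S R)
  | .loop _ D => some D
  | .spol _ D _ _ => some D
  | .reduce _ D _ _ => some D
  | .update _ D _ => some D
  | _ => none

/-! ### The original F5C, with Setup_Reduced_Basis -/

section Original

/-- The signature `μ e_ν` is the pair `(μ, ν)`. -/
abbrev OSig (n : ℕ) := Mon n × ℕ

/-- One list of rules for each index `ν`. A rule is a pair of a monomial and the index of a labeled
polynomial; `none` is the phantom polynomial. The most recent rule is the last one. -/
abbrev ORules (n : ℕ) := List (List (Mon n × Option ℕ))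

variable {n : ℕ} {K : Type*} [Field K]

/-- Find_Rewriting. -/
noncomputable def origFindRewriting (D : Stage n K (OSig n) (ORules n)) (u : Mon n) (k : ℕ) :
    Option ℕ :=
  match (D.rules.getD (D.sig k).2 []).reverse.find? fun ρ => decide (ρ.1 ≤ u + (D.sig k).1) with
  | some ρ => ρ.2
  | none => some k

/-- Is_Rewritable. -/
def OrigRewritable (D : Stage n K (OSig n) (ORules n)) (u : Mon n) (k : ℕ) : Prop :=
  origFindRewriting D u k ≠ some k

/-- The effect of Setup_Reduced_Basis once the interreduction `B` has been computed. -/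
def SetupReducedBasis (m : MonomialOrder (Fin n)) (B : Set (Pol n K)) (prev : Finset ℕ)
    (r : List (Labeled n K (OSig n))) (rules : ORules n) : Prop :=
  ∃ b : List (Pol n K), b.Nodup ∧ {p | p ∈ b} = B ∧
    prev = Finset.range b.length ∧
    r = b.mapIdx (fun j p => ⟨(0, j), p⟩) ∧
    rules = (List.range b.length).map fun k => (List.range k).map fun j =>
      (m.degree (b.getD j 0) ⊔ m.degree (b.getD k 0) - m.degree (b.getD k 0), none)

variable (K) in
/-- The original F5C. -/
noncomputable def original (m : MonomialOrder (Fin n)) : Version m K (OSig n) (ORules n) where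
  mul u s := (u + s.1, s.2)
  lt s s' := s.2 < s'.2 ∨ (s.2 = s'.2 ∧ m.toSyn s.1 < m.toSyn s'.1)
  first := (0, 0)
  unit k := (0, k)
  addRule s k rules := rules.modify s.2 fun l => l ++ [(s.1, some k)]
  initRules := [[]]
  openRules rules := rules ++ [[]]
  critReject D u k := (D.sig k).2 = D.idx ∧ D.TopRedByPrev m (u + (D.sig k).1)
  spolReject D u k := OrigRewritable D u k
  reductorReject D u j := OrigRewritable D u j ∨ D.TopRedByPrev m (u + (D.sig j).1)
  restart _ B prev r rules := SetupReducedBasis m B prev r rules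

end Original

/-! ### The reformulation without Setup_Reduced_Basis -/

section WithoutSetup

/-- A signature is just a monomial, because only the polynomials of one stage, all of the same
index, have one. The polynomials indexed by `G_prev` have no signature, which is `none`. -/
abbrev MSig (n : ℕ) := Option (Mon n)

/-- A single list of rules; the most recent rule is the last one. -/
abbrev MRules (n : ℕ) := List (Mon n × ℕ)

/-- What `G_prev` refers to in the next stage: either the reduced basis `B`, or all of `G_curr`, in
which case `B` serves only to compute normal forms. -/
inductive PrevChoice
  | reduced
  | unreduced

variable {n : ℕ} {K : Type*} [Field K]

/-- No signature is smaller than every signature. -/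
def MSig.lt (m : MonomialOrder (Fin n)) : MSig n → MSig n → Prop
  | none, some _ => True
  | some a, some b => m.toSyn a < m.toSyn b
  | _, none => False

/-- The monomial of the signature. (It is only looked at for polynomials not in `G_prev`.) -/
def MSig.mon (s : MSig n) : Mon n := s.getD 0

/-- Find_Rewriting. -/
noncomputable def findRewriting (D : Stage n K (MSig n) (MRules n)) (u : Mon n) (k : ℕ) : ℕ :=
  match D.rules.reverse.find? fun ρ => decide (ρ.1 ≤ u + MSig.mon (D.sig k)) with
  | some ρ => ρ.2
  | none => k

/-- Is_Rewritable. -/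
def Rewritable (D : Stage n K (MSig n) (MRules n)) (u : Mon n) (k : ℕ) : Prop :=
  findRewriting D u k ≠ k

variable (K) in
/-- The reformulated algorithm: all criteria are checked only for indices outside `G_prev`, there
is a single rule list, which is empty at the beginning of each stage, and the elements of `G_prev`
have no signatures. -/
noncomputable def withoutSetup (m : MonomialOrder (Fin n)) (c : PrevChoice) :
    Version m K (MSig n) (MRules n) where
  mul u s := s.map fun a => u + a
  lt s s' := MSig.lt m s s'
  first := none
  unit _ := some 0
  addRule s k rules := rules ++ [(MSig.mon s, k)]
  initRules := []
  openRules _ := []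
  critReject D u k := k ∉ D.prev ∧ D.TopRedByPrev m (u + MSig.mon (D.sig k))
  spolReject D u k := k ∉ D.prev ∧ Rewritable D u k
  reductorReject D u j :=
    j ∉ D.prev ∧ (Rewritable D u j ∨ D.TopRedByPrev m (u + MSig.mon (D.sig j)))
  restart D B prev r rules :=
    rules = [] ∧
    match c with
    | .reduced => ∃ b : List (Pol n K), b.Nodup ∧ {p | p ∈ b} = B ∧
        prev = Finset.range b.length ∧ r = b.map fun p => ⟨none, p⟩
    | .unreduced => prev = D.curr ∧ r = D.r.map fun x => ⟨none, x.poly⟩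

end WithoutSetup

end F5C

/-! Fix a stage with previous ideal I and new input f, homogeneous of degree d. Modulo I, a
polynomial p ≡ a·f has the head monomial of a as a signature (`Rep`). Call (σ, τ) optimal (`Opt`) if
τ is the head of a polynomial of signature σ but of none of smaller signature. Then σ is not a
syzygy signature, τ is the least head for σ, and every head monomial of I + ⟨f⟩ is a head of I or
such a τ (`exists_opt_of_mem_sup`).

Correctness. The algorithm works degree by degree. For each σ that is not top-reducible by `G_prev`,
the most recent rule dividing σ selects one multiple of a labeled polynomial. Below the current
degree this multiple has the optimal head (`Core.opt`). Otherwise its head would also occur at a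
smaller signature or in I; the two multiples with this common head are not rejected, so their
critical pair would still be pending, although pending pairs have at least the current degree. Once
no pair is left this holds in every degree, so `G_curr` is a Gröbner basis of I + ⟨f⟩.

Termination. By Dickson's lemma the optimal pairs are multiples of finitely many pairs M, and
homogeneity forces signature and head to be multiplied by the same monomial (`Opt.ratio_eq`). The
rank of σ counts the members of M with smaller ratio signature/head. A new signature u·s arises from
an optimal s by a multiplier that destroys optimality, so its rank exceeds that of s (`rank_lt`),
while deg u is at most a constant C of the stage (`Core.degree_multiplier_le`). Hence every recorded
signature has degree at most C·|M|. Recorded signatures are distinct, so a stage creates a bounded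
number of polynomials (`Core.exists_length_le`), and a lexicographic measure decreases at every
step. A run cannot get stuck either, because every Gröbner basis has an interreduction.

The claims about `Rules` are components of the invariant `Core`. -/

open MonomialOrder

namespace F5C

/-! ### Head terms, reduction, Gröbner bases and interreduction -/

section Polynomials

variable {n : ℕ} {K : Type*} [Field K] {m : MonomialOrder (Fin n)}

theorem degree_monomial_mul {u : Mon n} {c : K} {p : Pol n K} (hc : c ≠ 0) (hp : p ≠ 0) :
    m.degree (monomial u c * p) = u + m.degree p := by
  classical
  rw [m.degree_mul (by simpa using hc) hp, m.degree_monomial, if_neg hc]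

theorem leadingCoeff_monomial_mul {u : Mon n} {c : K} {p : Pol n K} :
    m.leadingCoeff (monomial u c * p) = c * m.leadingCoeff p := by
  simp

theorem isHomogeneous_monomial_mul {u : Mon n} {c : K} {p : Pol n K} {e : ℕ}
    (hp : p.IsHomogeneous e) : (monomial u c * p).IsHomogeneous (u.degree + e) :=
  (isHomogeneous_monomial c rfl).mul hp

theorem degree_degree_of_isHomogeneous {p : Pol n K} {e : ℕ} (hp : p.IsHomogeneous e)
    (h0 : p ≠ 0) : (m.degree p).degree = e := by
  by_contra h
  exact m.coeff_degree_ne_zero_iff.2 h0 (hp.coeff_eq_zero h)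

theorem monic_zero : monic m (0 : Pol n K) = 0 := by simp [monic]

theorem monic_ne_zero {p : Pol n K} (hp : p ≠ 0) : monic m p ≠ 0 := by
  simp [monic, hp]

theorem degree_monic (p : Pol n K) : m.degree (monic m p) = m.degree p := by
  by_cases hp : p = 0
  · simp [hp, monic_zero]
  · have h : (m.leadingCoeff p)⁻¹ ≠ 0 := by simpa using hp
    simpa [monic] using degree_monomial_mul (m := m) (u := 0) h hp

theorem leadingCoeff_monic {p : Pol n K} (hp : p ≠ 0) : m.leadingCoeff (monic m p) = 1 := by
  have h : m.leadingCoeff p ≠ 0 := by simpa using hp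
  simp [monic, h]

theorem isHomogeneous_monic {p : Pol n K} {e : ℕ} (hp : p.IsHomogeneous e) :
    (monic m p).IsHomogeneous e := by
  simpa [monic] using hp.C_mul (m.leadingCoeff p)⁻¹

theorem span_monic {p : Pol n K} (hp : p ≠ 0) :
    Ideal.span {monic m p} = Ideal.span {p} := by
  refine Ideal.span_singleton_eq_span_singleton.2 ?_
  have h : m.leadingCoeff p ≠ 0 := by simpa using hp
  refine (associated_unit_mul_right p (C (m.leadingCoeff p)⁻¹) ?_).symm
  exact IsUnit.map C (by simpa using h)

/-- Cancelling equal head terms. -/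
theorem degree_sub_lt_of_head {p q : Pol n K} (hd : m.degree p = m.degree q)
    (hc : m.leadingCoeff p = m.leadingCoeff q) :
    p - q = 0 ∨ m.degree (p - q) ≺[m] m.degree p := by
  by_cases h0 : p - q = 0
  · exact Or.inl h0
  refine Or.inr (lt_of_le_of_ne ?_ ?_)
  · have := m.degree_sub_le (f := p) (g := q)
    rwa [← hd, sup_idem] at this
  · intro h
    have h1 := m.toSyn.injective h
    apply m.coeff_degree_ne_zero_iff.2 h0
    rw [h1, coeff_sub]
    have : coeff (m.degree p) q = m.leadingCoeff q := by rw [hd]; rfl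
    rw [this, ← hc]
    exact sub_self _

/-- The result of a top-reduction is zero or has a smaller head monomial. -/
theorem degree_topReduce_lt {h g : Pol n K} {u : Mon n} (hh : h ≠ 0) (hg : g ≠ 0)
    (hu : m.degree h = u + m.degree g) :
    h - monomial u (m.leadingCoeff h / m.leadingCoeff g) * g = 0 ∨
      m.degree (h - monomial u (m.leadingCoeff h / m.leadingCoeff g) * g) ≺[m] m.degree h := by
  have h1 : m.leadingCoeff h ≠ 0 := by simpa using hh
  have h2 : m.leadingCoeff g ≠ 0 := by simpa using hg
  apply degree_sub_lt_of_head
  · rw [hu, degree_monomial_mul (div_ne_zero h1 h2) hg]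
  · rw [leadingCoeff_monomial_mul, div_mul_cancel₀ _ h2]

/-! ### Reduction -/

theorem Red.exists_eq_sub {G : Set (Pol n K)} {p q : Pol n K} (h : Red m G p q) :
    ∃ g ∈ G, ∃ a ∈ p.support, ∃ (u : Mon n) (c : K), g ≠ 0 ∧ c ≠ 0 ∧ u + m.degree g = a ∧
      q = p - monomial u c * g ∧ c * m.leadingCoeff g = coeff a p := by
  obtain ⟨g, hg, hg0, a, ha, hle, rfl⟩ := h
  have h2 : m.leadingCoeff g ≠ 0 := by simpa using hg0
  exact ⟨g, hg, a, ha, a - m.degree g, coeff a p / m.leadingCoeff g, hg0,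
    div_ne_zero (mem_support_iff.1 ha) h2, tsub_add_cancel_of_le hle, rfl, div_mul_cancel₀ _ h2⟩

theorem Red.sub_mem_span {G : Set (Pol n K)} {p q : Pol n K} (h : Red m G p q) :
    p - q ∈ Ideal.span G := by
  obtain ⟨g, hg, a, ha, u, c, -, -, -, rfl, -⟩ := h.exists_eq_sub
  rw [sub_sub_cancel]
  exact Ideal.mul_mem_left _ _ (Ideal.subset_span hg)

theorem Red.isHomogeneous {G : Set (Pol n K)} {p q : Pol n K} (h : Red m G p q)
    (hG : ∀ g ∈ G, ∃ d : ℕ, g.IsHomogeneous d) {e : ℕ} (hp : p.IsHomogeneous e) :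
    q.IsHomogeneous e := by
  obtain ⟨g, hg, a, ha, u, c, hg0, -, hu, rfl, -⟩ := h.exists_eq_sub
  obtain ⟨d, hd⟩ := hG g hg
  refine hp.sub ?_
  have h1 := isHomogeneous_monomial_mul (u := u) (c := c) hd
  have h2 : a.degree = e := by
    by_contra hne
    exact mem_support_iff.1 ha (hp.coeff_eq_zero hne)
  rwa [← h2, ← hu, map_add, degree_degree_of_isHomogeneous hd hg0]

/-- A reduction step at the monomial `a` removes `a` and leaves everything above `a` alone. -/
theorem Red.exists_coeff {G : Set (Pol n K)} {p q : Pol n K} (h : Red m G p q) :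
    ∃ a ∈ p.support, (∃ g ∈ G, g ≠ 0 ∧ m.degree g ≤ a) ∧ coeff a q = 0 ∧
      ∀ b, a ≺[m] b → coeff b q = coeff b p := by
  obtain ⟨g, hg, a, ha, u, c, hg0, hc, hu, rfl, hcoef⟩ := h.exists_eq_sub
  refine ⟨a, ha, ⟨g, hg, hg0, hu ▸ le_add_self⟩, ?_, fun b hb => ?_⟩
  · rw [coeff_sub, sub_eq_zero, ← hcoef, ← leadingCoeff_monomial_mul (u := u),
      MonomialOrder.leadingCoeff, degree_monomial_mul hc hg0, hu]
  · rw [coeff_sub, m.coeff_eq_zero_of_lt (f := monomial u c * g), sub_zero]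
    rwa [degree_monomial_mul hc hg0, hu]

theorem Red.degree_le {G : Set (Pol n K)} {p q : Pol n K} (h : Red m G p q) :
    m.degree q ≼[m] m.degree p := by
  obtain ⟨a, ha, -, -, hb⟩ := h.exists_coeff
  by_contra hlt
  rw [not_le] at hlt
  have h1 := hb _ (lt_of_le_of_lt (m.le_degree ha) hlt)
  rw [m.coeff_eq_zero_of_lt hlt, m.coeff_degree_eq_zero_iff] at h1
  rw [h1, m.degree_zero, map_zero] at hlt
  exact absurd (m.zero_le _) (not_le.2 hlt)

section ReflTransGen

variable {G : Set (Pol n K)} {p q : Pol n K} (h : Relation.ReflTransGen (Red m G) p q)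
include h

theorem sub_mem_span_of_reds : p - q ∈ Ideal.span G := by
  induction h with
  | refl => simp
  | tail _ h ih => simpa using add_mem ih h.sub_mem_span

theorem isHomogeneous_of_reds (hG : ∀ g ∈ G, ∃ d : ℕ, g.IsHomogeneous d) {e : ℕ}
    (hp : p.IsHomogeneous e) : q.IsHomogeneous e := by
  induction h with
  | refl => exact hp
  | tail _ h ih => exact h.isHomogeneous hG ih

theorem degree_le_of_reds : m.degree q ≼[m] m.degree p := by
  induction h with
  | refl => exact le_rfl
  | tail _ h ih => exact h.degree_le.trans ih

end ReflTransGen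

/-- Irreducibility depends only on the head monomials of `G`, so exchanging an element of `G` for
another with the same head does not affect it. -/
theorem not_red_iff {G : Set (Pol n K)} {h : Pol n K} :
    (∀ q, ¬ Red m G h q) ↔
      ∀ a ∈ h.support, ∀ g ∈ G, g ≠ 0 → ¬ m.degree g ≤ a := by
  constructor
  · intro H a ha g hg hg0 hle
    exact H _ ⟨g, hg, hg0, a, ha, hle, rfl⟩
  · rintro H q ⟨g, hg, hg0, a, ha, hle, -⟩
    exact H a ha g hg hg0 hle

/-- A reduction at the largest reducible monomial leaves only smaller reducible ones. The induction
runs over a strict upper bound `x` of the reducible monomials; `⊤` serves as the initial bound. -/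
theorem exists_isNormalForm (m : MonomialOrder (Fin n)) (G : Set (Pol n K)) (p : Pol n K) :
    ∃ h, IsNormalForm m G p h := by
  classical
  suffices H : ∀ (x : WithTop m.syn) (p : Pol n K),
      (∀ a ∈ p.support, (∃ g ∈ G, g ≠ 0 ∧ m.degree g ≤ a) → ((m.toSyn a : m.syn) : WithTop m.syn) < x) →
      ∃ h, IsNormalForm m G p h from H ⊤ p fun _ _ _ => WithTop.coe_lt_top _
  intro x
  induction x using WellFoundedLT.induction with
  | _ x ih =>
  intro p hp
  by_cases hne : (p.support.filter fun a => ∃ g ∈ G, g ≠ 0 ∧ m.degree g ≤ a).Nonempty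
  · obtain ⟨a, ha, hmax⟩ := Finset.exists_max_image _ (fun a => m.toSyn a) hne
    obtain ⟨hap, g, hg, hg0, hle⟩ := Finset.mem_filter.1 ha
    have hstep : Red m G p (p - monomial (a - m.degree g) (coeff a p / m.leadingCoeff g) * g) :=
      ⟨g, hg, hg0, a, hap, hle, rfl⟩
    set q := p - monomial (a - m.degree g) (coeff a p / m.leadingCoeff g) * g
    have h2 : m.leadingCoeff g ≠ 0 := by simpa using hg0
    have hdeg : m.degree (monomial (a - m.degree g) (coeff a p / m.leadingCoeff g) * g) = a := by
      rw [degree_monomial_mul (div_ne_zero (mem_support_iff.1 hap) h2) hg0,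
        tsub_add_cancel_of_le hle]
    obtain ⟨h, hh, hirr⟩ := ih (m.toSyn a : m.syn) (hp a hap ⟨g, hg, hg0, hle⟩) q (by
      intro b hb hred
      rw [WithTop.coe_lt_coe]
      by_contra hlt
      rw [not_lt] at hlt
      rcases hlt.lt_or_eq with hlt | heq
      · have h3 : b ∈ p.support := by
          rw [mem_support_iff] at hb ⊢
          rwa [coeff_sub, m.coeff_eq_zero_of_lt
            (f := monomial (a - m.degree g) (coeff a p / m.leadingCoeff g) * g)
            (hdeg.symm ▸ hlt), sub_zero] at hb
        exact absurd (hmax b (Finset.mem_filter.2 ⟨h3, hred⟩)) (not_le.2 hlt)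
      · have hab := m.toSyn.injective heq
        subst hab
        apply mem_support_iff.1 hb
        have h4 := leadingCoeff_monomial_mul (m := m) (u := a - m.degree g)
          (c := coeff a p / m.leadingCoeff g) (p := g)
        rw [MonomialOrder.leadingCoeff, hdeg, div_mul_cancel₀ _ h2] at h4
        rw [coeff_sub, h4, sub_self])
    exact ⟨h, Relation.ReflTransGen.head hstep hh, hirr⟩
  · refine ⟨p, Relation.ReflTransGen.refl, not_red_iff.2 fun a ha g hg hg0 hle => hne ?_⟩
    exact ⟨a, Finset.mem_filter.2 ⟨ha, g, hg, hg0, hle⟩⟩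

/-! ### Gröbner bases and interreduction -/

theorem isNormalForm_eq_zero {I : Ideal (Pol n K)} {G : Set (Pol n K)} (hGI : G ⊆ I)
    (hlt : ∀ p ∈ I, p ≠ 0 → ∃ g ∈ G, g ≠ 0 ∧ m.degree g ≤ m.degree p) {p h : Pol n K}
    (hp : p ∈ I) (hh : IsNormalForm m G p h) : h = 0 := by
  by_contra h0
  have hI : h ∈ I := by
    have := Ideal.span_le.2 hGI (sub_mem_span_of_reds hh.1)
    simpa using sub_mem hp this
  obtain ⟨g, hg, hg0, hle⟩ := hlt h hI h0
  exact not_red_iff.1 hh.2 _ (m.degree_mem_support h0) g hg hg0 hle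

/-- Generation of `I` comes for free: an element of `I` has normal form 0, so it lies in the span of
`G`. -/
theorem isGroebnerBasis_of_degree {I : Ideal (Pol n K)} {G : Set (Pol n K)} (hfin : G.Finite)
    (hGI : G ⊆ I) (hlt : ∀ p ∈ I, p ≠ 0 → ∃ g ∈ G, g ≠ 0 ∧ m.degree g ≤ m.degree p) :
    IsGroebnerBasis m I G := by
  refine ⟨hfin, hGI, le_antisymm (Ideal.span_le.2 hGI) fun p hp => ?_, hlt⟩
  obtain ⟨h, hh⟩ := exists_isNormalForm m G p
  have h0 := isNormalForm_eq_zero hGI hlt hp hh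
  simpa [h0] using sub_mem_span_of_reds hh.1

/-- If an element is reduced at its head, the reducing element has a head dividing it and takes over
its role; if it is reduced below its head, the head survives. -/
theorem IsGroebnerBasis.interStep {I : Ideal (Pol n K)} {G G' : Set (Pol n K)}
    (hG : IsGroebnerBasis m I G) (h : InterStep m G G') : IsGroebnerBasis m I G' := by
  obtain ⟨hfin, hGI, -, hlt⟩ := hG
  cases h with
  | reduce g h hg hr =>
    refine isGroebnerBasis_of_degree ((hfin.subset Set.sdiff_subset).insert _) ?_ ?_
    · refine Set.insert_subset ?_ (Set.sdiff_subset.trans hGI)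
      have h1 := Ideal.span_le.2 (Set.sdiff_subset.trans hGI) hr.sub_mem_span
      simpa using sub_mem (hGI hg) h1
    · intro p hp hp0
      obtain ⟨g1, hg1, hg10, hle⟩ := hlt p hp hp0
      by_cases hgg : g1 = g
      · subst hgg
        obtain ⟨a, ha, ⟨g2, hg2, hg20, hle2⟩, -, hb⟩ := hr.exists_coeff
        by_cases hag : a = m.degree g1
        · exact ⟨g2, Or.inr hg2, hg20, (hag ▸ hle2).trans hle⟩
        · have hlt1 : a ≺[m] m.degree g1 :=
            lt_of_le_of_ne (m.le_degree ha) fun h => hag (m.toSyn.injective h)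
          have h1 := hb _ hlt1
          have h2 : m.degree g1 ∈ h.support := by
            rw [mem_support_iff, h1]; exact m.coeff_degree_ne_zero_iff.2 hg10
          have h3 : m.degree h = m.degree g1 :=
            m.toSyn.injective (le_antisymm hr.degree_le (m.le_degree h2))
          refine ⟨h, Or.inl rfl, ?_, h3 ▸ hle⟩
          rintro rfl
          simp at h2
      · exact ⟨g1, Or.inr ⟨hg1, hgg⟩, hg10, hle⟩
  | drop h0 =>
    refine isGroebnerBasis_of_degree (hfin.subset Set.sdiff_subset)
      (Set.sdiff_subset.trans hGI) fun p hp hp0 => ?_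
    obtain ⟨g1, hg1, hg10, hle⟩ := hlt p hp hp0
    exact ⟨g1, ⟨hg1, hg10⟩, hg10, hle⟩
  | normalise g hg hg0 =>
    refine isGroebnerBasis_of_degree ((hfin.subset Set.sdiff_subset).insert _) ?_ ?_
    · exact Set.insert_subset (Ideal.mul_mem_left _ _ (hGI hg)) (Set.sdiff_subset.trans hGI)
    · intro p hp hp0
      obtain ⟨g1, hg1, hg10, hle⟩ := hlt p hp hp0
      by_cases hgg : g1 = g
      · subst hgg
        exact ⟨_, Or.inl rfl, monic_ne_zero hg0, by rwa [degree_monic]⟩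
      · exact ⟨g1, Or.inr ⟨hg1, hgg⟩, hg10, hle⟩

theorem IsGroebnerBasis.interreduction {I : Ideal (Pol n K)} {G B : Set (Pol n K)}
    (hG : IsGroebnerBasis m I G) (h : Relation.ReflTransGen (InterStep m) G B) :
    IsGroebnerBasis m I B := by
  induction h with
  | refl => exact hG
  | tail _ h ih => exact ih.interStep h

theorem isHomogeneous_of_interSteps {G B : Set (Pol n K)}
    (hG : ∀ g ∈ G, ∃ d : ℕ, g.IsHomogeneous d) (h : Relation.ReflTransGen (InterStep m) G B) :
    ∀ g ∈ B, ∃ d : ℕ, g.IsHomogeneous d := by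
  induction h with
  | refl => exact hG
  | tail _ h ih =>
    cases h with
    | reduce g h hg hr =>
      rintro x (rfl | hx)
      · obtain ⟨d, hd⟩ := ih g hg
        exact ⟨d, hr.isHomogeneous (fun y hy => ih y hy.1) hd⟩
      · exact ih x hx.1
    | drop h0 => exact fun x hx => ih x hx.1
    | normalise g hg hg0 =>
      rintro x (rfl | hx)
      · obtain ⟨d, hd⟩ := ih g hg
        exact ⟨d, isHomogeneous_monic hd⟩
      · exact ih x hx.1

/-- Reducing one element repeatedly is an interreduction, unless the element is absorbed. -/
theorem interSteps_of_reds {G : Set (Pol n K)} {g h : Pol n K} (hg : g ∉ G)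
    (hr : Relation.ReflTransGen (Red m G) g h) :
    Relation.ReflTransGen (InterStep m) (insert g G) G ∨
      h ∉ G ∧ Relation.ReflTransGen (InterStep m) (insert g G) (insert h G) := by
  induction hr with
  | refl => exact Or.inr ⟨hg, Relation.ReflTransGen.refl⟩
  | @tail b c _ hbc ih =>
    rcases ih with ih | ⟨hb, ih⟩
    · exact Or.inl ih
    · have hdiff : insert b G \ {b} = G := by simp [hb]
      have hst : InterStep m (insert b G) (insert c G) := by
        have := InterStep.reduce (insert b G) b c (Set.mem_insert _ _) (by rwa [hdiff])
        rwa [hdiff] at this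
      by_cases hc : c ∈ G
      · rw [Set.insert_eq_of_mem hc] at hst
        exact Or.inl (ih.tail hst)
      · exact Or.inr ⟨hc, ih.tail hst⟩

/-- If no head monomial of `G` divides another one, then `G` can be interreduced. -/
theorem exists_isInterreduction_of_minimal {G : Set (Pol n K)} (hfin : G.Finite)
    (h0 : (0 : Pol n K) ∉ G)
    (hmin : ∀ g ∈ G, ∀ g' ∈ G, m.degree g ≤ m.degree g' → g = g') :
    ∃ B, IsInterreduction m G B := by
  -- Induction on the number of elements that are not monic or are reducible by the others.
  obtain ⟨N, hN⟩ : ∃ N, {g ∈ G | ¬ (m.leadingCoeff g = 1 ∧ ∀ h, ¬ Red m (G \ {g}) g h)}.ncard = N :=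
    ⟨_, rfl⟩
  induction N using Nat.strong_induction_on generalizing G with
  | _ N ih =>
  by_cases hall : IsInterreduced m G
  · exact ⟨G, Relation.ReflTransGen.refl, hall⟩
  · obtain ⟨g, hg, hbad⟩ : ∃ g ∈ G, ¬ (m.leadingCoeff g = 1 ∧ ∀ h, ¬ Red m (G \ {g}) g h) := by
      by_contra H
      push Not at H
      exact hall fun g hg => ⟨(H g hg).1, (H g hg).2⟩
    obtain ⟨h, hh, hirr⟩ := exists_isNormalForm m (G \ {g}) g
    have hg0 : g ≠ 0 := fun h => h0 (h ▸ hg)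
    -- Minimality of the heads forbids a reduction at the head of `g`, so the head persists along
    -- the chain.
    have hkey : m.degree h = m.degree g ∧ h ≠ 0 := by
      clear hirr
      induction hh with
      | refl => exact ⟨rfl, hg0⟩
      | @tail b c _ hbc ihb =>
        obtain ⟨a, ha, ⟨g', hg', hg'0, hle⟩, -, hb⟩ := hbc.exists_coeff
        have hne : a ≠ m.degree b := by
          rintro rfl
          exact hg'.2 (hmin g' hg'.1 g hg (ihb.1 ▸ hle))
        have hlt1 : a ≺[m] m.degree b :=
          lt_of_le_of_ne (m.le_degree ha) fun h => hne (m.toSyn.injective h)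
        have h2 : m.degree b ∈ c.support := by
          rw [mem_support_iff, hb _ hlt1]; exact m.coeff_degree_ne_zero_iff.2 ihb.2
        refine ⟨?_, ?_⟩
        · rw [← ihb.1]
          exact m.toSyn.injective (le_antisymm hbc.degree_le (m.le_degree h2))
        · rintro rfl
          simp at h2
    have hnotin : ∀ x ∈ G \ {g}, m.degree x ≠ m.degree g := fun x hx hd =>
      hx.2 (hmin x hx.1 g hg hd.le)
    have hins : insert g (G \ {g}) = G := by simp [Set.insert_eq_of_mem hg]
    have hhn : h ∉ G \ {g} := fun hx => hnotin h hx hkey.1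
    have hmn : monic m h ∉ G \ {g} := fun hx => hnotin _ hx (by rw [degree_monic, hkey.1])
    have hsteps : Relation.ReflTransGen (InterStep m) G (insert (monic m h) (G \ {g})) := by
      have h1 : Relation.ReflTransGen (InterStep m) G (insert h (G \ {g})) := by
        -- Each intermediate polynomial has the head of `g`, hence is different from all other
        -- elements, and no step merges two elements of the set.
        have hpath : ∀ x, Relation.ReflTransGen (Red m (G \ {g})) g x →
            Relation.ReflTransGen (Red m (G \ {g})) x h →
            Relation.ReflTransGen (InterStep m) (insert x (G \ {g})) (insert h (G \ {g})) := by
          intro x hgx hxh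
          have hx : m.degree x = m.degree g := m.toSyn.injective
            (le_antisymm (degree_le_of_reds hgx) (hkey.1 ▸ degree_le_of_reds hxh))
          induction hxh using Relation.ReflTransGen.head_induction_on with
          | refl => exact Relation.ReflTransGen.refl
          | @head b c hbc hch ihb =>
            have hbn : b ∉ G \ {g} := fun hb => hnotin b hb hx
            have hdiff : insert b (G \ {g}) \ {b} = G \ {g} :=
              Set.insert_sdiff_self_of_notMem hbn
            have hst : InterStep m (insert b (G \ {g})) (insert c (G \ {g})) := by
              have := InterStep.reduce (insert b (G \ {g})) b c (Set.mem_insert _ _)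
                (by rwa [hdiff])
              rwa [hdiff] at this
            exact Relation.ReflTransGen.head hst (ihb (hgx.tail hbc) (m.toSyn.injective
              (le_antisymm (degree_le_of_reds (hgx.tail hbc))
                (hkey.1 ▸ degree_le_of_reds hch))))
        have := hpath g Relation.ReflTransGen.refl hh
        rwa [hins] at this
      refine h1.tail ?_
      have := InterStep.normalise (m := m) (insert h (G \ {g})) h (Set.mem_insert _ _) hkey.2
      rwa [Set.insert_sdiff_self_of_notMem hhn] at this
    set G' := insert (monic m h) (G \ {g}) with hG'
    have hdiffm : G' \ {monic m h} = G \ {g} := Set.insert_sdiff_self_of_notMem hmn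
    have hmd : m.degree (monic m h) = m.degree g := by rw [degree_monic, hkey.1]
    -- The heads are unchanged, so elements that were already in final form stay so, and the
    -- replacement of `g` joins them.
    have hmono : {x ∈ G' | ¬ (m.leadingCoeff x = 1 ∧ ∀ h, ¬ Red m (G' \ {x}) x h)} ⊆
        {x ∈ G | ¬ (m.leadingCoeff x = 1 ∧ ∀ h, ¬ Red m (G \ {x}) x h)} \ {g} := by
      rintro x ⟨hxG, hx⟩
      rcases hxG with rfl | hxG
      · refine absurd ⟨leadingCoeff_monic hkey.2, ?_⟩ hx
        rw [hdiffm]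
        rw [not_red_iff] at hirr ⊢
        intro a ha
        refine hirr a ?_
        rw [mem_support_iff] at ha ⊢
        intro h0
        simp [monic, h0] at ha
      · refine ⟨⟨hxG.1, fun hok => hx ⟨hok.1, ?_⟩⟩, hxG.2⟩
        have hok2 := not_red_iff.1 hok.2
        rw [not_red_iff]
        rintro a ha y ⟨hy | hy, hyx⟩ hy0 hle
        · subst hy
          exact hok2 a ha g ⟨hg, fun h => hxG.2 h.symm⟩ hg0 (hmd ▸ hle)
        · exact hok2 a ha y ⟨hy.1, hyx⟩ hy0 hle
    have hfin' : G'.Finite := (hfin.subset Set.sdiff_subset).insert _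
    have hlt : {x ∈ G' | ¬ (m.leadingCoeff x = 1 ∧ ∀ h, ¬ Red m (G' \ {x}) x h)}.ncard < N := by
      rw [← hN]
      refine lt_of_le_of_lt (Set.ncard_le_ncard hmono
        ((hfin.subset (Set.sep_subset _ _)).subset Set.sdiff_subset)) ?_
      exact Set.ncard_sdiff_singleton_lt_of_mem ⟨hg, hbad⟩ (hfin.subset (Set.sep_subset _ _))
    obtain ⟨B, hB1, hB2⟩ := ih _ hlt hfin' (by
        rintro (h1 | h1)
        · exact monic_ne_zero hkey.2 h1.symm
        · exact h0 h1.1) (by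
        rintro x (rfl | hx) y (rfl | hy) hle
        · rfl
        · rw [hmd] at hle
          exact absurd (hmin g hg y hy.1 hle).symm hy.2
        · rw [hmd] at hle
          exact absurd (hmin x hx.1 g hg hle) hx.2
        · exact hmin x hx.1 y hy.1 hle) rfl
    exact ⟨B, hsteps.trans hB1, hB2⟩

/-- Needed so that a run can always leave a stage. An element whose head is a multiple of another
head is superfluous, so it reduces to 0 by the rest and can be dropped; finitely many deletions
leave heads none of which divides another. -/
theorem IsGroebnerBasis.exists_isInterreduction {I : Ideal (Pol n K)} {G : Set (Pol n K)}
    (hG : IsGroebnerBasis m I G) : ∃ B, IsInterreduction m G B := by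
  obtain ⟨N, hN⟩ : ∃ N, G.ncard = N := ⟨_, rfl⟩
  induction N using Nat.strong_induction_on generalizing G with
  | _ N ih =>
  have hshrink : ∀ g ∈ G, Relation.ReflTransGen (InterStep m) G (G \ {g}) →
      ∃ B, IsInterreduction m G B := fun g hg hst => by
    obtain ⟨B, hB1, hB2⟩ := ih _ (hN ▸ Set.ncard_sdiff_singleton_lt_of_mem hg hG.1)
      (hG.interreduction hst) rfl
    exact ⟨B, hst.trans hB1, hB2⟩
  by_cases h0 : (0 : Pol n K) ∈ G
  · exact hshrink 0 h0 (.single (.drop G h0))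
  by_cases hmin : ∀ g ∈ G, ∀ g' ∈ G, m.degree g ≤ m.degree g' → g = g'
  · exact exists_isInterreduction_of_minimal hG.1 h0 hmin
  push Not at hmin
  obtain ⟨g, hg, g', hg', hle, hne⟩ := hmin
  refine hshrink g' hg' ?_
  have hG' : ∀ p ∈ I, p ≠ 0 → ∃ x ∈ G \ {g'}, x ≠ 0 ∧ m.degree x ≤ m.degree p := by
    intro p hp hp0
    obtain ⟨x, hx, hx0, hxp⟩ := hG.2.2.2 p hp hp0
    by_cases hxg : x = g'
    · subst hxg
      exact ⟨g, ⟨hg, hne⟩, fun h => h0 (h ▸ hg), hle.trans hxp⟩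
    · exact ⟨x, ⟨hx, hxg⟩, hx0, hxp⟩
  obtain ⟨h, hh⟩ := exists_isNormalForm m (G \ {g'}) g'
  have hz := isNormalForm_eq_zero (Set.sdiff_subset.trans hG.2.1) hG' (hG.2.1 hg') hh
  subst hz
  have hins : insert g' (G \ {g'}) = G := by simp [Set.insert_eq_of_mem hg']
  -- Either an intermediate result coincides with an element already present and disappears, or 0 is
  -- reached as a new element and is dropped.
  rcases interSteps_of_reds (by simp) hh.1 with h1 | ⟨h1, h2⟩
  · rwa [hins] at h1
  · rw [hins] at h2
    refine h2.tail ?_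
    have := InterStep.drop (m := m) (insert 0 (G \ {g'})) (Set.mem_insert _ _)
    rwa [Set.insert_sdiff_self_of_notMem h1] at this

end Polynomials

/-! ### Signatures modulo the previous ideal, optimal pairs and their rank -/

section Signatures

variable {n : ℕ} {K : Type*} [Field K] (m : MonomialOrder (Fin n)) (I : Ideal (Pol n K))
  (f : Pol n K) (d : ℕ)

/-- Modulo `I`, the homogeneous polynomial `p` is a multiple `a · f`, where the monomials of `a` are
at most `σ`, and `σ` has the coefficient `c`. If `c ≠ 0`, then `σ` is a signature of `p`. -/
def Rep (c : K) (σ : Mon n) (p : Pol n K) : Prop :=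
  p.IsHomogeneous (σ.degree + d) ∧ ∃ a : Pol n K, a.IsHomogeneous σ.degree ∧ coeff σ a = c ∧
    (∀ b ∈ a.support, b ≼[m] σ) ∧ p - a * f ∈ I

/-- `τ` is the smallest head monomial of a polynomial with signature `σ`, and `σ` is not the
signature of a syzygy. -/
def Opt (σ τ : Mon n) : Prop :=
  ∃ (p : Pol n K) (c : K), p ≠ 0 ∧ c ≠ 0 ∧ Rep m I f d c σ p ∧ m.degree p = τ ∧
    ∀ q, q ≠ 0 → Rep m I f d 0 σ q → m.degree q ≠ τ

variable {m I f d} {c c' : K} {σ σ' τ τ' u : Mon n} {p q : Pol n K}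

theorem Rep.linear (hp : Rep m I f d c σ p) (hq : Rep m I f d c' σ q) (s t : K) :
    Rep m I f d (s * c + t * c') σ (C s * p + C t * q) := by
  obtain ⟨hp, a, ha, rfl, hab, hap⟩ := hp
  obtain ⟨hq, b, hb, rfl, hbb, hbq⟩ := hq
  refine ⟨(hp.C_mul s).add (hq.C_mul t), C s * a + C t * b, (ha.C_mul s).add (hb.C_mul t),
    by simp, fun x hx => ?_, ?_⟩
  · have : x ∈ a.support ∨ x ∈ b.support := by
      by_contra h
      simp only [mem_support_iff, not_or, not_not] at h hx
      simp [h.1, h.2] at hx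
    exact this.elim (hab x) (hbb x)
  · have := add_mem (I.mul_mem_left (C s) hap) (I.mul_mem_left (C t) hbq)
    convert this using 1
    ring

theorem Rep.monomial_mul (hp : Rep m I f d c σ p) (u : Mon n) (s : K) :
    Rep m I f d (s * c) (u + σ) (monomial u s * p) := by
  obtain ⟨hp, a, ha, rfl, hab, hap⟩ := hp
  refine ⟨?_, monomial u s * a, ?_, ?_, fun x hx => ?_, ?_⟩
  · rw [map_add, add_assoc]
    exact isHomogeneous_monomial_mul hp
  · rw [map_add]
    exact isHomogeneous_monomial_mul ha
  · rw [coeff_monomial_mul]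
  · rw [mem_support_iff, coeff_monomial_mul'] at hx
    split_ifs at hx with hux
    · have h1 := hab (x - u) (mem_support_iff.2 (right_ne_zero_of_mul hx))
      calc m.toSyn x = m.toSyn u + m.toSyn (x - u) := by
            rw [← map_add, add_tsub_cancel_of_le hux]
        _ ≤ m.toSyn u + m.toSyn σ := by gcongr
        _ = m.toSyn (u + σ) := (map_add _ _ _).symm
    · exact absurd rfl hx
  · have := I.mul_mem_left (monomial u s) hap
    convert this using 1
    ring

theorem Rep.of_lt (hp : Rep m I f d c σ' p) (h : σ' ≺[m] σ) (hd : σ'.degree = σ.degree) :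
    Rep m I f d 0 σ p := by
  obtain ⟨hp, a, ha, -, hab, hap⟩ := hp
  refine ⟨hd ▸ hp, a, hd ▸ ha, ?_, fun b hb => (hab b hb).trans h.le, hap⟩
  by_contra hne
  exact absurd (hab σ (mem_support_iff.2 hne)) (not_le.2 h)

theorem Rep.of_mem (hp : p ∈ I) (hh : p.IsHomogeneous (σ.degree + d)) : Rep m I f d 0 σ p :=
  ⟨hh, 0, isHomogeneous_zero _ _ _, by simp, by simp, by simpa using hp⟩

theorem Rep.congr (hp : Rep m I f d c σ p) (hq : q.IsHomogeneous (σ.degree + d))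
    (h : p - q ∈ I) : Rep m I f d c σ q := by
  obtain ⟨hp, a, ha, hc, hab, hap⟩ := hp
  refine ⟨hq, a, ha, hc, hab, ?_⟩
  convert sub_mem hap h using 1
  ring

theorem Rep.self (hf : f.IsHomogeneous d) : Rep m I f d 1 0 f := by
  refine ⟨by simpa using hf, 1, by simpa using isHomogeneous_one _ _, by simp, ?_, by simp⟩
  intro b hb
  have : b = 0 := by
    simpa using hb
  rw [this]

/-- The trivial syzygy: if a is a multiple of `g` with head `σ`, then a·f lies in `I`. This
justifies rejecting signatures that are top-reducible by `G_prev`. -/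
theorem Rep.zero_of_mem {g : Pol n K} {e : ℕ} (hg : g ∈ I) (hg0 : g ≠ 0) (hh : g.IsHomogeneous e)
    (hle : m.degree g ≤ σ) : Rep m I f d 1 σ 0 := by
  have hlc : m.leadingCoeff g ≠ 0 := by simpa using hg0
  have hdeg : m.degree (monomial (σ - m.degree g) (m.leadingCoeff g)⁻¹ * g) = σ := by
    rw [degree_monomial_mul (inv_ne_zero hlc) hg0, tsub_add_cancel_of_le hle]
  refine ⟨isHomogeneous_zero _ _ _, monomial (σ - m.degree g) (m.leadingCoeff g)⁻¹ * g, ?_, ?_,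
    fun b hb => ?_, ?_⟩
  · have h := isHomogeneous_monomial_mul (u := σ - m.degree g) (c := (m.leadingCoeff g)⁻¹) hh
    rwa [← degree_degree_of_isHomogeneous hh hg0, ← map_add, tsub_add_cancel_of_le hle] at h
  · have h := leadingCoeff_monomial_mul (m := m) (u := σ - m.degree g)
      (c := (m.leadingCoeff g)⁻¹) (p := g)
    rwa [MonomialOrder.leadingCoeff, hdeg, inv_mul_cancel₀ hlc] at h
  · have := m.le_degree hb
    rwa [hdeg] at this
  · rw [zero_sub, neg_mem_iff]
    exact I.mul_mem_right _ (I.mul_mem_left _ hg)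

theorem Rep.mem_sup (hp : Rep m I f d c σ p) : p ∈ I ⊔ Ideal.span {f} := by
  obtain ⟨-, a, -, -, -, hap⟩ := hp
  rw [← sub_add_cancel p (a * f)]
  exact add_mem (Ideal.mem_sup_left hap)
    (Ideal.mem_sup_right (Ideal.mul_mem_left _ _ (Ideal.mem_span_singleton_self f)))

/-- Coefficient 0 at `σ` means that the multiplier of `f` has all its monomials below `σ`: its head
is a genuine smaller signature, unless the multiplier vanishes. -/
theorem Rep.exists_lt (hp : Rep m I f d 0 σ p) :
    p ∈ I ∨ ∃ σ', σ' ≺[m] σ ∧ σ'.degree = σ.degree ∧ ∃ c, c ≠ 0 ∧ Rep m I f d c σ' p := by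
  obtain ⟨hp, a, ha, hc, hab, hap⟩ := hp
  by_cases h0 : a = 0
  · left
    simpa [h0] using hap
  · right
    have hmem := m.degree_mem_support h0
    have hdeg := degree_degree_of_isHomogeneous (m := m) ha h0
    refine ⟨m.degree a, lt_of_le_of_ne (hab _ hmem) fun h => ?_, hdeg,
      coeff (m.degree a) a, mem_support_iff.1 hmem, hdeg ▸ hp, a, hdeg ▸ ha, rfl,
      fun b hb => m.le_degree hb, hap⟩
    rw [m.toSyn.injective h] at hmem
    exact mem_support_iff.1 hmem hc

theorem Rep.eliminate (hp : Rep m I f d c σ p) (hq : Rep m I f d c' σ q) (hc' : c' ≠ 0) :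
    Rep m I f d 0 σ (p - C (c / c') * q) := by
  have := hp.linear hq 1 (-(c / c'))
  rwa [one_mul, neg_mul, div_mul_cancel₀ _ hc', add_neg_cancel, C_1, one_mul, C_neg, neg_mul,
    ← sub_eq_add_neg] at this

/-- As long as the same head occurs at a smaller signature, pass to that signature; the descent
stops because the monomial order is a well-order. -/
theorem Rep.exists_opt (hc : c ≠ 0) (hp : Rep m I f d c σ p) (hp0 : p ≠ 0) :
    (∃ g ∈ I, g ≠ 0 ∧ m.degree g = m.degree p) ∨
      ∃ σ', σ' ≼[m] σ ∧ σ'.degree = σ.degree ∧ Opt m I f d σ' (m.degree p) := by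
  obtain ⟨x, hx⟩ : ∃ x, m.toSyn σ = x := ⟨_, rfl⟩
  induction x using WellFoundedLT.induction generalizing σ p c with
  | _ x ih =>
  by_cases h : ∃ q, q ≠ 0 ∧ Rep m I f d 0 σ q ∧ m.degree q = m.degree p
  · obtain ⟨q, hq0, hq, hqd⟩ := h
    rw [← hqd]
    rcases hq.exists_lt with hI | ⟨σ', hlt, hdeg, c', hc', hq'⟩
    · exact Or.inl ⟨q, hI, hq0, rfl⟩
    · rcases ih _ (hx ▸ hlt) hc' hq' hq0 rfl with h1 | ⟨σ'', hle, hdeg', ho⟩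
      · exact Or.inl h1
      · exact Or.inr ⟨σ'', hle.trans hlt.le, hdeg'.trans hdeg, ho⟩
  · push Not at h
    exact Or.inr ⟨σ, le_rfl, rfl, p, c, hp0, hc, hp, rfl, h⟩

theorem Rep.exists_opt_lt (hp : Rep m I f d 0 σ p) (hp0 : p ≠ 0) :
    (∃ g ∈ I, g ≠ 0 ∧ m.degree g = m.degree p) ∨
      ∃ σ', σ' ≺[m] σ ∧ σ'.degree = σ.degree ∧ Opt m I f d σ' (m.degree p) := by
  rcases hp.exists_lt with hI | ⟨σ', hlt, hdeg, c', hc', hp'⟩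
  · exact Or.inl ⟨p, hI, hp0, rfl⟩
  · rcases hp'.exists_opt hc' hp0 with h1 | ⟨σ'', hle, hdeg', ho⟩
    · exact Or.inl h1
    · exact Or.inr ⟨σ'', hle.trans_lt hlt, hdeg'.trans hdeg, ho⟩

theorem Opt.degree_eq (h : Opt m I f d σ τ) : τ.degree = σ.degree + d := by
  obtain ⟨p, c, hp0, -, hp, rfl, -⟩ := h
  exact degree_degree_of_isHomogeneous hp.1 hp0

theorem Opt.not_syzygy (h : Opt m I f d σ τ) (hc : c ≠ 0) : ¬ Rep m I f d c σ 0 := by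
  intro h0
  obtain ⟨p, c', hp0, -, hp, hd, hmin⟩ := h
  have := hp.eliminate h0 hc
  rw [mul_zero, sub_zero] at this
  exact hmin p hp0 this hd

/-- If `q` had a smaller head, subtracting a multiple of it from the optimal polynomial would remove
the signature `σ` but keep the head, against optimality. -/
theorem Opt.le (h : Opt m I f d σ τ) (hc : c ≠ 0) (hq : Rep m I f d c σ q) :
    τ ≼[m] m.degree q := by
  obtain ⟨p, c', hp0, hc', hp, rfl, hmin⟩ := h
  by_contra hlt
  rw [not_le] at hlt
  have hz : c' / c ≠ 0 := div_ne_zero hc' hc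
  have hlt' : m.degree (C (c' / c) * q) ≺[m] m.degree p := by
    refine lt_of_le_of_lt ?_ hlt
    have := m.degree_mul_le (f := C (c' / c)) (g := q)
    rwa [m.degree_C, zero_add] at this
  have hd := m.degree_sub_of_lt hlt'
  refine hmin _ ?_ (hp.eliminate hq hc) hd
  intro h0
  rw [sub_eq_zero] at h0
  rw [← h0] at hlt'
  exact lt_irrefl _ hlt'

theorem Opt.unique (h : Opt m I f d σ τ) (h' : Opt m I f d σ τ') : τ = τ' := by
  apply m.toSyn.injective
  obtain ⟨p, c, hp0, hc, hp, rfl, -⟩ := id h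
  obtain ⟨p', c', hp0', hc', hp', rfl, -⟩ := id h'
  exact le_antisymm (h.le hc' hp') (h'.le hc hp)

/-- Cancelling the head of `p` by `q` keeps the signature `σ`. The result is nonzero because `σ` is
not a syzygy signature, and its head bounds `τ`. -/
theorem Opt.lt (h : Opt m I f d σ τ) (hc : c ≠ 0) (hp : Rep m I f d c σ p) (hp0 : p ≠ 0)
    (hq : Rep m I f d 0 σ q) (hq0 : q ≠ 0) (hqp : m.degree q = m.degree p) :
    τ ≺[m] m.degree p := by
  have h1 : m.leadingCoeff p ≠ 0 := by simpa using hp0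
  have h2 : m.leadingCoeff q ≠ 0 := by simpa using hq0
  set s := m.leadingCoeff p / m.leadingCoeff q with hs
  have hr : Rep m I f d c σ (p - monomial 0 s * q) := by
    have := hp.linear hq 1 (-s)
    rwa [one_mul, mul_zero, add_zero, C_1, one_mul, C_neg, neg_mul, ← sub_eq_add_neg] at this
  rcases degree_topReduce_lt (u := 0) hp0 hq0 (by rw [zero_add, hqp]) with h0 | hlt
  · rw [← hs] at h0
    rw [h0] at hr
    exact absurd hr (h.not_syzygy hc)
  · exact lt_of_le_of_lt (h.le hc hr) hlt

theorem toSyn_add_lt_add_left {a b : Mon n} (c : Mon n) (h : a ≺[m] b) : c + a ≺[m] c + b := by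
  rw [map_add, map_add]
  gcongr

theorem toSyn_add_lt_add_right {a b : Mon n} (c : Mon n) (h : a ≺[m] b) : a + c ≺[m] b + c := by
  rw [map_add, map_add]
  gcongr

/-- If both signature and head monomial are multiples, then by the same factor. -/
theorem Opt.ratio_eq {v : Mon n} (h : Opt m I f d σ τ) (h' : Opt m I f d (u + σ) (v + τ)) :
    u = v := by
  obtain ⟨p, c, hp0, hc, hp, rfl, -⟩ := id h
  have hdeg : u.degree = v.degree := by
    have h1 := h.degree_eq
    have h2 := h'.degree_eq
    rw [map_add, map_add] at h2
    omega
  -- For u < v, the multiple u·p has the signature `u + σ` and too small a head; for v < u, the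
  -- multiple v·p reaches the head `v + τ` at a smaller signature. Equal degrees are needed to
  -- compare the signatures in the second case.
  rcases lt_trichotomy (m.toSyn u) (m.toSyn v) with hlt | heq | hlt
  · have h1 := h'.le (c := 1 * c) (by simpa using hc) (hp.monomial_mul u 1)
    rw [degree_monomial_mul one_ne_zero hp0] at h1
    exact absurd h1 (not_le.2 (toSyn_add_lt_add_right _ hlt))
  · exact m.toSyn.injective heq
  · obtain ⟨-, -, -, -, -, -, hmin⟩ := h'
    refine absurd (degree_monomial_mul one_ne_zero hp0) (hmin (monomial v 1 * p) ?_
      ((hp.monomial_mul v 1).of_lt (toSyn_add_lt_add_right _ hlt) ?_))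
    · simpa using hp0
    · rw [map_add, map_add, hdeg]

variable (m I f d) in
/-- Finitely many pairs (signature, smallest head monomial) divide all others. -/
theorem exists_finset_opt : ∃ M : Finset (Mon n × Mon n), (∀ a ∈ M, Opt m I f d a.1 a.2) ∧
    ∀ σ τ, Opt m I f d σ τ → ∃ a ∈ M, ∃ u, σ = u + a.1 ∧ τ = u + a.2 := by
  set S : Set (Mon n × Mon n) := {a | Opt m I f d a.1 a.2}
  -- Dickson's lemma on pairs of monomials: the minimal ones form an antichain. `Opt.ratio_eq` then
  -- turns divisibility in both components into multiplication by one common monomial.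
  have hfin : {a | Minimal (· ∈ S) a}.Finite :=
    WellQuasiOrderedLE.finite_of_isAntichain (setOfPred_minimal_antichain _)
  refine ⟨hfin.toFinset, fun a ha => ((Set.Finite.mem_toFinset _).1 ha).1, fun σ τ h => ?_⟩
  obtain ⟨a, hle, ha⟩ := exists_minimal_le_of_wellFoundedLT (· ∈ S) (σ, τ) h
  have h1 : a.1 ≤ σ := hle.1
  have h2 : a.2 ≤ τ := hle.2
  refine ⟨a, (Set.Finite.mem_toFinset _).2 ha, σ - a.1, ?_, ?_⟩
  · rw [tsub_add_cancel_of_le h1]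
  · have ho : Opt m I f d a.1 a.2 := ha.1
    have h' := h
    rw [← tsub_add_cancel_of_le h1, ← tsub_add_cancel_of_le h2] at h'
    rw [ho.ratio_eq h', tsub_add_cancel_of_le h2]

variable (m I f d) in
open Classical in
/-- The number of elements of `M` whose ratio of signature and head monomial is less than that of
the signature `σ`. -/
noncomputable def rank (M : Finset (Mon n × Mon n)) (σ : Mon n) : ℕ :=
  -- The comparison of a.1/a.2 with σ/τ, cross-multiplied. If `σ` has no optimal head, the condition
  -- is vacuous and all of `M` is counted.
  (M.filter fun a => ∀ τ, Opt m I f d σ τ → a.1 + τ ≺[m] σ + a.2).card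

theorem rank_le (M : Finset (Mon n × Mon n)) (σ : Mon n) : rank m I f d M σ ≤ M.card := by
  classical
  exact Finset.card_filter_le _ _

/-- A multiple whose optimal head is smaller than expected has a larger ratio. What was counted
stays counted, and the member of `M` that generates (σ, τ), having exactly the ratio of `σ`, is
counted in addition. -/
theorem rank_lt {M : Finset (Mon n × Mon n)}
    (hM : ∀ σ τ, Opt m I f d σ τ → ∃ a ∈ M, ∃ u, σ = u + a.1 ∧ τ = u + a.2)
    (h : Opt m I f d σ τ) (hlt : ∀ τ', Opt m I f d (u + σ) τ' → τ' ≺[m] u + τ) :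
    rank m I f d M σ < rank m I f d M (u + σ) := by
  classical
  obtain ⟨a, ha, w, rfl, rfl⟩ := hM σ τ h
  refine Finset.card_lt_card (Finset.ssubset_iff_of_subset ?_ |>.2 ⟨a, ?_, ?_⟩)
  · intro b hb
    obtain ⟨hb, hb'⟩ := Finset.mem_filter.1 hb
    refine Finset.mem_filter.2 ⟨hb, fun τ' hτ' => ?_⟩
    calc m.toSyn (b.1 + τ') < m.toSyn (b.1 + (u + (w + a.2))) :=
          toSyn_add_lt_add_left _ (hlt τ' hτ')
      _ = m.toSyn (u + (b.1 + (w + a.2))) := by rw [add_left_comm]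
      _ < m.toSyn (u + (w + a.1 + b.2)) := toSyn_add_lt_add_left _ (hb' _ h)
      _ = m.toSyn (u + (w + a.1) + b.2) := by rw [add_assoc u]
  · refine Finset.mem_filter.2 ⟨ha, fun τ' hτ' => ?_⟩
    calc m.toSyn (a.1 + τ') < m.toSyn (a.1 + (u + (w + a.2))) :=
          toSyn_add_lt_add_left _ (hlt τ' hτ')
      _ = m.toSyn (u + (w + a.1) + a.2) := by congr 1; abel
  · intro hb
    have h1 := (Finset.mem_filter.1 hb).2 _ h
    rw [show a.1 + (w + a.2) = w + a.1 + a.2 by abel] at h1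
    exact lt_irrefl _ h1

section Graded

attribute [local instance] MvPolynomial.gradedAlgebra

theorem homogeneousComponent_mul_of_isHomogeneous {a : Pol n K} (hf : f.IsHomogeneous d) (e : ℕ) :
    homogeneousComponent e (a * f) =
      if d ≤ e then homogeneousComponent (e - d) a * f else 0 := by
  have h := DirectSum.coe_decompose_mul_of_right_mem (𝒜 := homogeneousSubmodule (Fin n) K)
    (a := a) e hf
  simp only [← decomposition.decompose'_apply]
  exact h

/-- The head monomials of `I + ⟨f⟩`. -/
theorem exists_opt_of_mem_sup (hI : I.IsHomogeneous (homogeneousSubmodule (Fin n) K))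
    (hf : f.IsHomogeneous d) (hp : p ∈ I ⊔ Ideal.span {f}) (hp0 : p ≠ 0) :
    (∃ g ∈ I, g ≠ 0 ∧ m.degree g = m.degree p) ∨ ∃ σ, Opt m I f d σ (m.degree p) := by
  obtain ⟨i, hi, j, hj, rfl⟩ := Submodule.mem_sup.1 hp
  obtain ⟨a, rfl⟩ := Ideal.mem_span_singleton'.1 hj
  set p := i + a * f
  -- The homogeneous component in the degree of the head has the same head; since `I` is
  -- homogeneous, the problem reduces to this component.
  set e := (m.degree p).degree
  have hcoeff : coeff (m.degree p) (homogeneousComponent e p) = coeff (m.degree p) p := by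
    rw [coeff_homogeneousComponent, if_pos rfl]
  have hmem : m.degree p ∈ (homogeneousComponent e p).support := by
    rw [mem_support_iff, hcoeff]
    exact m.coeff_degree_ne_zero_iff.2 hp0
  have hq0 : homogeneousComponent e p ≠ 0 := by
    intro h
    rw [h] at hmem
    simp at hmem
  have hdeg : m.degree (homogeneousComponent e p) = m.degree p := by
    refine m.toSyn.injective (le_antisymm (m.degree_le_degree_of_support_subset ?_)
      (m.le_degree hmem))
    intro b hb
    rw [mem_support_iff, coeff_homogeneousComponent] at hb
    rw [mem_support_iff]
    split_ifs at hb with h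
    · exact hb
    · exact absurd rfl hb
  rw [← hdeg]
  have hhom : (homogeneousComponent e p).IsHomogeneous e := homogeneousComponent_isHomogeneous _ _
  have hsum : homogeneousComponent e p - homogeneousComponent e (a * f) ∈ I := by
    rw [map_add, add_sub_cancel_right]
    exact homogeneousComponent_mem_of_mem hI hi e
  rw [homogeneousComponent_mul_of_isHomogeneous hf] at hsum
  generalize homogeneousComponent e p = q at hq0 hhom hsum
  by_cases hz : (if d ≤ e then homogeneousComponent (e - d) a * f else 0) = 0
  · rw [hz, sub_zero] at hsum
    exact Or.inl ⟨q, hsum, hq0, rfl⟩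
  · have hde : d ≤ e := by
      by_contra h
      rw [if_neg h] at hz
      exact hz rfl
    rw [if_pos hde] at hsum hz
    have ha0 := left_ne_zero_of_mul hz
    have hah : (homogeneousComponent (e - d) a).IsHomogeneous (e - d) :=
      homogeneousComponent_isHomogeneous _ _
    generalize homogeneousComponent (e - d) a = a' at ha0 hah hsum
    have hda := degree_degree_of_isHomogeneous (m := m) hah ha0
    have hrep : Rep m I f d (m.leadingCoeff a') (m.degree a') q := by
      refine ⟨?_, a', hda.symm ▸ hah, rfl, fun b hb => m.le_degree hb, hsum⟩
      rwa [hda, Nat.sub_add_cancel hde]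
    rcases hrep.exists_opt (by simpa using ha0) hq0 with h | ⟨σ, -, -, h⟩
    · exact Or.inl h
    · exact Or.inr ⟨σ, h⟩

theorem isHomogeneous_span {S : Set (Pol n K)} (hS : ∀ g ∈ S, ∃ d : ℕ, g.IsHomogeneous d) :
    (Ideal.span S).IsHomogeneous (homogeneousSubmodule (Fin n) K) :=
  Ideal.homogeneous_span _ _ hS

end Graded

end Signatures

/-! ### Rule lists -/

section Rules

variable {n : ℕ}

/-- No rule that divides `σ` is more recent than the rule of the index `k`. -/
def Last (l : MRules n) (σ : Mon n) (k : ℕ) : Prop :=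
  (∀ ρ ∈ l, ¬ ρ.1 ≤ σ) ∨
    ∃ l₁ ρ l₂, l = l₁ ++ ρ :: l₂ ∧ ρ.2 = k ∧ ρ.1 ≤ σ ∧ ∀ ρ' ∈ l₂, ¬ ρ'.1 ≤ σ

theorem exists_last (l : MRules n) (σ : Mon n) :
    (∀ ρ ∈ l, ¬ ρ.1 ≤ σ) ∨ ∃ ρ ∈ l, ρ.1 ≤ σ ∧ Last l σ ρ.2 := by
  induction l using List.reverseRecOn with
  | nil => simp
  | append_singleton l ρ ih =>
    by_cases hρ : ρ.1 ≤ σ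
    · exact Or.inr ⟨ρ, by simp, hρ, Or.inr ⟨l, ρ, [], rfl, rfl, hρ, by simp⟩⟩
    · rcases ih with ih | ⟨ρ', hmem, hle, h | ⟨l₁, ρ'', l₂, rfl, h2, h3, h4⟩⟩
      · left
        intro x hx
        rcases List.mem_append.1 hx with hx | hx
        · exact ih x hx
        · rwa [List.mem_singleton.1 hx]
      · exact absurd hle (h _ hmem)
      · refine Or.inr ⟨ρ', List.mem_append_left _ hmem, hle,
          Or.inr ⟨l₁, ρ'', l₂ ++ [ρ], by simp, h2, h3, ?_⟩⟩
        intro x hx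
        rcases List.mem_append.1 hx with hx | hx
        · exact h4 x hx
        · rwa [List.mem_singleton.1 hx]

/-- A later rule belongs to another index and can only make `k` rewritable. Hence rejection by a
criterion is permanent. -/
theorem Last.of_append {l : MRules n} {σ : Mon n} {k : ℕ} {ρ : Mon n × ℕ}
    (h : Last (l ++ [ρ]) σ k) (hk : ρ.2 ≠ k) : Last l σ k ∧ ¬ ρ.1 ≤ σ := by
  rcases h with h | ⟨l₁, ρ', l₂, heq, h2, h3, h4⟩
  · exact ⟨Or.inl fun x hx => h x (List.mem_append_left _ hx), h ρ (by simp)⟩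
  · rcases List.eq_nil_or_concat l₂ with rfl | ⟨l₂, x, rfl⟩
    · have h5 := List.append_inj' heq rfl
      simp only [List.cons.injEq, and_true] at h5
      exact absurd (h5.2 ▸ h2) hk
    · have h5 : l ++ [ρ] = (l₁ ++ ρ' :: l₂) ++ [x] := by simpa using heq
      obtain ⟨h6, h7⟩ := List.append_inj' h5 rfl
      simp only [List.cons.injEq, and_true] at h7
      subst h7
      refine ⟨Or.inr ⟨l₁, ρ', l₂, h6, h2, h3, fun y hy => h4 y (by simp [hy])⟩, h4 ρ (by simp)⟩

variable {K : Type*} [Field K]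

abbrev MStage (n : ℕ) (K : Type*) [Field K] := Stage n K (MSig n) (MRules n)

theorem not_rewritable_iff {D : MStage n K} {u : Mon n} {k : ℕ} :
    ¬ Rewritable D u k ↔ Last D.rules (u + MSig.mon (D.sig k)) k := by
  unfold Rewritable findRewriting
  rw [not_not]
  cases hfind : D.rules.reverse.find? fun ρ => decide (ρ.1 ≤ u + MSig.mon (D.sig k)) with
  | none =>
    simp only [true_iff]
    left
    intro ρ hρ
    have := List.find?_eq_none.1 hfind ρ (List.mem_reverse.2 hρ)
    simpa using this
  | some ρ =>
    obtain ⟨h1, as, bs, h2, h3⟩ := List.find?_eq_some_iff_append.1 hfind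
    have h1 : ρ.1 ≤ u + MSig.mon (D.sig k) := by simpa using h1
    have h2' : D.rules = bs.reverse ++ ρ :: as.reverse := by
      rw [← List.reverse_reverse D.rules, h2]
      simp
    simp only
    constructor
    · rintro rfl
      refine Or.inr ⟨bs.reverse, ρ, as.reverse, h2', rfl, h1, fun x hx => ?_⟩
      simpa using h3 x (List.mem_reverse.1 hx)
    · rintro (h | ⟨l₁, ρ', l₂, heq, h4, h5, h6⟩)
      · exact absurd h1 (h ρ (by rw [h2']; simp))
      · have : D.rules.reverse = l₂.reverse ++ ρ' :: l₁.reverse := by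
          rw [heq]
          simp
        have h7 : D.rules.reverse.find? (fun ρ => decide (ρ.1 ≤ u + MSig.mon (D.sig k))) =
            some ρ' := by
          refine List.find?_eq_some_iff_append.2 ⟨by simpa using h5, _, _, this, fun x hx => ?_⟩
          simpa using h6 x (List.mem_reverse.1 hx)
        rw [hfind] at h7
        rw [Option.some.inj h7, h4]

end Rules

/-! ### The values of the variables after a modification -/

section Access

variable {n : ℕ} {K : Type*} [Field K] {S R : Type} [Inhabited S] {D : Stage n K S R}
  {k j : ℕ} {p : Pol n K} {s : S} {m : MonomialOrder (Fin n)} {V : Version m K S R}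

theorem poly_setPoly_self (hk : k < D.r.length) : (D.setPoly k p).poly k = p := by
  simp [Stage.poly, Stage.setPoly, List.getD_eq_getElem?_getD, hk]

theorem poly_setPoly_of_ne (h : j ≠ k) : (D.setPoly k p).poly j = D.poly j := by
  simp [Stage.poly, Stage.setPoly, List.getD_eq_getElem?_getD, List.getElem?_set_ne h.symm]

theorem sig_setPoly : (D.setPoly k p).sig j = D.sig j := by
  by_cases h : j = k
  · subst h
    by_cases hj : j < D.r.length
    · simp [Stage.sig, Stage.setPoly, List.getD_eq_getElem?_getD, hj]
    · simp [Stage.sig, Stage.setPoly, List.getD_eq_getElem?_getD, hj]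
  · simp [Stage.sig, Stage.setPoly, List.getD_eq_getElem?_getD, List.getElem?_set_ne (Ne.symm h)]

theorem length_setPoly : (D.setPoly k p).r.length = D.r.length := by
  simp [Stage.setPoly]

theorem poly_append_of_lt (h : j < D.r.length) : (D.append V s p).poly j = D.poly j := by
  simp [Stage.poly, Stage.append, List.getD_eq_getElem?_getD, List.getElem?_append_left h]

theorem poly_append_self : (D.append V s p).poly D.r.length = p := by
  simp [Stage.poly, Stage.append, List.getD_eq_getElem?_getD]

theorem sig_append_of_lt (h : j < D.r.length) : (D.append V s p).sig j = D.sig j := by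
  simp [Stage.sig, Stage.append, List.getD_eq_getElem?_getD, List.getElem?_append_left h]

theorem sig_append_self : (D.append V s p).sig D.r.length = s := by
  simp [Stage.sig, Stage.append, List.getD_eq_getElem?_getD]

omit [Inhabited S] in
theorem length_append : (D.append V s p).r.length = D.r.length + 1 := by
  simp [Stage.append]

end Access

/-! ### The invariant -/

section Invariant

variable {n : ℕ} {K : Type*} [Field K] (m : MonomialOrder (Fin n))

/-- The component `u · poly k` of a critical pair is rejected by one of the criteria. -/
def DeadComp (D : MStage n K) (u : Mon n) (k : ℕ) : Prop :=
  k ∉ D.prev ∧ (Rewritable D u k ∨ D.TopRedByPrev m (u + MSig.mon (D.sig k)))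

/-- The critical pair of `k` and `l` is rejected by one of the criteria. -/
def DeadPair (D : MStage n K) (k l : ℕ) : Prop :=
  DeadComp m D (m.degree (D.poly k) ⊔ m.degree (D.poly l) - m.degree (D.poly k)) k ∨
    DeadComp m D (m.degree (D.poly k) ⊔ m.degree (D.poly l) - m.degree (D.poly l)) l

/-- The first component is outside `G_prev` because elements without signature count as smaller.
`not_lt` allows equal signatures; these are excluded only when rewritability is tested. -/
structure PairWF (D : MStage n K) (c : CritPair n) : Prop where
  k_mem : c.k ∈ D.curr
  l_mem : c.l ∈ D.curr
  k_prev : c.k ∉ D.prev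
  ne : c.k ≠ c.l
  t_eq : c.t = m.degree (D.poly c.k) ⊔ m.degree (D.poly c.l)
  u_eq : c.u = c.t - m.degree (D.poly c.k)
  v_eq : c.v = c.t - m.degree (D.poly c.l)
  not_lt : ¬ MSig.lt m ((D.sig c.k).map fun a => c.u + a) ((D.sig c.l).map fun a => c.v + a)
  k_top : ¬ D.TopRedByPrev m (c.u + MSig.mon (D.sig c.k))
  l_top : c.l ∉ D.prev → ¬ D.TopRedByPrev m (c.v + MSig.mon (D.sig c.l))

variable (K) in
/-- The data that stay fixed during a stage: the previous ideal `I` with its basis `B`, the new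
input polynomial `f` of degree `d`, and a finite description `M` of the optimal signatures. -/
structure StageData where
  I : Ideal (Pol n K)
  f : Pol n K
  d : ℕ
  B : Set (Pol n K)
  M : Finset (Mon n × Mon n)
  C : ℕ
  f_hom : f.IsHomogeneous d
  B_gb : IsGroebnerBasis m I B
  B_hom : ∀ g ∈ B, ∃ e : ℕ, g.IsHomogeneous e
  M_opt : ∀ a ∈ M, Opt m I f d a.1 a.2
  opt_M : ∀ σ τ, Opt m I f d σ τ → ∃ a ∈ M, ∃ u, σ = u + a.1 ∧ τ = u + a.2
  M_deg : ∀ a ∈ M, a.2.degree ≤ C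

variable {m}

/-- The invariant of a stage: `U` is the set of critical pairs that are still to be treated, `A` the
set of indices of those polynomials that have not yet been put into `G_curr`, and `e` the degree of
the critical pairs that have been selected last. -/
structure Core (X : StageData K m) (D : MStage n K) (U : Finset (CritPair n)) (A : Finset ℕ)
    (e : ℕ) : Prop where
  B_eq : D.B = X.B
  idx_poly : D.poly D.idx = X.f
  idx_sig : D.sig D.idx = some 0
  idx_mem : D.idx ∈ D.curr
  prev_sub : D.prev ⊆ D.curr
  prev_lt : ∀ k ∈ D.prev, k < D.idx
  prev_sig : ∀ k ∈ D.prev, D.sig k = none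
  prev_mem : ∀ k ∈ D.prev, D.poly k ∈ X.I
  prev_hom : ∀ k ∈ D.prev, ∃ d : ℕ, (D.poly k).IsHomogeneous d
  prev_deg : ∀ k ∈ D.prev, (m.degree (D.poly k)).degree ≤ X.C
  prev_gb : ∀ p ∈ X.I, p ≠ 0 → ∃ k ∈ D.prev, m.degree (D.poly k) ≤ m.degree p
  lt_len : ∀ k ∈ D.curr ∪ A, k < D.r.length
  poly_ne : ∀ k ∈ D.curr, D.poly k ≠ 0
  disj : ∀ k ∈ A, k ∉ D.curr
  rule_idx : ∀ ρ ∈ D.rules, D.idx < ρ.2 ∧ ρ.2 < D.r.length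
  rule_sig : ∀ ρ ∈ D.rules, D.sig ρ.2 = some ρ.1
  rule_mem : ∀ ρ ∈ D.rules, ρ.2 ∈ D.curr ∨ ρ.2 ∈ A ∨ D.poly ρ.2 = 0
  rule_rep : ∀ ρ ∈ D.rules, ∃ c, c ≠ 0 ∧ Rep m X.I X.f X.d c ρ.1 (D.poly ρ.2)
  rule_deg : ∀ ρ ∈ D.rules, ρ.1.degree + X.d ≤ e
  -- The source of termination: ranks are at most the size of `M`, so all recorded signatures have
  -- bounded degree.
  rule_rank : ∀ ρ ∈ D.rules, ρ.1.degree ≤ X.C * rank m X.I X.f X.d X.M ρ.1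
  rule_pending : ∀ ρ ∈ D.rules, ρ.2 ∈ A → ρ.1.degree + X.d = e
  has_rule : ∀ k ∈ D.curr ∪ A, k ∉ D.prev → k ≠ D.idx → ∃ σ, (σ, k) ∈ D.rules
  nodup : (D.rules.map Prod.fst).Nodup
  sorted : D.rules.Pairwise fun ρ ρ' => ρ.1.degree ≤ ρ'.1.degree
  pair_wf : ∀ c ∈ U, PairWF m D c
  pair_all : ∀ k ∈ D.curr, k ∉ D.prev → ∀ l ∈ D.curr, l ≠ k →
    DeadPair m D k l ∨ ∃ c ∈ U, c.k = k ∧ c.l = l ∨ c.k = l ∧ c.l = k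
  pair_deg : ∀ c ∈ U, e ≤ c.t.degree
  -- An element of the current degree can produce a pair in that same degree, but only with a
  -- partner whose head divides its own, and such pairs are already rejected. A live pair thus sees
  -- only elements of smaller degree.
  pair_fresh : ∀ c ∈ U, DeadPair m D c.k c.l ∨
    ∀ ρ ∈ D.rules, ρ.2 ∈ D.curr → ρ.1.degree + X.d < c.t.degree

theorem DeadPair.symm {D : MStage n K} {k l : ℕ} (h : DeadPair m D k l) : DeadPair m D l k := by
  unfold DeadPair at h ⊢
  rw [sup_comm]
  exact h.symm

theorem Stage.TopRedByPrev.mono {D : MStage n K} {a b : Mon n} (h : D.TopRedByPrev m a)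
    (hab : a ≤ b) : D.TopRedByPrev m b := by
  obtain ⟨k, hk, hle⟩ := h
  exact ⟨k, hk, hle.trans hab⟩

namespace Core

variable {X : StageData K m} {D : MStage n K} {U : Finset (CritPair n)} {A : Finset ℕ} {e : ℕ}
  {k l : ℕ} {σ τ s u v : Mon n} {p q : Pol n K}

theorem idx_notMem_prev (h : Core X D U A e) : D.idx ∉ D.prev :=
  fun hk => lt_irrefl _ (h.prev_lt _ hk)

theorem rule_notMem_prev (h : Core X D U A e) {ρ : Mon n × ℕ} (hρ : ρ ∈ D.rules) :
    ρ.2 ∉ D.prev :=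
  fun hk => lt_asymm (h.prev_lt _ hk) (h.rule_idx ρ hρ).1

theorem pending_notMem_prev (h : Core X D U A e) (hk : k ∈ A) : k ∉ D.prev :=
  fun hp => h.disj k hk (h.prev_sub hp)

theorem pending_rule (h : Core X D U A e) (hk : k ∈ A) : ∃ σ, (σ, k) ∈ D.rules :=
  h.has_rule k (Finset.mem_union_right _ hk) (h.pending_notMem_prev hk)
    fun hi => h.disj k hk (hi ▸ h.idx_mem)

theorem exists_sig (h : Core X D U A e) (hk : k ∈ D.curr ∪ A) (hkp : k ∉ D.prev) :
    ∃ s, D.sig k = some s ∧ ∃ c, c ≠ 0 ∧ Rep m X.I X.f X.d c s (D.poly k) := by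
  by_cases hi : k = D.idx
  · subst hi
    refine ⟨0, h.idx_sig, 1, one_ne_zero, ?_⟩
    rw [h.idx_poly]
    exact Rep.self X.f_hom
  · obtain ⟨σ, hσ⟩ := h.has_rule k hk hkp hi
    exact ⟨σ, h.rule_sig _ hσ, h.rule_rep _ hσ⟩

theorem degree_degree (h : Core X D U A e) (hk : k ∈ D.curr) (hkp : k ∉ D.prev)
    (hs : D.sig k = some s) : (m.degree (D.poly k)).degree = s.degree + X.d := by
  obtain ⟨s', hs', c, -, hrep⟩ := h.exists_sig (Finset.mem_union_left _ hk) hkp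
  rw [hs] at hs'
  cases hs'
  exact degree_degree_of_isHomogeneous hrep.1 (h.poly_ne k hk)

/-- The rule that decides for the larger multiple records the signature `s` itself, so it also
divides the smaller multiple, while any later rule dividing that one would divide the larger one
too. -/
theorem last_of_le (h : Core X D U A e) (hs : D.sig k = some s) (hl : Last D.rules (v + s) k)
    (huv : u ≤ v) : Last D.rules (u + s) k := by
  have hle : u + s ≤ v + s := by gcongr
  rcases hl with hl | ⟨l₁, ρ, l₂, heq, h1, h2, h3⟩
  · exact Or.inl fun ρ hρ hρ' => hl ρ hρ (hρ'.trans hle)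
  · refine Or.inr ⟨l₁, ρ, l₂, heq, h1, ?_, fun ρ' hρ' hle' => h3 ρ' hρ' (hle'.trans hle)⟩
    have h4 := h.rule_sig ρ (by rw [heq]; simp)
    rw [h1, hs] at h4
    cases h4
    exact le_add_self

/-- The owner of the most recent rule dividing `σ`, or the new input polynomial, of signature 1, if
there is no such rule. -/
theorem exists_canonical (h : Core X D U A e) (σ : Mon n) :
    ∃ k u s, (k = D.idx ∨ ∃ ρ ∈ D.rules, ρ.2 = k) ∧ D.sig k = some s ∧ u + s = σ ∧
      Last D.rules σ k := by
  rcases exists_last D.rules σ with h1 | ⟨ρ, hρ, hle, hl⟩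
  · exact ⟨D.idx, σ, 0, Or.inl rfl, h.idx_sig, add_zero _, Or.inl h1⟩
  · exact ⟨ρ.2, σ - ρ.1, ρ.1, Or.inr ⟨ρ, hρ, rfl⟩, h.rule_sig _ hρ, tsub_add_cancel_of_le hle, hl⟩

/-- If `k` is the most recent rule for its multiple `σ`, then a rule for `σ` itself is `k`. -/
theorem eq_of_last (h : Core X D U A e) (hs : D.sig k = some s) (hl : Last D.rules (u + s) k)
    (hρ : (u + s, l) ∈ D.rules) : u = 0 ∧ l = k := by
  rcases hl with hl | ⟨l₁, ρ, l₂, heq, h1, h2, h3⟩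
  · exact absurd le_rfl (hl _ hρ)
  · have h4 := h.rule_sig ρ (by rw [heq]; simp)
    rw [h1, hs] at h4
    cases h4
    have hsort := h.sorted
    have hnd := h.nodup
    rw [heq] at hρ hsort hnd
    -- No rule after `ρ` divides the signature `u + s`, so its own rule does not come after `ρ`, and
    -- the rules are sorted by degree.
    have hdeg : (u + ρ.1).degree ≤ ρ.1.degree := by
      rcases List.mem_append.1 hρ with hρ | hρ
      · exact (List.pairwise_append.1 hsort).2.2 _ hρ ρ (by simp)
      · rcases List.mem_cons.1 hρ with hρ | hρ
        · exact (congrArg (fun x => (Prod.fst x).degree) hρ).le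
        · exact absurd le_rfl (h3 _ hρ)
    have hu : u = 0 := by
      rw [map_add] at hdeg
      exact (Finsupp.degree_eq_zero_iff u).1 (by omega)
    subst hu
    rw [zero_add] at hρ
    refine ⟨rfl, ?_⟩
    have := List.inj_on_of_nodup_map hnd hρ (show ρ ∈ l₁ ++ ρ :: l₂ by simp) rfl
    rw [← h1, ← this]

theorem syzygy_of_topRed (h : Core X D U A e) (ht : D.TopRedByPrev m σ) :
    Rep m X.I X.f X.d 1 σ 0 := by
  obtain ⟨b, hb, hle⟩ := ht
  obtain ⟨d, hd⟩ := h.prev_hom b hb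
  exact Rep.zero_of_mem (h.prev_mem b hb) (h.poly_ne b (h.prev_sub hb)) hd hle

theorem not_topRed_of_opt (h : Core X D U A e) (ho : Opt m X.I X.f X.d σ τ) :
    ¬ D.TopRedByPrev m σ :=
  fun ht => ho.not_syzygy one_ne_zero (h.syzygy_of_topRed ht)

/-- If two components that are not rejected have the same head monomial, then their critical pair is
still to be treated. -/
theorem le_degree_of_pair (h : Core X D U A e) (hk : k ∈ D.curr) (hkp : k ∉ D.prev)
    (hs : D.sig k = some s) (hl : Last D.rules (u + s) k) (ht : ¬ D.TopRedByPrev m (u + s))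
    (hm : l ∈ D.curr) (hne : l ≠ k) (heq : u + m.degree (D.poly k) = v + m.degree (D.poly l))
    (hlp : l ∉ D.prev → ∃ s', D.sig l = some s' ∧ Last D.rules (v + s') l ∧
      ¬ D.TopRedByPrev m (v + s')) :
    e ≤ (u + m.degree (D.poly k)).degree := by
  have hle : m.degree (D.poly k) ⊔ m.degree (D.poly l) ≤ u + m.degree (D.poly k) :=
    sup_le le_add_self (heq ▸ le_add_self)
  -- The least common multiple divides the common head, so the multipliers of the critical pair
  -- divide `u` and `v`; both criteria pass to smaller multipliers, so a rejected pair is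
  -- impossible.
  rcases h.pair_all k hk hkp l hm hne with hdead | ⟨c, hc, hkl⟩
  · exfalso
    rcases hdead with ⟨-, hd⟩ | ⟨hlp', hd⟩
    · have hu := tsub_le_iff_right.2 hle
      rw [hs] at hd
      rcases hd with hd | hd
      · refine not_rewritable_iff.2 ?_ hd
        rw [hs]
        exact h.last_of_le hs hl hu
      · exact ht (hd.mono (add_le_add hu le_rfl))
    · obtain ⟨s', hs', hl', ht'⟩ := hlp hlp'
      have hv := tsub_le_iff_right.2 (heq ▸ hle)
      rw [hs'] at hd
      rcases hd with hd | hd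
      · refine not_rewritable_iff.2 ?_ hd
        rw [hs']
        exact h.last_of_le hs' hl' hv
      · exact ht' (hd.mono (add_le_add hv le_rfl))
  · refine (h.pair_deg c hc).trans (Finsupp.degree_mono ?_)
    rw [(h.pair_wf c hc).t_eq]
    rcases hkl with ⟨h1, h2⟩ | ⟨h1, h2⟩
    · rwa [h1, h2]
    · rwa [h1, h2, sup_comm]

/-- Below the current degree, a component that is not rejected has the smallest head monomial that
is possible for its signature. -/
theorem opt (h : Core X D U A e) (hdeg : σ.degree + X.d < e) (ht : ¬ D.TopRedByPrev m σ)
    (hk : k ∈ D.curr) (hkp : k ∉ D.prev) (hs : D.sig k = some s) (hu : u + s = σ)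
    (hl : Last D.rules σ k) : Opt m X.I X.f X.d σ (u + m.degree (D.poly k)) := by
  obtain ⟨x, hx⟩ : ∃ x, m.toSyn σ = x := ⟨_, rfl⟩
  induction x using WellFoundedLT.induction generalizing σ k s u with
  | _ x ih =>
  have hk0 := h.poly_ne k hk
  have hdk := h.degree_degree hk hkp hs
  have hlt : (u + m.degree (D.poly k)).degree < e := by
    rw [map_add, hdk, ← add_assoc, ← map_add, hu]
    exact hdeg
  obtain ⟨s', hs', c, hc, hrep⟩ := h.exists_sig (Finset.mem_union_left _ hk) hkp
  obtain rfl : s = s' := by rw [hs] at hs'; exact Option.some.inj hs'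
  have hrep' := hrep.monomial_mul u 1
  rw [hu] at hrep'
  refine ⟨_, _, ?_, ?_, hrep', degree_monomial_mul one_ne_zero hk0, fun q hq0 hq hqd => ?_⟩
  · simpa using hk0
  · simpa using hc
  subst hu
  -- A failure of optimality means that the head occurs in `I` or is optimal for some `σ' ≺ σ`. In
  -- the first case an element of `G_prev`, in the second the canonical multiple for `σ'`, optimal
  -- by induction, has the same head; the pair with `k` would have degree below `e` and yet be
  -- pending.
  rcases hq.exists_opt_lt hq0 with ⟨g, hg, hg0, hgd⟩ | ⟨σ', hlt', hdeg', ho⟩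
  · obtain ⟨b, hb, hle⟩ := h.prev_gb g hg hg0
    rw [hgd, hqd] at hle
    refine absurd (h.le_degree_of_pair (l := b) (v := u + m.degree (D.poly k) - m.degree (D.poly b))
      hk hkp hs hl ht (h.prev_sub hb) ?_ (tsub_add_cancel_of_le hle).symm
      fun hbp => absurd hb hbp) (not_le.2 hlt)
    rintro rfl
    exact hkp hb
  · obtain ⟨j, v, s', hj, hsj, hv, hl'⟩ := h.exists_canonical σ'
    have ht' := h.not_topRed_of_opt ho
    have hj0 : D.poly j ≠ 0 := by
      intro h0
      have hr : ∃ c, c ≠ 0 ∧ Rep m X.I X.f X.d c s' (D.poly j) := by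
        rcases hj with rfl | ⟨ρ, hρ, rfl⟩
        · exact absurd h0 (h.poly_ne _ h.idx_mem)
        · have h1 := h.rule_sig ρ hρ
          rw [hsj] at h1
          cases h1
          exact h.rule_rep ρ hρ
      obtain ⟨c, hc, hr⟩ := hr
      rw [h0] at hr
      have hr' := hr.monomial_mul v 1
      rw [mul_zero, one_mul, hv] at hr'
      exact ho.not_syzygy hc hr'
    have hjc : j ∈ D.curr := by
      rcases hj with rfl | ⟨ρ, hρ, rfl⟩
      · exact h.idx_mem
      · rcases h.rule_mem ρ hρ with h1 | h1 | h1
        · exact h1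
        -- Polynomials still outside `G_curr` have degree exactly `e`, too large to divide into
        -- `σ'`.
        · have h2 := h.rule_pending ρ hρ h1
          have h3 := h.rule_sig ρ hρ
          rw [hsj] at h3
          cases h3
          have h4 : ρ.1.degree ≤ σ'.degree := by
            rw [← hv]
            exact Finsupp.degree_mono le_add_self
          omega
        · exact absurd h1 hj0
    have hjp : j ∉ D.prev := by
      rcases hj with rfl | ⟨ρ, hρ, rfl⟩
      · exact h.idx_notMem_prev
      · exact h.rule_notMem_prev hρ
    have ho' := ih _ (hx ▸ hlt') (hdeg' ▸ hdeg) ht' hjc hjp hsj hv hl' rfl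
    have heq := ho'.unique ho
    rw [hqd] at heq
    subst hv
    refine absurd (h.le_degree_of_pair (l := j) hk hkp hs hl ht hjc ?_ heq.symm
      fun _ => ⟨s', hsj, hl', ht'⟩) (not_le.2 hlt)
    -- If both multiples came from the same polynomial, equal heads would give equal multipliers and
    -- hence `σ' = σ`.
    rintro rfl
    have := add_right_cancel heq
    subst this
    obtain rfl := Option.some.inj (hs.symm.trans hsj)
    exact lt_irrefl _ hlt'

end Core

end Invariant

/-! ### Degree bounds for new signatures -/

section Operations

variable {n : ℕ} {K : Type*} [Field K] {m : MonomialOrder (Fin n)}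
  {X : StageData K m} {D : MStage n K} {U : Finset (CritPair n)} {A : Finset ℕ} {e : ℕ}
  {k l : ℕ} {σ τ s u v : Mon n} {p q : Pol n K}

/-- The multiplier of a component that is not rejected and not optimal is small. -/
theorem Core.degree_multiplier_le (h : Core X D U A e) (hk : k ∈ D.curr) (hkp : k ∉ D.prev)
    (hs : D.sig k = some s) (hl : Last D.rules (u + s) k) (ht : ¬ D.TopRedByPrev m (u + s))
    (he : (u + s).degree + X.d = e) (hq : Rep m X.I X.f X.d 0 (u + s) q) (hq0 : q ≠ 0)
    (hqd : m.degree q = u + m.degree (D.poly k)) : u.degree ≤ X.C := by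
  have hdk := h.degree_degree hk hkp hs
  -- Proper divisors of `u` lead to degrees below `e`, where `Core.opt` applies.
  have hopt : ∀ u₀, u₀ ≤ u → u₀ ≠ u →
      Opt m X.I X.f X.d (u₀ + s) (u₀ + m.degree (D.poly k)) := by
    intro u₀ hle hne
    refine h.opt ?_ (fun h' => ht (h'.mono (by gcongr))) hk hkp hs rfl (h.last_of_le hs hl hle)
    have hdeg : (u - u₀).degree ≠ 0 := by
      rw [Ne, Finsupp.degree_eq_zero_iff]
      intro h0
      exact hne (le_antisymm hle (tsub_eq_zero_iff_le.1 h0))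
    have h2 : u.degree = (u - u₀).degree + u₀.degree := by
      rw [← map_add, tsub_add_cancel_of_le hle]
    rw [map_add] at he ⊢
    omega
  -- Here `x` is the head in `G_prev` or in `M` that divides the head of `q`. Already at lcm(x, head
  -- of k) the smaller signature, or `I`, reaches the head of the multiple of `poly k`, so
  -- optimality fails there. By `hopt` this multiple must be the one by `u`, whence `u` divides `x`.
  have hsmall : ∀ x : Mon n, x ≤ u + m.degree (D.poly k) →
      (x ⊔ m.degree (D.poly k)) - m.degree (D.poly k) = u → u ≤ x := by
    intro x hx hu
    rw [← hu, tsub_le_iff_right]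
    exact sup_le le_self_add le_add_self
  rcases hq.exists_opt_lt hq0 with ⟨g, hg, hg0, hgd⟩ | ⟨σ', hlt, hdeg, ho⟩
  · obtain ⟨b, hb, hle⟩ := h.prev_gb g hg hg0
    rw [hgd, hqd] at hle
    refine (Finsupp.degree_mono (hsmall _ hle ?_)).trans (h.prev_deg b hb)
    by_contra hne
    set t := m.degree (D.poly b) ⊔ m.degree (D.poly k) with htdef
    have htu : t - m.degree (D.poly k) ≤ u := tsub_le_iff_right.2 (sup_le hle le_add_self)
    obtain ⟨-, -, -, -, -, -, hmin⟩ := hopt _ htu hne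
    have hb0 := h.poly_ne b (h.prev_sub hb)
    obtain ⟨d, hd⟩ := h.prev_hom b hb
    have htb : t - m.degree (D.poly b) + m.degree (D.poly b) = t :=
      tsub_add_cancel_of_le le_sup_left
    have htk : t - m.degree (D.poly k) + m.degree (D.poly k) = t :=
      tsub_add_cancel_of_le le_sup_right
    refine hmin (monomial (t - m.degree (D.poly b)) 1 * D.poly b) (by simpa using hb0)
      (Rep.of_mem (Ideal.mul_mem_left _ _ (h.prev_mem b hb)) ?_)
      (by rw [degree_monomial_mul one_ne_zero hb0, htb, htk])
    have h1 := isHomogeneous_monomial_mul (u := t - m.degree (D.poly b)) (c := (1 : K)) hd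
    have h2 := congrArg Finsupp.degree (htb.trans htk.symm)
    rw [map_add, map_add, hdk, degree_degree_of_isHomogeneous hd hb0, ← add_assoc,
      ← map_add (Finsupp.degree)] at h2
    rwa [h2] at h1
  · obtain ⟨a, ha, v, rfl, hqa⟩ := X.opt_M σ' _ ho
    rw [hqd] at hqa
    have hle : a.2 ≤ u + m.degree (D.poly k) := hqa ▸ le_add_self
    refine (Finsupp.degree_mono (hsmall _ hle ?_)).trans (X.M_deg a ha)
    by_contra hne
    set t := a.2 ⊔ m.degree (D.poly k) with htdef
    have htle : t ≤ u + m.degree (D.poly k) := sup_le hle le_add_self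
    have htu : t - m.degree (D.poly k) ≤ u := tsub_le_iff_right.2 htle
    obtain ⟨-, -, -, -, -, -, hmin⟩ := hopt _ htu hne
    have hoa := X.M_opt a ha
    have hta : t - a.2 + a.2 = t := tsub_add_cancel_of_le le_sup_left
    have htk : t - m.degree (D.poly k) + m.degree (D.poly k) = t :=
      tsub_add_cancel_of_le le_sup_right
    set u₀ := t - m.degree (D.poly k)
    set v₀ := t - a.2
    -- Both multiples contain the common factor `w`; cancelling it moves the comparison of
    -- signatures down to the least common multiple.
    set w := u + m.degree (D.poly k) - t
    have hw : w + t = u + m.degree (D.poly k) := tsub_add_cancel_of_le htle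
    have hwu : u = w + u₀ := by
      have : u + m.degree (D.poly k) = w + u₀ + m.degree (D.poly k) := by
        rw [← hw, add_assoc, htk]
      exact add_right_cancel this
    have hwv : v = w + v₀ := by
      have : v + a.2 = w + v₀ + a.2 := by rw [← hqa, ← hw, add_assoc, hta]
      exact add_right_cancel this
    have hlt' : v₀ + a.1 ≺[m] u₀ + s := by
      rw [hwu, hwv, add_assoc, add_assoc, map_add, map_add m.toSyn w] at hlt
      exact lt_of_add_lt_add_left hlt
    have hdeg' : (v₀ + a.1).degree = (u₀ + s).degree := by
      have h1 := congrArg Finsupp.degree hta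
      have h2 := congrArg Finsupp.degree htk
      have h3 := hoa.degree_eq
      rw [map_add] at h1 h2
      rw [map_add, map_add]
      omega
    obtain ⟨p, c, hp0, hc, hp, hpd, -⟩ := id hoa
    refine hmin (monomial v₀ 1 * p) (by simpa using hp0) ((hp.monomial_mul v₀ 1).of_lt hlt' hdeg')
      ?_
    rw [degree_monomial_mul one_ne_zero hp0, hpd, hta, htk]

/-- The degree of a new signature is bounded in terms of its rank. -/
theorem Core.degree_le_rank (h : Core X D U A e) (hk : k ∈ D.curr) (hkp : k ∉ D.prev)
    (hs : D.sig k = some s) (hl : Last D.rules (u + s) k) (ht : ¬ D.TopRedByPrev m (u + s))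
    (he : (u + s).degree + X.d = e)
    (hfresh : ∀ ρ ∈ D.rules, ρ.2 ∈ D.curr → ρ.1.degree + X.d < e)
    (hq : Rep m X.I X.f X.d 0 (u + s) q) (hq0 : q ≠ 0)
    (hqd : m.degree q = u + m.degree (D.poly k)) :
    (u + s).degree ≤ X.C * rank m X.I X.f X.d X.M (u + s) := by
  have hk0 := h.poly_ne k hk
  -- The new input polynomial, of signature 1, is the base case; any other element of `G_curr`
  -- carries the bound from its own rule and has smaller degree.
  have hrule : k = D.idx ∧ s = 0 ∨
      s.degree + X.d < e ∧ s.degree ≤ X.C * rank m X.I X.f X.d X.M s := by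
    by_cases hi : k = D.idx
    · subst hi
      rw [h.idx_sig] at hs
      cases hs
      exact Or.inl ⟨rfl, rfl⟩
    · obtain ⟨σ, hσ⟩ := h.has_rule k (Finset.mem_union_left _ hk) hkp hi
      have h1 := h.rule_sig _ hσ
      rw [hs] at h1
      cases h1
      exact Or.inr ⟨hfresh _ hσ hk, h.rule_rank _ hσ⟩
  by_cases hu : u = 0
  · subst hu
    rw [zero_add] at he ⊢
    rcases hrule with ⟨-, rfl⟩ | hrule
    · simp
    · omega
  have hu' : u.degree ≠ 0 := by rwa [Ne, Finsupp.degree_eq_zero_iff]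
  have hs' : s.degree ≤ X.C * rank m X.I X.f X.d X.M s := by
    rcases hrule with ⟨-, rfl⟩ | hrule
    · simp
    · exact hrule.2
  have hopt : Opt m X.I X.f X.d (0 + s) (0 + m.degree (D.poly k)) := by
    refine h.opt ?_ (fun h' => ht (h'.mono (by gcongr; exact bot_le))) hk hkp hs rfl
      (h.last_of_le hs hl bot_le)
    rw [map_add] at he
    rw [zero_add]
    omega
  rw [zero_add, zero_add] at hopt
  obtain ⟨s', hs'', c, hc, hrep⟩ := h.exists_sig (Finset.mem_union_left _ hk) hkp
  obtain rfl := Option.some.inj (hs.symm.trans hs'')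
  -- `q` has the head of the multiple of `poly k` at a smaller signature, so that multiple is not
  -- optimal. The rank rises by at least 1, which pays for the at most `X.C` degrees of `u`.
  have hrank : rank m X.I X.f X.d X.M s < rank m X.I X.f X.d X.M (u + s) := by
    refine rank_lt X.opt_M hopt fun τ' hτ' => ?_
    have hdeg := degree_monomial_mul (m := m) (u := u) (c := (1 : K)) one_ne_zero hk0
    rw [← hdeg]
    exact hτ'.lt (by simpa using hc) (hrep.monomial_mul u 1) (by simpa using hk0) hq hq0
      (hqd.trans hdeg.symm)
  have hC := h.degree_multiplier_le hk hkp hs hl ht he hq hq0 hqd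
  calc (u + s).degree = u.degree + s.degree := map_add _ _ _
    _ ≤ X.C + X.C * rank m X.I X.f X.d X.M s := by gcongr
    _ = X.C * (rank m X.I X.f X.d X.M s + 1) := by ring
    _ ≤ X.C * rank m X.I X.f X.d X.M (u + s) := by gcongr; exact hrank

theorem finite_degree_le (n e : ℕ) : {σ : Mon n | σ.degree ≤ e}.Finite := by
  refine (Set.finite_Iic (Finsupp.equivFunOnFinite.symm fun _ => e)).subset ?_
  intro σ hσ i
  exact (Finsupp.le_degree i σ).trans hσ

/-- The number of rules is bounded during a stage. -/
theorem Core.exists_length_le (X : StageData K m) : ∃ N, ∀ (D : MStage n K)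
    (U : Finset (CritPair n)) (A : Finset ℕ) (e : ℕ), Core X D U A e → D.rules.length ≤ N := by
  classical
  have hfin := finite_degree_le n (X.C * X.M.card)
  refine ⟨hfin.toFinset.card, fun D U A e h => ?_⟩
  rw [← List.length_map (f := Prod.fst), ← List.toFinset_card_of_nodup h.nodup]
  refine Finset.card_le_card fun σ hσ => ?_
  rw [List.mem_toFinset, List.mem_map] at hσ
  obtain ⟨ρ, hρ, rfl⟩ := hσ
  rw [Set.Finite.mem_toFinset]
  exact (h.rule_rank ρ hρ).trans (Nat.mul_le_mul_left _ (rank_le _ _))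

/-! ### Preservation of the invariant -/

/-- The criteria see only `G_prev`, the signature and the rules, and added rules never revive a
component. -/
theorem DeadComp.congr {D' : MStage n K} (h : DeadComp m D u k) (hprev : D'.prev = D.prev)
    (hpoly : ∀ b ∈ D.prev, D'.poly b = D.poly b) (hsig : D'.sig k = D.sig k)
    (hrules : ∀ σ, Last D'.rules σ k → Last D.rules σ k) : DeadComp m D' u k := by
  obtain ⟨hk, hd⟩ := h
  refine ⟨hprev ▸ hk, hd.imp (fun hr => ?_) ?_⟩
  · by_contra hnr
    rw [not_rewritable_iff, hsig] at hnr
    exact not_rewritable_iff.2 (hrules _ hnr) hr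
  · rintro ⟨b, hb, hle⟩
    exact ⟨b, hprev ▸ hb, by rw [hpoly b hb, hsig]; exact hle⟩

theorem DeadPair.congr {D' : MStage n K} (h : DeadPair m D k l) (hprev : D'.prev = D.prev)
    (hpoly : ∀ b ∈ D.prev, D'.poly b = D.poly b)
    (hk : D'.poly k = D.poly k) (hl : D'.poly l = D.poly l)
    (hks : D'.sig k = D.sig k) (hls : D'.sig l = D.sig l)
    (hrules : ∀ σ j, j = k ∨ j = l → Last D'.rules σ j → Last D.rules σ j) :
    DeadPair m D' k l := by
  unfold DeadPair
  rw [hk, hl]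
  exact h.imp (fun h => h.congr hprev hpoly hks fun σ => hrules σ k (Or.inl rfl))
    fun h => h.congr hprev hpoly hls fun σ => hrules σ l (Or.inr rfl)

theorem PairWF.congr {D' : MStage n K} {c : CritPair n} (h : PairWF m D c)
    (hprev : D'.prev = D.prev) (hcurr : D.curr ⊆ D'.curr)
    (hpoly : ∀ b ∈ D.prev, D'.poly b = D.poly b)
    (hk : D'.poly c.k = D.poly c.k) (hl : D'.poly c.l = D.poly c.l)
    (hks : D'.sig c.k = D.sig c.k) (hls : D'.sig c.l = D.sig c.l) : PairWF m D' c := by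
  have htop : ∀ a, D'.TopRedByPrev m a → D.TopRedByPrev m a := by
    rintro a ⟨b, hb, hle⟩
    rw [hprev] at hb
    exact ⟨b, hb, by rwa [← hpoly b hb]⟩
  refine ⟨hcurr h.k_mem, hcurr h.l_mem, hprev ▸ h.k_prev, h.ne, ?_, ?_, ?_, ?_, ?_, ?_⟩
  · rw [hk, hl, h.t_eq]
  · rw [hk, h.u_eq]
  · rw [hl, h.v_eq]
  · rw [hks, hls]
    exact h.not_lt
  · rw [hks]
    exact fun h' => h.k_top (htop _ h')
  · rw [hprev, hls]
    exact fun hp h' => h.l_top hp (htop _ h')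

/-- Pairs refer to `G_curr` only, so changing a polynomial outside it affects nothing but the
representation attached to its rule. -/
theorem Core.setPoly (h : Core X D U A e) (hk : k ∈ A)
    (hp : ∀ σ, (σ, k) ∈ D.rules → ∃ c, c ≠ 0 ∧ Rep m X.I X.f X.d c σ p) :
    Core X (D.setPoly k p) U A e := by
  have hne : ∀ j ∈ D.curr, j ≠ k := fun j hj hjk => h.disj k hk (hjk ▸ hj)
  have hcurr : ∀ j ∈ D.curr, (D.setPoly k p).poly j = D.poly j :=
    fun j hj => poly_setPoly_of_ne (hne j hj)
  have hprev : ∀ j ∈ D.prev, (D.setPoly k p).poly j = D.poly j :=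
    fun j hj => hcurr j (h.prev_sub hj)
  exact {
    B_eq := h.B_eq
    idx_poly := (hcurr _ h.idx_mem).trans h.idx_poly
    idx_sig := sig_setPoly.trans h.idx_sig
    idx_mem := h.idx_mem
    prev_sub := h.prev_sub
    prev_lt := h.prev_lt
    prev_sig := fun j hj => sig_setPoly.trans (h.prev_sig j hj)
    prev_mem := fun j hj => (hprev j hj).symm ▸ h.prev_mem j hj
    prev_hom := fun j hj => (hprev j hj).symm ▸ h.prev_hom j hj
    prev_deg := fun j hj => (hprev j hj).symm ▸ h.prev_deg j hj
    prev_gb := fun g hg hg0 => by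
      obtain ⟨j, hj, hle⟩ := h.prev_gb g hg hg0
      exact ⟨j, hj, (hprev j hj).symm ▸ hle⟩
    lt_len := fun j hj => by rw [length_setPoly]; exact h.lt_len j hj
    poly_ne := fun j hj => (hcurr j hj).symm ▸ h.poly_ne j hj
    disj := h.disj
    rule_idx := fun ρ hρ => by rw [length_setPoly]; exact h.rule_idx ρ hρ
    rule_sig := fun ρ hρ => sig_setPoly.trans (h.rule_sig ρ hρ)
    rule_mem := fun ρ hρ => by
      by_cases hj : ρ.2 = k
      · exact Or.inr (Or.inl (hj ▸ hk))
      · rw [poly_setPoly_of_ne hj]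
        exact h.rule_mem ρ hρ
    rule_rep := fun ρ hρ => by
      by_cases hj : ρ.2 = k
      · rw [hj, poly_setPoly_self (h.lt_len k (Finset.mem_union_right _ hk))]
        exact hp ρ.1 (hj ▸ hρ)
      · rw [poly_setPoly_of_ne hj]
        exact h.rule_rep ρ hρ
    rule_deg := h.rule_deg
    rule_rank := h.rule_rank
    rule_pending := h.rule_pending
    has_rule := h.has_rule
    nodup := h.nodup
    sorted := h.sorted
    pair_wf := fun c hc => by
      have hwf := h.pair_wf c hc
      exact hwf.congr rfl subset_rfl hprev (hcurr _ hwf.k_mem) (hcurr _ hwf.l_mem) sig_setPoly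
        sig_setPoly
    pair_all := fun j hj hjp i hi hij => (h.pair_all j hj hjp i hi hij).imp_left fun hd =>
      hd.congr rfl hprev (hcurr _ hj) (hcurr _ hi) sig_setPoly sig_setPoly fun _ _ _ h => h
    pair_deg := h.pair_deg
    pair_fresh := fun c hc => by
      have hwf := h.pair_wf c hc
      exact (h.pair_fresh c hc).imp_left fun hd => hd.congr rfl hprev (hcurr _ hwf.k_mem)
        (hcurr _ hwf.l_mem) sig_setPoly sig_setPoly fun _ _ _ h => h }

/-- Covers both ways of creating a polynomial: S-polynomials, and top-reductions by a multiple of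
larger signature. The multiple of `poly k` carries the new signature; `q` is the partner that
cancels its head from a smaller signature. -/
theorem Core.append (h : Core X D U A e) (ch : PrevChoice) (hk : k ∈ D.curr) (hkp : k ∉ D.prev)
    (hs : D.sig k = some s) (hl : Last D.rules (u + s) k) (ht : ¬ D.TopRedByPrev m (u + s))
    (he : (u + s).degree + X.d = e)
    (hfresh : ∀ ρ ∈ D.rules, ρ.2 ∈ D.curr → ρ.1.degree + X.d < e)
    (hq : Rep m X.I X.f X.d 0 (u + s) q) (hq0 : q ≠ 0)
    (hqd : m.degree q = u + m.degree (D.poly k)) {c : K} (hc : c ≠ 0)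
    (hp : Rep m X.I X.f X.d c (u + s) p) {A' : Finset ℕ} (hA : A ⊆ A')
    (hA' : ∀ j ∈ A', j = D.r.length ∨ j ∈ A) (hpA : p = 0 ∨ D.r.length ∈ A') :
    Core X (D.append (withoutSetup K m ch) (some (u + s)) p) U A' e := by
  have hlt : ∀ j ∈ D.curr, j < D.r.length := fun j hj => h.lt_len j (Finset.mem_union_left _ hj)
  have hcurr : ∀ j ∈ D.curr,
      (D.append (withoutSetup K m ch) (some (u + s)) p).poly j = D.poly j :=
    fun j hj => poly_append_of_lt (hlt j hj)
  have hsig : ∀ j ∈ D.curr,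
      (D.append (withoutSetup K m ch) (some (u + s)) p).sig j = D.sig j :=
    fun j hj => sig_append_of_lt (hlt j hj)
  have hprev : ∀ j ∈ D.prev,
      (D.append (withoutSetup K m ch) (some (u + s)) p).poly j = D.poly j :=
    fun j hj => hcurr j (h.prev_sub hj)
  have hrules : (D.append (withoutSetup K m ch) (some (u + s)) p).rules =
      D.rules ++ [(u + s, D.r.length)] := rfl
  have hmem : ∀ {ρ}, ρ ∈ (D.append (withoutSetup K m ch) (some (u + s)) p).rules →
      ρ ∈ D.rules ∨ ρ = (u + s, D.r.length) := fun {ρ} hρ => by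
    rw [hrules, List.mem_append, List.mem_singleton] at hρ
    exact hρ
  have hlast : ∀ σ, ∀ j ∈ D.curr,
      Last (D.append (withoutSetup K m ch) (some (u + s)) p).rules σ j → Last D.rules σ j :=
    fun σ j hj hL => (hL.of_append (hlt j hj).ne').1
  have hdead : ∀ i ∈ D.curr, ∀ j ∈ D.curr, DeadPair m D i j →
      DeadPair m (D.append (withoutSetup K m ch) (some (u + s)) p) i j :=
    fun i hi j hj hd => hd.congr rfl hprev (hcurr i hi) (hcurr j hj) (hsig i hi) (hsig j hj)
      fun σ x hx => hlast σ x (by rcases hx with rfl | rfl <;> assumption)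
  have hnew : D.r.length ∉ D.curr := fun hj => lt_irrefl _ (hlt _ hj)
  have hnewA : D.r.length ∉ A := fun hj =>
    lt_irrefl _ (h.lt_len _ (Finset.mem_union_right _ hj))
  exact {
    B_eq := h.B_eq
    idx_poly := (hcurr _ h.idx_mem).trans h.idx_poly
    idx_sig := (hsig _ h.idx_mem).trans h.idx_sig
    idx_mem := h.idx_mem
    prev_sub := h.prev_sub
    prev_lt := h.prev_lt
    prev_sig := fun j hj => (hsig j (h.prev_sub hj)).trans (h.prev_sig j hj)
    prev_mem := fun j hj => (hprev j hj).symm ▸ h.prev_mem j hj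
    prev_hom := fun j hj => (hprev j hj).symm ▸ h.prev_hom j hj
    prev_deg := fun j hj => (hprev j hj).symm ▸ h.prev_deg j hj
    prev_gb := fun g hg hg0 => by
      obtain ⟨j, hj, hle⟩ := h.prev_gb g hg hg0
      exact ⟨j, hj, (hprev j hj).symm ▸ hle⟩
    lt_len := fun j hj => by
      rw [length_append]
      rcases Finset.mem_union.1 hj with hj | hj
      · exact Nat.lt_succ_of_lt (hlt j hj)
      · rcases hA' j hj with rfl | hj
        · exact Nat.lt_succ_self _
        · exact Nat.lt_succ_of_lt (h.lt_len j (Finset.mem_union_right _ hj))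
    poly_ne := fun j hj => (hcurr j hj).symm ▸ h.poly_ne j hj
    disj := fun j hj => by
      rcases hA' j hj with rfl | hj
      · exact hnew
      · exact h.disj j hj
    rule_idx := fun ρ hρ => by
      rw [length_append]
      rcases hmem hρ with hρ | rfl
      · exact ⟨(h.rule_idx ρ hρ).1, Nat.lt_succ_of_lt (h.rule_idx ρ hρ).2⟩
      · exact ⟨hlt _ h.idx_mem, Nat.lt_succ_self _⟩
    rule_sig := fun ρ hρ => by
      rcases hmem hρ with hρ | rfl
      · rw [sig_append_of_lt (h.rule_idx ρ hρ).2]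
        exact h.rule_sig ρ hρ
      · exact sig_append_self
    rule_mem := fun ρ hρ => by
      rcases hmem hρ with hρ | rfl
      · rw [poly_append_of_lt (h.rule_idx ρ hρ).2]
        exact (h.rule_mem ρ hρ).imp_right (Or.imp_left fun h => hA h)
      · rw [poly_append_self]
        exact Or.inr hpA.symm
    rule_rep := fun ρ hρ => by
      rcases hmem hρ with hρ | rfl
      · rw [poly_append_of_lt (h.rule_idx ρ hρ).2]
        exact h.rule_rep ρ hρ
      · rw [poly_append_self]
        exact ⟨c, hc, hp⟩
    rule_deg := fun ρ hρ => by
      rcases hmem hρ with hρ | rfl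
      · exact h.rule_deg ρ hρ
      · exact he.le
    rule_rank := fun ρ hρ => by
      rcases hmem hρ with hρ | rfl
      · exact h.rule_rank ρ hρ
      · exact h.degree_le_rank hk hkp hs hl ht he hfresh hq hq0 hqd
    rule_pending := fun ρ hρ hρA => by
      rcases hmem hρ with hρ | rfl
      · rcases hA' _ hρA with h1 | h1
        · exact absurd h1 (h.rule_idx ρ hρ).2.ne
        · exact h.rule_pending ρ hρ h1
      · exact he
    has_rule := fun j hj hjp hji => by
      have hcase : j = D.r.length ∨ j ∈ D.curr ∪ A := by
        rcases Finset.mem_union.1 hj with hj | hj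
        · exact Or.inr (Finset.mem_union_left _ hj)
        · exact (hA' j hj).imp_right (Finset.mem_union_right _)
      rcases hcase with rfl | hj
      · exact ⟨u + s, List.mem_append_right _ (List.mem_singleton.2 rfl)⟩
      · obtain ⟨σ, hσ⟩ := h.has_rule j hj hjp hji
        exact ⟨σ, List.mem_append_left _ hσ⟩
    nodup := by
      rw [hrules, List.map_append, List.nodup_append]
      refine ⟨h.nodup, by simp, ?_⟩
      rintro σ hσ _ hσ' rfl
      simp only [List.map_cons, List.map_nil, List.mem_singleton] at hσ'
      subst hσ'
      obtain ⟨⟨_, j⟩, hρ, rfl⟩ := List.mem_map.1 hσ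
      -- A repeated signature could only be that of `k` itself with multiplier 1, but elements of
      -- `G_curr` have degree below `e`.
      obtain ⟨hu, rfl⟩ := h.eq_of_last hs hl hρ
      exact (hfresh _ hρ hk).ne he
    sorted := by
      rw [hrules, List.pairwise_append]
      refine ⟨h.sorted, by simp, fun ρ hρ ρ' hρ' => ?_⟩
      rw [List.mem_singleton.1 hρ']
      have := h.rule_deg ρ hρ
      simp only
      omega
    pair_wf := fun c hc => by
      have hwf := h.pair_wf c hc
      exact hwf.congr rfl subset_rfl hprev (hcurr _ hwf.k_mem) (hcurr _ hwf.l_mem)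
        (hsig _ hwf.k_mem) (hsig _ hwf.l_mem)
    pair_all := fun j hj hjp i hi hij =>
      (h.pair_all j hj hjp i hi hij).imp_left (hdead j hj i hi)
    pair_deg := h.pair_deg
    pair_fresh := fun c hc => by
      have hwf := h.pair_wf c hc
      refine (h.pair_fresh c hc).imp (hdead _ hwf.k_mem _ hwf.l_mem) fun hf ρ hρ hρc => ?_
      rcases hmem hρ with hρ | rfl
      · exact hf ρ hρ hρc
      · exact absurd hρc hnew }

/-- Rejected pairs can be dropped. -/
theorem Core.drop (h : Core X D U A e) {U' : Finset (CritPair n)} (hU : U' ⊆ U)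
    (hdead : ∀ c ∈ U, c ∉ U' → DeadPair m D c.k c.l) : Core X D U' A e :=
  { h with
    pair_wf := fun c hc => h.pair_wf c (hU hc)
    pair_all := fun k hk hkp l hl hkl => by
      rcases h.pair_all k hk hkp l hl hkl with hd | ⟨c, hc, hcc⟩
      · exact Or.inl hd
      · by_cases hc' : c ∈ U'
        · exact Or.inr ⟨c, hc', hcc⟩
        · left
          rcases hcc with ⟨rfl, rfl⟩ | ⟨rfl, rfl⟩
          · exact hdead c hc hc'
          · exact (hdead c hc hc').symm
    pair_deg := fun c hc => h.pair_deg c (hU hc)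
    pair_fresh := fun c hc => h.pair_fresh c (hU hc) }

/-- With nothing waiting outside `G_curr`, the current degree may advance to that of the next pair,
or arbitrarily far if no pair remains. -/
theorem Core.raise (h : Core X D U ∅ e) {e' : ℕ} (he : e ≤ e')
    (hU : ∀ c ∈ U, e' ≤ c.t.degree) : Core X D U ∅ e' :=
  { h with
    rule_deg := fun ρ hρ => (h.rule_deg ρ hρ).trans he
    rule_pending := fun _ _ hA => absurd hA (Finset.notMem_empty _)
    pair_deg := hU }

theorem Core.forget (h : Core X D U A e) {A' : Finset ℕ} (hA : A' ⊆ A)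
    (h0 : ∀ k ∈ A, k ∉ A' → D.poly k = 0) : Core X D U A' e :=
  { h with
    lt_len := fun k hk => h.lt_len k (Finset.union_subset_union_right hA hk)
    disj := fun k hk => h.disj k (hA hk)
    rule_mem := fun ρ hρ => by
      rcases h.rule_mem ρ hρ with h1 | h1 | h1
      · exact Or.inl h1
      · by_cases hA' : ρ.2 ∈ A'
        · exact Or.inr (Or.inl hA')
        · exact Or.inr (Or.inr (h0 _ h1 hA'))
      · exact Or.inr (Or.inr h1)
    rule_pending := fun ρ hρ hk => h.rule_pending ρ hρ (hA hk)
    has_rule := fun k hk => h.has_rule k (Finset.union_subset_union_right hA hk) }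

theorem Core.withPairs (h : Core X D U A e) (Q : Finset (CritPair n)) :
    Core X { D with pairs := Q } U A e :=
  ⟨h.B_eq, h.idx_poly, h.idx_sig, h.idx_mem, h.prev_sub, h.prev_lt, h.prev_sig, h.prev_mem,
    h.prev_hom, h.prev_deg, h.prev_gb, h.lt_len, h.poly_ne, h.disj, h.rule_idx, h.rule_sig,
    h.rule_mem, h.rule_rep, h.rule_deg, h.rule_rank, h.rule_pending, h.has_rule, h.nodup,
    h.sorted, fun c hc => (h.pair_wf c hc).congr rfl subset_rfl (fun _ _ => rfl) rfl rfl rfl rfl,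
    h.pair_all, h.pair_deg, h.pair_fresh⟩

theorem critPair_cases (ch : PrevChoice) (hk : k ∈ D.curr) (hkp : k ∉ D.prev) (hl : l ∈ D.curr)
    (hkl : k ≠ l) (hprev : ∀ j ∈ D.prev, D.sig j = none) :
    (DeadPair m D k l ∧ critPair (withoutSetup K m ch) D k l = ∅) ∨
      ∃ c, critPair (withoutSetup K m ch) D k l = {c} ∧ PairWF m D c ∧
        (c.k = k ∧ c.l = l ∨ c.k = l ∧ c.l = k) := by
  unfold critPair
  simp only
  split_ifs with h1 h2
  · left
    refine ⟨?_, rfl⟩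
    rcases h1 with ⟨h1, h2⟩ | ⟨h1, h2⟩
    · exact Or.inl ⟨h1, Or.inr h2⟩
    · exact Or.inr ⟨h1, Or.inr h2⟩
  · right
    refine ⟨_, rfl, ?_, Or.inr ⟨rfl, rfl⟩⟩
    obtain ⟨h3, h4⟩ := not_or.1 h1
    have h2' : MSig.lt m ((D.sig k).map fun a => m.degree (D.poly k) ⊔ m.degree (D.poly l) -
        m.degree (D.poly k) + a) ((D.sig l).map fun a => m.degree (D.poly k) ⊔
        m.degree (D.poly l) - m.degree (D.poly l) + a) := h2
    have hlp : l ∉ D.prev := by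
      intro hlp
      rw [hprev l hlp] at h2'
      revert h2'
      cases D.sig k <;> simp [MSig.lt]
    refine ⟨hl, hk, hlp, hkl.symm, sup_comm _ _, rfl, rfl, ?_, fun h => h4 ⟨hlp, h⟩,
      fun _ h => h3 ⟨hkp, h⟩⟩
    simp only
    revert h2'
    cases D.sig k <;> cases D.sig l <;> simp [MSig.lt]
    exact fun h => h.le
  · right
    refine ⟨_, rfl, ?_, Or.inl ⟨rfl, rfl⟩⟩
    obtain ⟨h3, h4⟩ := not_or.1 h1
    exact ⟨hk, hl, hkp, hkl, rfl, rfl, rfl, h2, fun h => h3 ⟨hkp, h⟩, fun hlp h => h4 ⟨hlp, h⟩⟩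

open Classical in
theorem Core.update (h : Core X D D.pairs A e) (ch : PrevChoice) (hk : k ∈ A)
    (hk0 : D.poly k ≠ 0)
    (hdead : ∀ l ∈ D.curr, m.degree (D.poly l) ≤ m.degree (D.poly k) → DeadPair m D k l)
    (hfresh : ∀ c ∈ D.pairs, DeadPair m D c.k c.l ∨ e < c.t.degree)
    (D' : MStage n K) (hD' : D' = { D with
      pairs := D.pairs ∪ D.curr.biUnion fun j => critPair (withoutSetup K m ch) D k j
      curr := insert k D.curr }) :
    Core X D' D'.pairs (A.erase k) e ∧
      ∀ c ∈ D'.pairs, DeadPair m D' c.k c.l ∨ e < c.t.degree := by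
  have hkp := h.pending_notMem_prev hk
  have hkc := h.disj k hk
  obtain ⟨σ, hσ⟩ := h.pending_rule hk
  have hrep := h.rule_rep _ hσ
  have hdegk : (m.degree (D.poly k)).degree = e := by
    obtain ⟨c, -, hrep⟩ := hrep
    rw [← h.rule_pending _ hσ hk]
    exact degree_degree_of_isHomogeneous hrep.1 hk0
  have hpoly : ∀ j, D'.poly j = D.poly j := fun j => by rw [hD']; rfl
  have hsig : ∀ j, D'.sig j = D.sig j := fun j => by rw [hD']; rfl
  have hprev : D'.prev = D.prev := by rw [hD']
  have hidx : D'.idx = D.idx := by rw [hD']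
  have hr : D'.r = D.r := by rw [hD']
  have hrules : D'.rules = D.rules := by rw [hD']
  have hcurr : D'.curr = insert k D.curr := by rw [hD']
  have hcurr' : D.curr ⊆ D'.curr := hcurr ▸ Finset.subset_insert _ _
  have hkc' : k ∈ D'.curr := hcurr ▸ Finset.mem_insert_self _ _
  have hde : ∀ i j, DeadPair m D i j → DeadPair m D' i j := fun i j hd =>
    hd.congr hprev (fun _ _ => hpoly _) (hpoly _) (hpoly _) (hsig _) (hsig _)
      fun σ x _ hL => hrules ▸ hL
  have hcases : ∀ j ∈ D.curr, (DeadPair m D' k j ∧ critPair (withoutSetup K m ch) D k j = ∅) ∨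
      ∃ c, critPair (withoutSetup K m ch) D k j = {c} ∧ PairWF m D' c ∧
        (c.k = k ∧ c.l = j ∨ c.k = j ∧ c.l = k) := by
    intro j hj
    have hcp : critPair (withoutSetup K m ch) D k j = critPair (withoutSetup K m ch) D' k j := by
      rw [hD']; rfl
    rw [hcp]
    refine critPair_cases ch hkc' (hprev ▸ hkp) (hcurr' hj) ?_ ?_
    · rintro rfl
      exact hkc hj
    · intro i hi
      rw [hsig]
      exact h.prev_sig i (hprev ▸ hi)
  have hpairs : D'.pairs =
      D.pairs ∪ D.curr.biUnion fun j => critPair (withoutSetup K m ch) D k j := by rw [hD']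
  have hmemp : ∀ c ∈ D'.pairs, c ∈ D.pairs ∨ ∃ j ∈ D.curr, PairWF m D' c ∧
      (c.k = k ∧ c.l = j ∨ c.k = j ∧ c.l = k) := by
    intro c hc
    rw [hpairs] at hc
    rcases Finset.mem_union.1 hc with hc | hc
    · exact Or.inl hc
    · obtain ⟨j, hj, hcj⟩ := Finset.mem_biUnion.1 hc
      rcases hcases j hj with ⟨-, h1⟩ | ⟨c', h1, h2, h3⟩
      · rw [h1] at hcj
        exact absurd hcj (Finset.notMem_empty _)
      · rw [h1, Finset.mem_singleton] at hcj
        subst hcj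
        exact Or.inr ⟨j, hj, h2, h3⟩
  have hsup : ∀ c ∈ D'.pairs, c ∈ D.pairs ∨ ∃ j ∈ D.curr,
      c.t = m.degree (D.poly k) ⊔ m.degree (D.poly j) ∧
        (DeadPair m D' k j → DeadPair m D' c.k c.l) := by
    intro c hc
    refine (hmemp c hc).imp_right ?_
    rintro ⟨j, hj, hwf, ⟨h1, h2⟩ | ⟨h1, h2⟩⟩
    · exact ⟨j, hj, by rw [hwf.t_eq, h1, h2, hpoly, hpoly], by rw [h1, h2]; exact id⟩
    · exact ⟨j, hj, by rw [hwf.t_eq, h1, h2, hpoly, hpoly, sup_comm],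
        by rw [h1, h2]; exact DeadPair.symm⟩
  have hfresh' : ∀ c ∈ D'.pairs, DeadPair m D' c.k c.l ∨ e < c.t.degree := by
    intro c hc
    rcases hsup c hc with hc | ⟨j, hj, ht, hd⟩
    · exact (hfresh c hc).imp_left (hde _ _)
    -- A new pair stays in degree `e` only if the head of `j` divides that of `k`, and then it is
    -- dead since the top-reduction was refused; otherwise the least common multiple has larger
    -- degree.
    · by_cases hle : m.degree (D.poly j) ≤ m.degree (D.poly k)
      · exact Or.inl (hd (hde _ _ (hdead j hj hle)))
      · right
        have hkt : m.degree (D.poly k) ≤ c.t := ht ▸ le_sup_left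
        rw [← hdegk]
        have h2 : c.t.degree = (c.t - m.degree (D.poly k)).degree
            + (m.degree (D.poly k)).degree := by
          rw [← map_add, tsub_add_cancel_of_le hkt]
        have h3 : (c.t - m.degree (D.poly k)).degree ≠ 0 := by
          rw [Ne, Finsupp.degree_eq_zero_iff, tsub_eq_zero_iff_le]
          intro h4
          exact hle ((ht ▸ le_sup_right : m.degree (D.poly j) ≤ c.t).trans h4)
        omega
  have hkl : ∀ j ∈ A.erase k, j ∈ A ∧ j ≠ k := fun j hj =>
    ⟨(Finset.mem_erase.1 hj).2, (Finset.mem_erase.1 hj).1⟩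
  have hun : ∀ j ∈ D'.curr ∪ A.erase k, j ∈ D.curr ∪ A := by
    intro j hj
    rw [hcurr] at hj
    rcases Finset.mem_union.1 hj with hj | hj
    · rcases Finset.mem_insert.1 hj with rfl | hj
      · exact Finset.mem_union_right _ hk
      · exact Finset.mem_union_left _ hj
    · exact Finset.mem_union_right _ (hkl j hj).1
  refine ⟨?_, hfresh'⟩
  exact {
    B_eq := by rw [hD']; exact h.B_eq
    idx_poly := by rw [hpoly, hidx]; exact h.idx_poly
    idx_sig := by rw [hsig, hidx]; exact h.idx_sig
    idx_mem := hidx ▸ hcurr' h.idx_mem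
    prev_sub := hprev ▸ h.prev_sub.trans hcurr'
    prev_lt := by rw [hprev, hidx]; exact h.prev_lt
    prev_sig := by rw [hprev]; intro j; rw [hsig]; exact h.prev_sig j
    prev_mem := by rw [hprev]; intro j; rw [hpoly]; exact h.prev_mem j
    prev_hom := by rw [hprev]; intro j; rw [hpoly]; exact h.prev_hom j
    prev_deg := by rw [hprev]; intro j; rw [hpoly]; exact h.prev_deg j
    prev_gb := fun g hg hg0 => by
      obtain ⟨j, hj, hle⟩ := h.prev_gb g hg hg0
      exact ⟨j, hprev ▸ hj, by rwa [hpoly]⟩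
    lt_len := fun j hj => by rw [hr]; exact h.lt_len j (hun j hj)
    poly_ne := fun j hj => by
      rw [hpoly]
      rw [hcurr] at hj
      rcases Finset.mem_insert.1 hj with rfl | hj
      · exact hk0
      · exact h.poly_ne j hj
    disj := fun j hj hjc => by
      rw [hcurr] at hjc
      rcases Finset.mem_insert.1 hjc with rfl | hjc
      · exact (hkl _ hj).2 rfl
      · exact h.disj j (hkl j hj).1 hjc
    rule_idx := by rw [hrules, hidx, hr]; exact h.rule_idx
    rule_sig := by rw [hrules]; intro ρ; rw [hsig]; exact h.rule_sig ρ
    rule_mem := by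
      rw [hrules]
      intro ρ hρ
      rw [hpoly, hcurr]
      rcases h.rule_mem ρ hρ with h1 | h1 | h1
      · exact Or.inl (Finset.mem_insert_of_mem h1)
      · by_cases hρk : ρ.2 = k
        · exact Or.inl (hρk ▸ Finset.mem_insert_self _ _)
        · exact Or.inr (Or.inl (Finset.mem_erase.2 ⟨hρk, h1⟩))
      · exact Or.inr (Or.inr h1)
    rule_rep := by rw [hrules]; intro ρ; rw [hpoly]; exact h.rule_rep ρ
    rule_deg := by rw [hrules]; exact h.rule_deg
    rule_rank := by rw [hrules]; exact h.rule_rank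
    rule_pending := by rw [hrules]; exact fun ρ hρ hj => h.rule_pending ρ hρ (hkl _ hj).1
    has_rule := by rw [hprev, hidx, hrules]; exact fun j hj => h.has_rule j (hun j hj)
    nodup := by rw [hrules]; exact h.nodup
    sorted := by rw [hrules]; exact h.sorted
    pair_wf := fun c hc => by
      rcases hmemp c hc with hc | ⟨-, -, hwf, -⟩
      · exact (h.pair_wf c hc).congr hprev hcurr' (fun _ _ => hpoly _) (hpoly _) (hpoly _)
          (hsig _) (hsig _)
      · exact hwf
    pair_all := by
      have hnewp : ∀ j ∈ D.curr, DeadPair m D' k j ∨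
          ∃ c ∈ D'.pairs, c.k = k ∧ c.l = j ∨ c.k = j ∧ c.l = k := by
        intro j hj
        rcases hcases j hj with ⟨h1, -⟩ | ⟨c, h1, -, h2⟩
        · exact Or.inl h1
        · refine Or.inr ⟨c, ?_, h2⟩
          rw [hpairs]
          exact Finset.mem_union_right _ (Finset.mem_biUnion.2 ⟨j, hj, by simp [h1]⟩)
      rw [hcurr, hprev]
      intro i hi hip j hj hij
      rcases Finset.mem_insert.1 hi with rfl | hi'
      · rcases Finset.mem_insert.1 hj with rfl | hj
        · exact absurd rfl hij
        · exact hnewp j hj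
      · rcases Finset.mem_insert.1 hj with rfl | hj
        · exact (hnewp i hi').imp DeadPair.symm fun ⟨c, hc, hcc⟩ => ⟨c, hc, hcc.symm⟩
        · refine (h.pair_all i hi' hip j hj hij).imp (hde _ _) fun ⟨c, hc, hcc⟩ =>
            ⟨c, ?_, hcc⟩
          rw [hpairs]
          exact Finset.mem_union_left _ hc
    pair_deg := fun c hc => by
      rcases hsup c hc with hc | ⟨j, -, ht, -⟩
      · exact h.pair_deg c hc
      · rw [ht, ← hdegk]
        exact Finsupp.degree_mono le_sup_left
    pair_fresh := fun c hc => (hfresh' c hc).imp_right fun hlt ρ hρ _ =>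
      (h.rule_deg ρ (hrules ▸ hρ)).trans_lt hlt }

end Operations

/-! ### Invariants of the phases of a stage -/

section Phases

variable {n : ℕ} {K : Type*} [Field K] {m : MonomialOrder (Fin n)}

/-- All polynomials of `G_curr` that were created in the current stage have degree less than `e`. -/
def CurrLT (X : StageData K m) (D : MStage n K) (e : ℕ) : Prop :=
  ∀ ρ ∈ D.rules, ρ.2 ∈ D.curr → ρ.1.degree + X.d < e

/-- Among the polynomials indexed by `C`, top-reductions by those of `C` and `G_curr` are
excluded by the criteria. -/
def Reduced (m : MonomialOrder (Fin n)) (D : MStage n K) (C : Finset ℕ) : Prop :=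
  ∀ k ∈ C, ∀ l ∈ D.curr ∪ C, l ≠ k → m.degree (D.poly l) ≤ m.degree (D.poly k) → DeadPair m D k l

def LoopInv (X : StageData K m) (D : MStage n K) : Prop :=
  ∃ e, Core X D D.pairs ∅ e

open Classical in
def SpolInv (X : StageData K m) (D : MStage n K) (P : Finset (CritPair n)) (new : Finset ℕ) :
    Prop :=
  ∃ e, Core X D (D.pairs ∪ P) new e ∧ (∀ c ∈ P, c.t.degree = e) ∧
    (∀ c ∈ D.pairs, e < c.t.degree) ∧ (new ≠ ∅ → CurrLT X D e)

structure ReduceCore (X : StageData K m) (D : MStage n K) (todo completed : Finset ℕ) (e : ℕ) :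
    Prop where
  core : Core X D D.pairs (todo ∪ completed) e
  pairs : ∀ c ∈ D.pairs, e < c.t.degree
  disj : ∀ k ∈ todo, k ∉ completed
  fresh : todo ≠ ∅ → CurrLT X D e
  ne_zero : ∀ k ∈ completed, D.poly k ≠ 0
  -- The effect of treating the smallest signature first; it prevents a completed polynomial from
  -- being a reductor of larger signature.
  order : ∀ k ∈ completed, ∀ t ∈ todo, ¬ MSig.lt m (D.sig t) (D.sig k)
  reduced : Reduced m D completed

def ReduceInv (X : StageData K m) (D : MStage n K) (todo completed : Finset ℕ) : Prop :=
  ∃ e, ReduceCore X D todo completed e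

def UpdateInv (X : StageData K m) (D : MStage n K) (Q : Finset ℕ) : Prop :=
  ∃ e, Core X D D.pairs Q e ∧ (∀ k ∈ Q, D.poly k ≠ 0) ∧
    (∀ c ∈ D.pairs, DeadPair m D c.k c.l ∨ e < c.t.degree) ∧ Reduced m D Q

variable {X : StageData K m} {D : MStage n K} {U P : Finset (CritPair n)}
  {A new todo completed Q : Finset ℕ} {e : ℕ} {k j : ℕ} {σ s u : Mon n} {p h : Pol n K} {c : K}

/-! ### Computation of S-polynomials -/

theorem LoopInv.select (H : LoopInv X D) {x : CritPair n} (hx : x ∈ D.pairs)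
    (hmin : ∀ c' ∈ D.pairs, x.t.degree ≤ c'.t.degree) :
    SpolInv X { D with pairs := D.pairs.filter fun c' => c'.t.degree ≠ x.t.degree }
      (D.pairs.filter fun c' => c'.t.degree = x.t.degree) ∅ := by
  classical
  obtain ⟨e, hcore⟩ := H
  refine ⟨x.t.degree, ?_, fun c hc => (Finset.mem_filter.1 hc).2, fun c hc => ?_,
    fun hne => absurd rfl hne⟩
  · have h1 := (hcore.raise (hcore.pair_deg x hx) hmin).withPairs
      (D.pairs.filter fun c' => c'.t.degree ≠ x.t.degree)
    convert h1 using 1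
    ext c
    simp only [Finset.mem_union, Finset.mem_filter]
    tauto
  · obtain ⟨hc, hne⟩ := Finset.mem_filter.1 hc
    exact lt_of_le_of_ne (hmin c hc) (Ne.symm hne)

open Classical in
theorem SpolInv.skip (H : SpolInv X D P new) (ch : PrevChoice) {x : CritPair n} (hx : x ∈ P)
    (hrew : (withoutSetup K m ch).spolReject D x.u x.k ∨
      (withoutSetup K m ch).spolReject D x.v x.l) : SpolInv X D (P.erase x) new := by
  obtain ⟨e, hcore, hP, hpairs, hnew⟩ := H
  refine ⟨e, ?_, fun c hc => hP c (Finset.mem_of_mem_erase hc), hpairs, hnew⟩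
  refine hcore.drop (Finset.union_subset_union_right (Finset.erase_subset _ _)) ?_
  intro c hc hc'
  obtain rfl : c = x := by
    by_contra hne
    rcases Finset.mem_union.1 hc with hc | hc
    · exact hc' (Finset.mem_union_left _ hc)
    · exact hc' (Finset.mem_union_right _ (Finset.mem_erase.2 ⟨hne, hc⟩))
  have hwf := hcore.pair_wf c hc
  unfold DeadPair
  rw [← hwf.t_eq, ← hwf.u_eq, ← hwf.v_eq]
  rcases hrew with ⟨h1, h2⟩ | ⟨h1, h2⟩
  · exact Or.inl ⟨h1, Or.inl h2⟩
  · exact Or.inr ⟨h1, Or.inl h2⟩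

theorem last_of_not_rewritable (hs : D.sig k = some s) (h : ¬ Rewritable D u k) :
    Last D.rules (u + s) k := by
  have := not_rewritable_iff.1 h
  rwa [hs] at this

open Classical in
theorem SpolInv.add (H : SpolInv X D P new) (ch : PrevChoice) {x : CritPair n} (hx : x ∈ P)
    (hu : ¬ (withoutSetup K m ch).spolReject D x.u x.k)
    (hv : ¬ (withoutSetup K m ch).spolReject D x.v x.l) :
    SpolInv X (D.append (withoutSetup K m ch) ((withoutSetup K m ch).mul x.u (D.sig x.k))
        (m.sPolynomial (D.poly x.k) (D.poly x.l))) (P.erase x)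
      (if m.sPolynomial (D.poly x.k) (D.poly x.l) = 0 then new
        else insert D.r.length new) := by
  obtain ⟨e, hcore, hP, hpairs, hnew⟩ := H
  have hxU := Finset.mem_union_right D.pairs hx
  have hwf := hcore.pair_wf x hxU
  have hxe := hP x hx
  have hu' : ¬ Rewritable D x.u x.k := fun h => hu ⟨hwf.k_prev, h⟩
  obtain ⟨s, hs, c, hc, hrep⟩ := hcore.exists_sig (Finset.mem_union_left _ hwf.k_mem) hwf.k_prev
  have hlast := last_of_not_rewritable hs hu'
  have htop : ¬ D.TopRedByPrev m (x.u + s) := by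
    have := hwf.k_top
    rwa [hs] at this
  have hk0 := hcore.poly_ne _ hwf.k_mem
  have hl0 := hcore.poly_ne _ hwf.l_mem
  have hut : x.u + m.degree (D.poly x.k) = x.t := by
    rw [hwf.u_eq, tsub_add_cancel_of_le (hwf.t_eq ▸ le_sup_left)]
  have hvt : x.v + m.degree (D.poly x.l) = x.t := by
    rw [hwf.v_eq, tsub_add_cancel_of_le (hwf.t_eq ▸ le_sup_right)]
  have hdeg : (x.u + s).degree + X.d = e := by
    have h1 := hcore.degree_degree hwf.k_mem hwf.k_prev hs
    have h2 := congrArg Finsupp.degree hut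
    rw [map_add] at h2 ⊢
    omega
  have hndead : ¬ DeadPair m D x.k x.l := by
    unfold DeadPair
    rw [← hwf.t_eq, ← hwf.u_eq, ← hwf.v_eq]
    rintro (⟨h1, h2 | h2⟩ | ⟨h1, h2 | h2⟩)
    · exact hu ⟨h1, h2⟩
    · exact hwf.k_top h2
    · exact hv ⟨h1, h2⟩
    · exact hwf.l_top h1 h2
  -- Only a pair that survives all criteria creates a polynomial, and for such a pair `G_curr` has
  -- no new element of the current degree.
  have hfresh : CurrLT X D e := hxe ▸ (hcore.pair_fresh x hxU).resolve_left hndead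
  have hlow : Rep m X.I X.f X.d 0 (x.u + s) (monomial x.v 1 * D.poly x.l) := by
    by_cases hlp : x.l ∈ D.prev
    · obtain ⟨d, hd⟩ := hcore.prev_hom _ hlp
      refine Rep.of_mem (Ideal.mul_mem_left _ _ (hcore.prev_mem _ hlp)) ?_
      have h1 := isHomogeneous_monomial_mul (u := x.v) (c := (1 : K)) hd
      have h2 := congrArg Finsupp.degree hvt
      rw [map_add, degree_degree_of_isHomogeneous hd hl0] at h2
      rwa [hdeg, ← hxe, ← h2]
    · obtain ⟨s', hs', c', hc', hrep'⟩ :=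
        hcore.exists_sig (Finset.mem_union_left _ hwf.l_mem) hlp
      -- Equal signatures would make both components the owner of the same most recent rule, or both
      -- the new input polynomial. So the signatures differ and the larger one survives in the
      -- S-polynomial.
      have hlt : x.v + s' ≺[m] x.u + s := by
        have h1 := hwf.not_lt
        rw [hs, hs'] at h1
        refine lt_of_le_of_ne (not_lt.1 h1) fun heq => ?_
        have heq' := m.toSyn.injective heq
        have hv' : ¬ Rewritable D x.v x.l := fun h => hv ⟨hlp, h⟩
        have hlast' := last_of_not_rewritable hs' hv'
        rw [heq'] at hlast'
        rcases hlast with h2 | ⟨l₁, ρ, l₂, h2, h3, h4, h5⟩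
        · have hidx : ∀ i ∈ D.curr, i ∉ D.prev → (∀ s'', D.sig i = some s'' → s'' ≤ x.u + s) →
              i = D.idx := by
            intro i hi hip hle
            by_contra hne
            obtain ⟨σ, hσ⟩ := hcore.has_rule i (Finset.mem_union_left _ hi) hip hne
            exact h2 _ hσ (hle σ (hcore.rule_sig _ hσ))
          refine hwf.ne ((hidx _ hwf.k_mem hwf.k_prev ?_).trans
            (hidx _ hwf.l_mem hlp ?_).symm)
          · intro s'' h6
            rw [hs] at h6
            cases h6
            exact le_add_self
          · intro s'' h6
            rw [hs'] at h6
            cases h6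
            rw [← heq']
            exact le_add_self
        · have hnone : ∀ i, Last D.rules (x.u + s) i → i = ρ.2 := by
            intro i hi
            rcases hi with h6 | ⟨l₁', ρ', l₂', h6, h7, h8, h9⟩
            · exact absurd h4 (h6 ρ (by rw [h2]; simp))
            · rw [h2] at h6
              rcases List.append_eq_append_iff.1 h6 with ⟨as, h10, h11⟩ | ⟨as, h10, h11⟩
              · cases as with
                | nil =>
                  simp only [List.nil_append, List.cons.injEq] at h11
                  rw [← h7, h11.1]
                | cons a as =>
                  simp only [List.cons_append, List.cons.injEq] at h11
                  exact absurd h8 (h5 ρ' (by rw [h11.2]; simp))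
              · cases as with
                | nil =>
                  simp only [List.nil_append, List.cons.injEq] at h11
                  rw [← h7, h11.1]
                | cons a as =>
                  simp only [List.cons_append, List.cons.injEq] at h11
                  exact absurd h4 (h9 ρ (by rw [h11.2]; simp))
          exact hwf.ne (h3 ▸ (hnone _ hlast').symm)
      refine Rep.of_lt (by simpa using hrep'.monomial_mul x.v 1) hlt ?_
      have h1 := hcore.degree_degree hwf.l_mem hlp hs'
      have h2 := congrArg Finsupp.degree hvt
      rw [map_add] at h2 hdeg ⊢
      rw [map_add]
      omega
  have hsp : m.sPolynomial (D.poly x.k) (D.poly x.l) =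
      C (m.leadingCoeff (D.poly x.l)) * (monomial x.u 1 * D.poly x.k) +
        C (-m.leadingCoeff (D.poly x.k)) * (monomial x.v 1 * D.poly x.l) := by
    rw [m.sPolynomial_def, ← hwf.t_eq, ← hwf.u_eq, ← hwf.v_eq, ← mul_assoc, ← mul_assoc,
      C_mul_monomial, C_mul_monomial, mul_one, mul_one, map_neg, neg_mul, sub_eq_add_neg]
  have hrepS := (hrep.monomial_mul x.u 1).linear hlow (m.leadingCoeff (D.poly x.l))
    (-m.leadingCoeff (D.poly x.k))
  rw [← hsp, mul_zero, add_zero, one_mul] at hrepS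
  have hmul : (withoutSetup K m ch).mul x.u (D.sig x.k) = some (x.u + s) := by
    rw [hs]; rfl
  rw [hmul]
  have hlc : m.leadingCoeff (D.poly x.l) * c ≠ 0 := mul_ne_zero (by simpa using hl0) hc
  have hdlow : m.degree (monomial x.v 1 * D.poly x.l) = x.u + m.degree (D.poly x.k) := by
    rw [degree_monomial_mul one_ne_zero hl0, hvt, hut]
  have happ := hcore.append ch hwf.k_mem hwf.k_prev hs hlast htop hdeg hfresh hlow
    (by simpa using hl0) hdlow hlc hrepS
    (A' := if m.sPolynomial (D.poly x.k) (D.poly x.l) = 0 then new else insert D.r.length new)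
    (by split_ifs <;> simp) (fun j hj => by
      split_ifs at hj
      · exact Or.inr hj
      · exact Finset.mem_insert.1 hj) (by
      by_cases h0 : m.sPolynomial (D.poly x.k) (D.poly x.l) = 0
      · exact Or.inl h0
      · rw [if_neg h0]
        exact Or.inr (Finset.mem_insert_self _ _))
  have hklt := hcore.lt_len x.k (Finset.mem_union_left _ hwf.k_mem)
  refine ⟨e, happ.drop (Finset.union_subset_union_right (Finset.erase_subset _ _)) ?_,
    fun c hc => hP c (Finset.mem_of_mem_erase hc), hpairs, fun _ ρ hρ hρc => ?_⟩
  · intro c hc hc'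
    obtain rfl : c = x := by
      by_contra hne
      rcases Finset.mem_union.1 hc with hc | hc
      · exact hc' (Finset.mem_union_left _ hc)
      · exact hc' (Finset.mem_union_right _ (Finset.mem_erase.2 ⟨hne, hc⟩))
    have hwf' := happ.pair_wf c hc
    refine Or.inl ?_
    rw [← hwf'.t_eq, ← hwf'.u_eq]
    -- The rule just added makes the first component of the treated pair rewritable, so the pair may
    -- leave the pending set as a rejected one.
    refine ⟨hwf.k_prev, Or.inl ?_⟩
    by_contra hnr
    have h1 := last_of_not_rewritable ((sig_append_of_lt hklt).trans hs) hnr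
    exact (h1.of_append hklt.ne').2 le_rfl
  · rcases List.mem_append.1 hρ with hρ | hρ
    · exact hfresh ρ hρ hρc
    · rw [List.mem_singleton.1 hρ] at hρc
      exact absurd (hcore.lt_len _ (Finset.mem_union_left _ hρc)) (lt_irrefl _)

theorem SpolInv.finish (H : SpolInv X D ∅ new) : ReduceInv X D new ∅ := by
  classical
  obtain ⟨e, hcore, -, hpairs, hnew⟩ := H
  have hcore : Core X D D.pairs new e := by
    convert hcore using 1
    simp
  exact ⟨e, by rwa [Finset.union_empty], hpairs, fun _ _ => Finset.notMem_empty _, hnew,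
    fun _ h => absurd h (Finset.notMem_empty _), fun _ h => absurd h (Finset.notMem_empty _),
    fun _ h => absurd h (Finset.notMem_empty _)⟩

/-! ### Reduction -/

theorem Rep.monic (hp : Rep m X.I X.f X.d c σ p) (hc : c ≠ 0) :
    ∃ c', c' ≠ 0 ∧ Rep m X.I X.f X.d c' σ (F5C.monic m p) := by
  by_cases hp0 : p = 0
  · subst hp0
    rw [monic_zero]
    exact ⟨c, hc, hp⟩
  · refine ⟨(m.leadingCoeff p)⁻¹ * c, mul_ne_zero (inv_ne_zero (by simpa using hp0)) hc, ?_⟩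
    have := hp.linear hp (m.leadingCoeff p)⁻¹ 0
    rwa [zero_mul, add_zero, C_0, zero_mul, add_zero] at this

namespace ReduceCore

variable (H : ReduceCore X D todo completed e)
include H

theorem setPoly (hk : k ∈ todo)
    (hp : ∀ σ, (σ, k) ∈ D.rules → ∃ c, c ≠ 0 ∧ Rep m X.I X.f X.d c σ p) :
    ReduceCore X (D.setPoly k p) todo completed e := by
  have hkA := Finset.mem_union_left completed hk
  have hne : ∀ j ∈ D.curr ∪ completed, j ≠ k := by
    rintro j hj rfl
    rcases Finset.mem_union.1 hj with hj | hj
    · exact H.core.disj _ hkA hj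
    · exact H.disj _ hk hj
  have hpoly : ∀ j ∈ D.curr ∪ completed, (D.setPoly k p).poly j = D.poly j :=
    fun j hj => poly_setPoly_of_ne (hne j hj)
  refine ⟨H.core.setPoly hkA hp, H.pairs, H.disj, H.fresh, fun j hj => ?_, fun j hj t ht => ?_,
    fun j hj l hl hlj hle => ?_⟩
  · rw [hpoly j (Finset.mem_union_right _ hj)]
    exact H.ne_zero j hj
  · rw [sig_setPoly, sig_setPoly]
    exact H.order j hj t ht
  · have hj' := hpoly j (Finset.mem_union_right _ hj)
    have hl' := hpoly l hl
    rw [hj', hl'] at hle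
    exact (H.reduced j hj l hl hlj hle).congr rfl
      (fun b hb => hpoly b (Finset.mem_union_left _ (H.core.prev_sub hb))) hj' hl' sig_setPoly
      sig_setPoly fun _ _ _ h => h

/-- Reduction modulo `B` changes the polynomial by an element of `I` only, so the signature is
untouched. -/
theorem normalForm (hk : k ∈ todo) (hh : IsNormalForm m D.B (D.poly k) h) :
    ReduceCore X (D.setPoly k h) todo completed e := by
  refine H.setPoly hk fun σ hσ => ?_
  obtain ⟨c, hc, hrep⟩ := H.core.rule_rep _ hσ
  refine ⟨c, hc, hrep.congr ?_ ?_⟩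
  · refine isHomogeneous_of_reds hh.1 ?_ hrep.1
    rw [H.core.B_eq]
    exact X.B_hom
  · rw [← X.B_gb.2.2.1, ← H.core.B_eq]
    exact sub_mem_span_of_reds hh.1

theorem exists_sig (hk : k ∈ todo) : ∃ σ, (σ, k) ∈ D.rules ∧ D.sig k = some σ ∧
    σ.degree + X.d = e ∧ ∃ c, c ≠ 0 ∧ Rep m X.I X.f X.d c σ (D.poly k) := by
  have hkA := Finset.mem_union_left completed hk
  obtain ⟨σ, hσ⟩ := H.core.pending_rule hkA
  exact ⟨σ, hσ, H.core.rule_sig _ hσ, H.core.rule_pending _ hσ hkA, H.core.rule_rep _ hσ⟩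

theorem lt_length (hk : k ∈ todo) : k < D.r.length :=
  H.core.lt_len k (Finset.mem_union_right _ (Finset.mem_union_left _ hk))

/-- The multiple of a reductor as an element with a signature. -/
theorem reductor_rep (hk : k ∈ todo) (hk0 : D.poly k ≠ 0) (hσ : D.sig k = some σ)
    (hj : j ∈ D.curr ∪ completed) (hu : u + m.degree (D.poly j) = m.degree (D.poly k)) (t : K) :
    (D.sig j = none ∧ Rep m X.I X.f X.d 0 σ (monomial u t * D.poly j)) ∨
      j ∉ D.prev ∧ ∃ s c, D.sig j = some s ∧ c ≠ 0 ∧ (u + s).degree = σ.degree ∧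
        Rep m X.I X.f X.d (t * c) (u + s) (monomial u t * D.poly j) := by
  obtain ⟨σ', -, hσ', hdeg, c, hc, hrep⟩ := H.exists_sig hk
  obtain rfl := Option.some.inj (hσ.symm.trans hσ')
  have hdk := degree_degree_of_isHomogeneous (m := m) hrep.1 hk0
  have hj0 : D.poly j ≠ 0 := by
    rcases Finset.mem_union.1 hj with hj | hj
    · exact H.core.poly_ne j hj
    · exact H.ne_zero j hj
  have hu' := congrArg Finsupp.degree hu
  rw [map_add, hdk] at hu'
  by_cases hjp : j ∈ D.prev
  · obtain ⟨d, hd⟩ := H.core.prev_hom j hjp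
    refine Or.inl ⟨H.core.prev_sig j hjp,
      Rep.of_mem (Ideal.mul_mem_left _ _ (H.core.prev_mem j hjp)) ?_⟩
    rw [← hu', degree_degree_of_isHomogeneous hd hj0]
    exact isHomogeneous_monomial_mul hd
  · have hjA : j ∈ D.curr ∪ (todo ∪ completed) := by
      rcases Finset.mem_union.1 hj with hj | hj
      · exact Finset.mem_union_left _ hj
      · exact Finset.mem_union_right _ (Finset.mem_union_right _ hj)
    obtain ⟨s, hs, c', hc', hrep'⟩ := H.core.exists_sig hjA hjp
    refine Or.inr ⟨hjp, s, c', hs, hc', ?_, hrep'.monomial_mul u t⟩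
    have h1 := degree_degree_of_isHomogeneous (m := m) hrep'.1 hj0
    rw [map_add]
    omega

theorem zero (hk : k ∈ todo) (hk0 : D.poly k = 0) :
    ReduceCore X D (todo.erase k) completed e := by
  refine ⟨H.core.forget (Finset.union_subset_union_left (Finset.erase_subset _ _)) ?_, H.pairs,
    fun j hj => H.disj j (Finset.mem_of_mem_erase hj), fun hne => H.fresh ?_, H.ne_zero,
    fun j hj t ht => H.order j hj t (Finset.mem_of_mem_erase ht), H.reduced⟩
  · intro j hj hj'
    by_cases hjk : j = k
    · exact hjk ▸ hk0
    · refine absurd ?_ hj'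
      rcases Finset.mem_union.1 hj with hj | hj
      · exact Finset.mem_union_left _ (Finset.mem_erase.2 ⟨hjk, hj⟩)
      · exact Finset.mem_union_right _ hj
  · rintro rfl
    exact Finset.notMem_empty _ hk

theorem pending_degree (hk : k ∈ todo ∪ completed) (hk0 : D.poly k ≠ 0) :
    (m.degree (D.poly k)).degree = e := by
  obtain ⟨σ, hσ⟩ := H.core.pending_rule hk
  obtain ⟨c, -, hrep⟩ := H.core.rule_rep _ hσ
  rw [← H.core.rule_pending _ hσ hk]
  exact degree_degree_of_isHomogeneous hrep.1 hk0

theorem complete (hk : k ∈ todo) (hk0 : D.poly k ≠ 0)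
    (hmin : ∀ k' ∈ todo, ¬ MSig.lt m (D.sig k') (D.sig k))
    (hdead : ∀ l ∈ D.curr ∪ completed, m.degree (D.poly l) ≤ m.degree (D.poly k) →
      DeadPair m D k l) :
    ReduceCore X D (todo.erase k) (insert k completed) e := by
  have hkc := H.disj k hk
  have hA : todo.erase k ∪ insert k completed = todo ∪ completed := by
    ext j
    by_cases hj : j = k
    · subst hj
      simp [hk]
    · simp [hj]
  refine ⟨by rw [hA]; exact H.core, H.pairs, fun j hj => ?_, fun hne => H.fresh ?_,
    fun j hj => ?_, fun j hj t ht => ?_, fun j hj l hl hlj hle => ?_⟩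
  · rw [Finset.mem_insert, not_or]
    exact ⟨(Finset.mem_erase.1 hj).1, H.disj j (Finset.mem_of_mem_erase hj)⟩
  · rintro rfl
    exact Finset.notMem_empty _ hk
  · rcases Finset.mem_insert.1 hj with rfl | hj
    · exact hk0
    · exact H.ne_zero j hj
  · rcases Finset.mem_insert.1 hj with rfl | hj
    · exact hmin t (Finset.mem_of_mem_erase ht)
    · exact H.order j hj t (Finset.mem_of_mem_erase ht)
  · have hl' : l = k ∨ l ∈ D.curr ∪ completed := by
      simp only [Finset.mem_union, Finset.mem_insert] at hl ⊢
      tauto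
    rcases Finset.mem_insert.1 hj with rfl | hjc
    · exact hdead l (hl'.resolve_left hlj) hle
    · rcases hl' with rfl | hl'
      -- Both polynomials have degree `e`, so divisibility of their heads is equality and the pair
      -- can be read in the other direction.
      · refine (hdead j (Finset.mem_union_right _ hjc) (le_of_eq ?_)).symm
        have h1 := H.pending_degree (Finset.mem_union_left _ hk) hk0
        have h2 := H.pending_degree (Finset.mem_union_right _ hjc) (H.ne_zero j hjc)
        have h3 : (m.degree (D.poly j) - m.degree (D.poly l)).degree +
            (m.degree (D.poly l)).degree = (m.degree (D.poly j)).degree := by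
          rw [← map_add, tsub_add_cancel_of_le hle]
        have h4 : m.degree (D.poly j) - m.degree (D.poly l) = 0 := by
          rw [← Finsupp.degree_eq_zero_iff]
          omega
        exact le_antisymm (tsub_eq_zero_iff_le.1 h4) hle
      · exact H.reduced j hjc l hl' hlj hle

/-- If Find_Reductor finds nothing, then all top-reductions are excluded by the criteria. -/
theorem deadPair_of_not_isReductor (ch : PrevChoice) (hk : k ∈ todo)
    (hJ : ∀ j u, ¬ IsReductor (withoutSetup K m ch) D (D.curr ∪ completed) k j u)
    {l : ℕ} (hl : l ∈ D.curr ∪ completed) (hle : m.degree (D.poly l) ≤ m.degree (D.poly k)) :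
    DeadPair m D k l := by
  obtain ⟨σ, hσ, hs, -⟩ := H.exists_sig hk
  refine Or.inr ?_
  rw [sup_eq_left.2 hle]
  have h1 := hJ l (m.degree (D.poly k) - m.degree (D.poly l))
  set u := m.degree (D.poly k) - m.degree (D.poly l)
  -- A divisor skipped because of equal signatures is rewritable anyway: `k` has a rule for this
  -- signature, and only `k` itself could own the multiple.
  by_cases hsig : (withoutSetup K m ch).mul u (D.sig l) = D.sig k
  · rw [hs] at hsig
    obtain ⟨s, hs', hus⟩ := Option.map_eq_some_iff.1 hsig
    refine ⟨fun hp => ?_, Or.inl ?_⟩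
    · rw [H.core.prev_sig l hp] at hs'
      cases hs'
    · by_contra hnr
      subst hus
      obtain ⟨-, rfl⟩ := H.core.eq_of_last hs' (last_of_not_rewritable hs' hnr) hσ
      rcases Finset.mem_union.1 hl with hl | hl
      · exact H.core.disj k (Finset.mem_union_left _ hk) hl
      · exact H.disj k hk hl
  · by_contra hnd
    exact h1 ⟨hl, hle, rfl, hsig, hnd⟩

/-- Adding a new polynomial when the signature of the reductor is larger. -/
theorem append (ch : PrevChoice) (hk : k ∈ todo) (hk0 : D.poly k ≠ 0)
    (hJ : IsReductor (withoutSetup K m ch) D (D.curr ∪ completed) k j u)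
    (hlarge : ¬ MSig.lt m ((withoutSetup K m ch).mul u (D.sig j)) (D.sig k)) :
    ReduceCore X (D.append (withoutSetup K m ch) ((withoutSetup K m ch).mul u (D.sig j))
      (monic m (D.poly k - monomial u (m.leadingCoeff (D.poly k) / m.leadingCoeff (D.poly j)) *
        D.poly j))) (insert D.r.length todo) completed e := by
  obtain ⟨hj, hle, hu, hne, hrej⟩ := hJ
  have hu' : u + m.degree (D.poly j) = m.degree (D.poly k) := by
    rw [hu, tsub_add_cancel_of_le hle]
  obtain ⟨σ, -, hσ, hdeg, c, hc, hrep⟩ := H.exists_sig hk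
  set t := m.leadingCoeff (D.poly k) / m.leadingCoeff (D.poly j) with ht
  rcases H.reductor_rep hk hk0 hσ hj hu' t with ⟨hs, -⟩ | ⟨hjp, s, c', hs, hc', hsd, hrep'⟩
  · refine absurd ?_ hlarge
    rw [hs, hσ]
    trivial
  have hmul : (withoutSetup K m ch).mul u (D.sig j) = some (u + s) := by
    rw [hs]; rfl
  rw [hmul] at hlarge hne ⊢
  rw [hσ] at hlarge hne
  have hlt : σ ≺[m] u + s := by
    refine lt_of_le_of_ne (not_lt.1 hlarge) fun heq => hne ?_
    rw [m.toSyn.injective heq]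
  have hfresh := H.fresh (by rintro rfl; exact Finset.notMem_empty _ hk)
  have hdeg' : (u + s).degree + X.d = e := by rw [hsd, hdeg]
  -- A completed reductor would have degree `e`, hence multiplier 1, and would have been completed
  -- before the smaller signature of `k`, contradicting `order`.
  have hjc : j ∈ D.curr := by
    rcases Finset.mem_union.1 hj with hj | hj
    · exact hj
    · exfalso
      obtain ⟨σ', hσ'⟩ := H.core.pending_rule (Finset.mem_union_right _ hj)
      have h1 := H.core.rule_sig _ hσ'
      obtain rfl := Option.some.inj (hs.symm.trans h1)
      have h2 := H.core.rule_pending _ hσ' (Finset.mem_union_right _ hj)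
      simp only at h2
      have h3 : u = 0 := by
        rw [← Finsupp.degree_eq_zero_iff]
        rw [map_add] at hdeg'
        omega
      subst h3
      rw [zero_add] at hlt
      refine H.order j hj k hk ?_
      rw [hs, hσ]
      exact hlt
  have hlast : Last D.rules (u + s) j :=
    last_of_not_rewritable hs fun h => hrej ⟨hjp, Or.inl h⟩
  have htop : ¬ D.TopRedByPrev m (u + s) := fun h => hrej ⟨hjp, Or.inr (by rw [hs]; exact h)⟩
  have hj0 := H.core.poly_ne j hjc
  have ht0 : t ≠ 0 := div_ne_zero (by simpa using hk0) (by simpa using hj0)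
  have hq := hrep.of_lt hlt hsd.symm
  have hrepP : Rep m X.I X.f X.d (-1 * (t * c')) (u + s)
      (D.poly k - monomial u t * D.poly j) := by
    have := hq.linear hrep' 1 (-1)
    rwa [mul_zero, zero_add, C_1, one_mul, C_neg, C_1, neg_one_mul (monomial u t * D.poly j),
      ← sub_eq_add_neg] at this
  have hcP : -1 * (t * c') ≠ 0 := mul_ne_zero (by simp) (mul_ne_zero ht0 hc')
  obtain ⟨c'', hc'', hrepM⟩ := hrepP.monic hcP
  have happ := H.core.append ch hjc hjp hs hlast htop hdeg' hfresh hq hk0 hu'.symm hc'' hrepM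
    (A' := insert D.r.length todo ∪ completed)
    (Finset.union_subset_union_left (Finset.subset_insert _ _)) (fun i hi => by
      rw [Finset.insert_union] at hi
      exact Finset.mem_insert.1 hi)
    (Or.inr (Finset.mem_union_left _ (Finset.mem_insert_self _ _)))
  have hltc : ∀ i ∈ D.curr ∪ completed, i < D.r.length := by
    intro i hi
    refine H.core.lt_len i ?_
    rcases Finset.mem_union.1 hi with hi | hi
    · exact Finset.mem_union_left _ hi
    · exact Finset.mem_union_right _ (Finset.mem_union_right _ hi)
  refine ⟨happ, H.pairs, fun i hi hic => ?_, fun _ ρ hρ hρc => ?_, fun i hi => ?_,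
    fun i hi x hx => ?_, fun i hi l hl hli hle => ?_⟩
  · rcases Finset.mem_insert.1 hi with rfl | hi
    · exact lt_irrefl _ (hltc _ (Finset.mem_union_right _ hic))
    · exact H.disj i hi hic
  · rcases List.mem_append.1 hρ with hρ | hρ
    · exact hfresh ρ hρ hρc
    · rw [List.mem_singleton.1 hρ] at hρc
      exact absurd (hltc _ (Finset.mem_union_left _ hρc)) (lt_irrefl _)
  · rw [poly_append_of_lt (hltc i (Finset.mem_union_right _ hi))]
    exact H.ne_zero i hi
  · rw [sig_append_of_lt (hltc i (Finset.mem_union_right _ hi))]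
    rcases Finset.mem_insert.1 hx with rfl | hx
    · rw [sig_append_self]
      have h1 := H.order i hi k hk
      rw [hσ] at h1
      cases hsi : D.sig i with
      | none => simp [MSig.lt]
      | some b =>
        rw [hsi] at h1
        exact fun h2 => h1 (hlt.trans h2)
    · rw [sig_append_of_lt (H.lt_length hx)]
      exact H.order i hi x hx
  · have hi' := hltc i (Finset.mem_union_right _ hi)
    have hl' := hltc l hl
    rw [poly_append_of_lt hi', poly_append_of_lt hl'] at hle
    refine (H.reduced i hi l hl hli hle).congr rfl
      (fun b hb => poly_append_of_lt (hltc b (Finset.mem_union_left _ (H.core.prev_sub hb))))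
      (poly_append_of_lt hi') (poly_append_of_lt hl') (sig_append_of_lt hi')
      (sig_append_of_lt hl') fun σ x hx hL => ?_
    refine (hL.of_append ?_).1
    rcases hx with rfl | rfl
    · exact hi'.ne'
    · exact hl'.ne'

/-- Replacing a polynomial by its top-reduction when the signature of the reductor is smaller. -/
theorem replace (ch : PrevChoice) (hk : k ∈ todo) (hk0 : D.poly k ≠ 0)
    (hJ : IsReductor (withoutSetup K m ch) D (D.curr ∪ completed) k j u)
    (hsmall : MSig.lt m ((withoutSetup K m ch).mul u (D.sig j)) (D.sig k)) :
    ReduceCore X (D.setPoly k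
      (monic m (D.poly k - monomial u (m.leadingCoeff (D.poly k) / m.leadingCoeff (D.poly j)) *
        D.poly j))) todo completed e := by
  obtain ⟨hj, hle, hu, hne, hrej⟩ := hJ
  have hu' : u + m.degree (D.poly j) = m.degree (D.poly k) := by
    rw [hu, tsub_add_cancel_of_le hle]
  refine H.setPoly hk fun σ hσ => ?_
  have hs := H.core.rule_sig _ hσ
  obtain ⟨c, hc, hrep⟩ := H.core.rule_rep _ hσ
  set t := m.leadingCoeff (D.poly k) / m.leadingCoeff (D.poly j)
  have hlow : Rep m X.I X.f X.d 0 σ (monomial u t * D.poly j) := by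
    rcases H.reductor_rep hk hk0 hs hj hu' t with ⟨-, h1⟩ | ⟨-, s, c', hs', -, hsd, h1⟩
    · exact h1
    · refine h1.of_lt ?_ hsd
      rw [hs, hs'] at hsmall
      exact hsmall
  have hrepP : Rep m X.I X.f X.d c σ (D.poly k - monomial u t * D.poly j) := by
    have := hrep.linear hlow 1 (-1)
    rwa [mul_zero, add_zero, one_mul, C_1, one_mul, C_neg, C_1, neg_mul, one_mul,
      ← sub_eq_add_neg] at this
  exact hrepP.monic hc

end ReduceCore

theorem ReduceInv.finish (H : ReduceInv X D ∅ completed) : UpdateInv X D completed := by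
  obtain ⟨e, H⟩ := H
  refine ⟨e, ?_, H.ne_zero, fun c hc => Or.inr (H.pairs c hc), H.reduced⟩
  have := H.core
  rwa [Finset.empty_union] at this

open Classical in
theorem UpdateInv.update (H : UpdateInv X D Q) (ch : PrevChoice) (hk : k ∈ Q) :
    UpdateInv X { D with
      pairs := D.pairs ∪ D.curr.biUnion fun j => critPair (withoutSetup K m ch) D k j
      curr := insert k D.curr } (Q.erase k) := by
  obtain ⟨e, hcore, hne, hfresh, hred⟩ := H
  have hkc := hcore.disj k hk
  obtain ⟨h1, h2⟩ := hcore.update ch hk (hne k hk) (fun l hl hle =>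
    hred k hk l (Finset.mem_union_left _ hl) (by rintro rfl; exact hkc hl) hle) hfresh _ rfl
  refine ⟨e, h1, fun j hj => hne j (Finset.mem_of_mem_erase hj), h2, fun j hj l hl hlj hle => ?_⟩
  refine (hred j (Finset.mem_of_mem_erase hj) l ?_ hlj hle).congr rfl (fun _ _ => rfl) rfl rfl rfl
    rfl fun _ _ _ h => h
  simp only [Finset.mem_union, Finset.mem_insert, Finset.mem_erase] at hl ⊢
  rcases hl with (rfl | hl) | hl
  · exact Or.inr hk
  · exact Or.inl hl
  · exact Or.inr hl.2

theorem UpdateInv.finish (H : UpdateInv X D ∅) : LoopInv X D := by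
  obtain ⟨e, hcore, -⟩ := H
  exact ⟨e, hcore⟩

/-! ### The end of a stage -/

theorem Core.isHomogeneous (H : Core X D U A e) (hk : k ∈ D.curr) :
    ∃ d : ℕ, (D.poly k).IsHomogeneous d := by
  by_cases hkp : k ∈ D.prev
  · exact H.prev_hom k hkp
  · obtain ⟨s, -, c, -, hrep⟩ := H.exists_sig (Finset.mem_union_left _ hk) hkp
    exact ⟨_, hrep.1⟩

theorem Core.poly_mem (H : Core X D U A e) (hk : k ∈ D.curr) :
    D.poly k ∈ X.I ⊔ Ideal.span {X.f} := by
  by_cases hkp : k ∈ D.prev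
  · exact Ideal.mem_sup_left (H.prev_mem k hkp)
  · obtain ⟨s, -, c, -, hrep⟩ := H.exists_sig (Finset.mem_union_left _ hk) hkp
    exact hrep.mem_sup

section Graded

attribute [local instance] MvPolynomial.gradedAlgebra

/-- Without pairs the degree bound of the invariant can be raised past any given signature, so
`Core.opt` applies to all of them. -/
theorem LoopInv.exists_degree_le (H : LoopInv X D) (hp : D.pairs = ∅)
    (hpI : p ∈ X.I ⊔ Ideal.span {X.f}) (hp0 : p ≠ 0) :
    ∃ k ∈ D.curr, m.degree (D.poly k) ≤ m.degree p := by
  obtain ⟨e, hcore⟩ := H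
  rw [hp] at hcore
  have hI : X.I.IsHomogeneous (homogeneousSubmodule (Fin n) K) := by
    rw [← X.B_gb.2.2.1]
    exact isHomogeneous_span X.B_hom
  rcases exists_opt_of_mem_sup hI X.f_hom hpI hp0 with ⟨g, hg, hg0, hd⟩ | ⟨σ, ho⟩
  · obtain ⟨k, hk, hle⟩ := hcore.prev_gb g hg hg0
    exact ⟨k, hcore.prev_sub hk, hd ▸ hle⟩
  · obtain ⟨k, u, s, hk, hs, hu, hl⟩ := hcore.exists_canonical σ
    have ht := hcore.not_topRed_of_opt ho
    have hkp : k ∉ D.prev := by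
      rcases hk with rfl | ⟨ρ, hρ, rfl⟩
      · exact hcore.idx_notMem_prev
      · exact hcore.rule_notMem_prev hρ
    have hkc : k ∈ D.curr := by
      rcases hk with rfl | ⟨ρ, hρ, rfl⟩
      · exact hcore.idx_mem
      · rcases hcore.rule_mem ρ hρ with h1 | h1 | h1
        · exact h1
        · exact absurd h1 (Finset.notMem_empty _)
        · exfalso
          obtain rfl := Option.some.inj (hs.symm.trans (hcore.rule_sig ρ hρ))
          obtain ⟨c, hc, hr⟩ := hcore.rule_rep ρ hρ
          rw [h1] at hr
          have hr' := hr.monomial_mul u 1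
          rw [mul_zero, one_mul, hu] at hr'
          exact ho.not_syzygy hc hr'
    have hcore' := hcore.raise (e' := e + (σ.degree + X.d + 1)) (Nat.le_add_right _ _)
      fun c hc => absurd hc (Finset.notMem_empty _)
    have ho' := hcore'.opt (by omega) ht hkc hkp hs hu hl
    exact ⟨k, hkc, ho.unique ho' ▸ le_add_self⟩

end Graded

theorem LoopInv.isGroebnerBasis (H : LoopInv X D) (hp : D.pairs = ∅) :
    IsGroebnerBasis m (X.I ⊔ Ideal.span {X.f}) {p | ∃ k ∈ D.curr, p = D.poly k} := by
  obtain ⟨e, hcore⟩ := id H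
  refine isGroebnerBasis_of_degree ?_ ?_ ?_
  · refine (D.curr.finite_toSet.image D.poly).subset ?_
    rintro p ⟨k, hk, rfl⟩
    exact ⟨k, hk, rfl⟩
  · rintro p ⟨k, hk, rfl⟩
    exact hcore.poly_mem hk
  · intro p hpI hp0
    obtain ⟨k, hk, hle⟩ := H.exists_degree_le hp hpI hp0
    exact ⟨_, ⟨k, hk, rfl⟩, hcore.poly_ne k hk, hle⟩

end Phases

/-! ### Passage between stages and the measure of a stage -/

section Stages

variable {n : ℕ} {K : Type*} [Field K] {m : MonomialOrder (Fin n)}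

abbrev MConfig (n : ℕ) (K : Type*) [Field K] := Config n K (MSig n) (MRules n)

/-- The invariant at the head of the loop of the main procedure. -/
structure OuterInv (m : MonomialOrder (Fin n)) (F fs : List (Pol n K)) (B : Set (Pol n K))
    (prev : Finset ℕ) (r : List (Labeled n K (MSig n))) (gs : List (Pol n K)) : Prop where
  perm : (gs ++ fs).Perm F
  gb : IsGroebnerBasis m (Ideal.span {g | g ∈ gs}) B
  hom : ∀ g ∈ B, ∃ d : ℕ, g.IsHomogeneous d
  prev_lt : ∀ k ∈ prev, k < r.length
  prev_sig : ∀ k ∈ prev, (r.getD k ⟨default, 0⟩).sig = none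
  prev_mem : ∀ k ∈ prev, (r.getD k ⟨default, 0⟩).poly ∈ Ideal.span {g | g ∈ gs}
  prev_ne : ∀ k ∈ prev, (r.getD k ⟨default, 0⟩).poly ≠ 0
  prev_hom : ∀ k ∈ prev, ∃ d : ℕ, (r.getD k ⟨default, 0⟩).poly.IsHomogeneous d
  prev_gb : ∀ p ∈ Ideal.span {g | g ∈ gs}, p ≠ 0 →
    ∃ k ∈ prev, m.degree (r.getD k ⟨default, 0⟩).poly ≤ m.degree p

/-- The ideal at the end of the stage `X`, after which the input polynomials `fs` are left. -/
def Link (F fs : List (Pol n K)) (X : StageData K m) : Prop :=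
  ∃ gs : List (Pol n K), (gs ++ fs).Perm F ∧ X.I ⊔ Ideal.span {X.f} = Ideal.span {g | g ∈ gs}

variable {X : StageData K m} {D : MStage n K} {F fs gs : List (Pol n K)} {f : Pol n K}
  {B : Set (Pol n K)} {prev : Finset ℕ} {r : List (Labeled n K (MSig n))} {rules : MRules n}

theorem span_append_singleton (gs : List (Pol n K)) (f : Pol n K) :
    Ideal.span {g | g ∈ gs ++ [f]} = Ideal.span {g | g ∈ gs} ⊔ Ideal.span {f} := by
  rw [← Ideal.span_union]
  congr 1
  ext g
  simp [or_comm]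

theorem perm_append_singleton_append (gs : List (Pol n K)) (f : Pol n K) (fs : List (Pol n K)) :
    gs ++ [f] ++ fs = gs ++ f :: fs := by simp

theorem isGroebnerBasis_singleton (hf : f ≠ 0) : IsGroebnerBasis m (Ideal.span {f}) {f} := by
  refine ⟨Set.finite_singleton f, Ideal.subset_span, rfl, fun p hp hp0 => ⟨f, rfl, hf, ?_⟩⟩
  obtain ⟨a, rfl⟩ := Ideal.mem_span_singleton'.1 hp
  rw [m.degree_mul (left_ne_zero_of_mul hp0) hf]
  exact le_add_self

theorem OuterInv.sort (hf : f ≠ 0) (hhom : ∃ d : ℕ, f.IsHomogeneous d) (hF : (f :: fs).Perm F) :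
    OuterInv m F fs {f} {0} [⟨none, monic m f⟩] [f] := by
  have hspan : Ideal.span {g | g ∈ [f]} = Ideal.span {f} := by simp
  have hgb := isGroebnerBasis_singleton (m := m) hf
  rw [← hspan] at hgb
  obtain ⟨d, hd⟩ := hhom
  refine ⟨hF, hgb, ?_, ?_, ?_, ?_, ?_, ?_, ?_⟩
  · rintro g rfl
    exact ⟨d, hd⟩
  · simp
  · simp
  · simp only [Finset.mem_singleton, forall_eq, List.getD_cons_zero, hspan]
    exact Ideal.mul_mem_left _ _ (Ideal.mem_span_singleton_self f)
  · simpa using monic_ne_zero hf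
  · simpa using Exists.intro d (isHomogeneous_monic hd)
  · intro p hp hp0
    obtain ⟨g, rfl, -, hle⟩ := hgb.2.2.2 p hp hp0
    exact ⟨0, Finset.mem_singleton_self 0, by simpa [degree_monic] using hle⟩

/-- The start of a stage. -/
theorem OuterInv.enter (H : OuterInv m F (f :: fs) B prev r gs) (hf : f ≠ 0)
    (hhom : ∃ d : ℕ, f.IsHomogeneous d) (ch : PrevChoice) (rules : MRules n) :
    ∃ X : StageData K m, Link F fs X ∧
      LoopInv X (F5C.enter (withoutSetup K m ch) f B prev r rules) := by
  classical
  obtain ⟨d, hd⟩ := hhom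
  obtain ⟨M, hM, hM'⟩ := exists_finset_opt m (Ideal.span {g | g ∈ gs}) (monic m f) d
  set poly : ℕ → Pol n K := fun k => (r.getD k ⟨default, 0⟩).poly
  let X : StageData K m :=
    { I := Ideal.span {g | g ∈ gs}
      f := monic m f
      d := d
      B := B
      M := M
      -- Dominates both kinds of heads that can bound a multiplier: those of `M` and those of
      -- `G_prev`.
      C := M.sup (fun a => a.2.degree) ⊔ prev.sup fun k => (m.degree (poly k)).degree
      f_hom := isHomogeneous_monic hd
      B_gb := H.gb
      B_hom := H.hom
      M_opt := hM
      opt_M := hM'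
      M_deg := fun a ha => le_sup_of_le_left (Finset.le_sup (f := fun a => a.2.degree) ha) }
  refine ⟨X, ⟨gs ++ [f], ?_, ?_⟩, 0, ?_⟩
  · rw [perm_append_singleton_append]
    exact H.perm
  · rw [span_append_singleton]
    exact congrArg _ (span_monic hf)
  set D := F5C.enter (withoutSetup K m ch) f B prev r rules with hD
  have hp : ∀ k ∈ prev, D.poly k = (r.getD k ⟨default, 0⟩).poly := by
    intro k hk
    have := H.prev_lt k hk
    simp [hD, F5C.enter, Stage.poly, List.getD_eq_getElem?_getD, List.getElem?_append_left this]
  have hs : ∀ k ∈ prev, D.sig k = none := by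
    intro k hk
    rw [← H.prev_sig k hk]
    have := H.prev_lt k hk
    simp [hD, F5C.enter, Stage.sig, List.getD_eq_getElem?_getD, List.getElem?_append_left this]
  have hcurr : D.curr = insert r.length prev := rfl
  have hrules : D.rules = [] := rfl
  have hnr : ∀ ρ, ρ ∉ D.rules := by simp [hrules]
  have hnp : r.length ∉ prev := fun h => lt_irrefl _ (H.prev_lt _ h)
  have hip : D.poly r.length = monic m f := by
    simp [hD, F5C.enter, Stage.poly, List.getD_eq_getElem?_getD]
  have his : D.sig r.length = some 0 := by
    simp [hD, F5C.enter, Stage.sig, List.getD_eq_getElem?_getD, withoutSetup]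
  have hpairs : D.pairs = prev.biUnion fun j => critPair (withoutSetup K m ch) D r.length j := rfl
  have hcases := fun l (hl : l ∈ prev) => critPair_cases (m := m) (D := D) ch
    (k := r.length) (l := l) (hcurr ▸ Finset.mem_insert_self _ _) hnp
    (hcurr ▸ Finset.mem_insert_of_mem hl) (fun h => hnp (h ▸ hl)) hs
  refine
    { B_eq := rfl
      idx_poly := hip
      idx_sig := his
      idx_mem := Finset.mem_insert_self _ _
      prev_sub := Finset.subset_insert _ _
      prev_lt := H.prev_lt
      prev_sig := hs
      prev_mem := fun k hk => hp k hk ▸ H.prev_mem k hk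
      prev_hom := fun k hk => by rw [hp k hk]; exact H.prev_hom k hk
      prev_deg := fun k hk => ?_
      prev_gb := fun p hpI hp0 => ?_
      lt_len := fun k hk => ?_
      poly_ne := fun k hk => ?_
      disj := fun k hk => absurd hk (Finset.notMem_empty _)
      rule_idx := fun ρ hρ => absurd hρ (hnr ρ)
      rule_sig := fun ρ hρ => absurd hρ (hnr ρ)
      rule_mem := fun ρ hρ => absurd hρ (hnr ρ)
      rule_rep := fun ρ hρ => absurd hρ (hnr ρ)
      rule_deg := fun ρ hρ => absurd hρ (hnr ρ)
      rule_rank := fun ρ hρ => absurd hρ (hnr ρ)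
      rule_pending := fun ρ hρ => absurd hρ (hnr ρ)
      has_rule := fun k hk hkp hki => ?_
      nodup := by rw [hrules]; exact List.nodup_nil
      sorted := by rw [hrules]; exact List.Pairwise.nil
      pair_wf := fun c hc => ?_
      pair_all := fun k hk hkp l hl hlk => ?_
      pair_deg := fun c hc => Nat.zero_le _
      pair_fresh := fun c hc => Or.inr fun ρ hρ => absurd hρ (hnr ρ) }
  · rw [hp k hk]
    exact le_sup_of_le_right (Finset.le_sup (f := fun k => (m.degree (poly k)).degree) hk)
  · obtain ⟨k, hk, hle⟩ := H.prev_gb p hpI hp0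
    exact ⟨k, hk, by rwa [hp k hk]⟩
  · have hlen : D.r.length = r.length + 1 := by simp [hD, F5C.enter]
    rw [Finset.union_empty, hcurr] at hk
    rw [hlen]
    rcases Finset.mem_insert.1 hk with rfl | hk
    · exact Nat.lt_succ_self _
    · exact (H.prev_lt k hk).trans (Nat.lt_succ_self _)
  · rw [hcurr] at hk
    rcases Finset.mem_insert.1 hk with rfl | hk
    · rw [hip]
      exact monic_ne_zero hf
    · rw [hp k hk]
      exact H.prev_ne k hk
  · rw [Finset.union_empty, hcurr] at hk
    exact absurd ((Finset.mem_insert.1 hk).resolve_left hki) hkp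
  · rw [hpairs] at hc
    obtain ⟨l, hl, hc⟩ := Finset.mem_biUnion.1 hc
    rcases hcases l hl with ⟨-, h⟩ | ⟨c', h, hwf, -⟩
    · rw [h] at hc
      exact absurd hc (Finset.notMem_empty _)
    · rw [h, Finset.mem_singleton] at hc
      exact hc ▸ hwf
  · rw [hcurr] at hk hl
    obtain rfl := (Finset.mem_insert.1 hk).resolve_right hkp
    have hl := (Finset.mem_insert.1 hl).resolve_left hlk
    rcases hcases l hl with ⟨h, -⟩ | ⟨c, h, -, hkl⟩
    · exact Or.inl h
    · refine Or.inr ⟨c, ?_, hkl⟩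
      rw [hpairs]
      exact Finset.mem_biUnion.2 ⟨l, hl, h ▸ Finset.mem_singleton_self c⟩

/-- The end of a stage. -/
theorem LoopInv.leave (H : LoopInv X D) (hX : Link F fs X) (hp : D.pairs = ∅) {ch : PrevChoice}
    (hB : IsInterreduction m {p | ∃ k ∈ D.curr, p = D.poly k} B)
    (hr : (withoutSetup K m ch).restart D B prev r rules) : ∃ gs, OuterInv m F fs B prev r gs := by
  obtain ⟨gs, hperm, hspan⟩ := hX
  have hgb := H.isGroebnerBasis hp
  rw [hspan] at hgb
  have hBgb := hgb.interreduction hB.1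
  obtain ⟨e, hcore⟩ := id H
  have hhom : ∀ g ∈ {p | ∃ k ∈ D.curr, p = D.poly k}, ∃ d : ℕ, g.IsHomogeneous d := by
    rintro g ⟨k, hk, rfl⟩
    exact hcore.isHomogeneous hk
  have hBhom := isHomogeneous_of_interSteps hhom hB.1
  obtain ⟨-, hr⟩ := hr
  refine ⟨gs, ?_⟩
  cases ch with
  | reduced =>
    obtain ⟨b, -, rfl, rfl, rfl⟩ := hr
    have hget : ∀ k ∈ Finset.range b.length, ∃ p ∈ b,
        ((b.map fun p => (⟨none, p⟩ : Labeled n K (MSig n))).getD k ⟨default, 0⟩) = ⟨none, p⟩ := by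
      intro k hk
      have hk := Finset.mem_range.1 hk
      exact ⟨b[k], List.getElem_mem hk, by simp [List.getD_eq_getElem?_getD, hk]⟩
    refine ⟨hperm, hBgb, hBhom, fun k hk => ?_, fun k hk => ?_, fun k hk => ?_, fun k hk => ?_,
      fun k hk => ?_, fun p hpI hp0 => ?_⟩
    · simpa using hk
    · obtain ⟨p, -, h⟩ := hget k hk
      rw [h]
    · obtain ⟨p, hpb, h⟩ := hget k hk
      rw [h]
      exact hBgb.2.1 hpb
    · obtain ⟨p, hpb, h⟩ := hget k hk
      rw [h]
      rintro (rfl : p = 0)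
      have h1 := (hB.2 0 hpb).1
      rw [m.leadingCoeff_zero] at h1
      exact zero_ne_one h1
    · obtain ⟨p, hpb, h⟩ := hget k hk
      rw [h]
      exact hBhom p hpb
    · obtain ⟨g, hg, -, hle⟩ := hBgb.2.2.2 p hpI hp0
      obtain ⟨k, hk, rfl⟩ := List.getElem_of_mem hg
      exact ⟨k, Finset.mem_range.2 hk, by simpa [List.getD_eq_getElem?_getD, hk] using hle⟩
  | unreduced =>
    obtain ⟨rfl, rfl⟩ := hr
    have hget : ∀ k, ((D.r.map fun x => (⟨none, x.poly⟩ : Labeled n K (MSig n))).getD k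
        ⟨default, 0⟩) = ⟨none, D.poly k⟩ := by
      intro k
      simp only [Stage.poly, List.getD_eq_getElem?_getD, List.getElem?_map]
      cases D.r[k]? <;> rfl
    refine ⟨hperm, hBgb, hBhom, fun k hk => ?_, fun k hk => ?_, fun k hk => ?_, fun k hk => ?_,
      fun k hk => ?_, fun p hpI hp0 => ?_⟩
    · simpa using hcore.lt_len k (Finset.mem_union_left _ hk)
    · rw [hget]
    · rw [hget]
      exact hgb.2.1 ⟨k, hk, rfl⟩
    · rw [hget]
      exact hcore.poly_ne k hk
    · rw [hget]
      exact hcore.isHomogeneous hk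
    · obtain ⟨g, ⟨k, hk, rfl⟩, -, hle⟩ := hgb.2.2.2 p hpI hp0
      exact ⟨k, hk, by rwa [hget]⟩

/-- The early return is sound even with inputs left over, because the ideal of the inputs used so
far is contained in ⟨F⟩. -/
theorem LoopInv.isGroebnerBasis_one (H : LoopInv X D) (hX : Link F fs X)
    (h1 : ∃ k ∈ D.curr, D.poly k = 1) : IsGroebnerBasis m (Ideal.span {f | f ∈ F}) {1} := by
  obtain ⟨gs, hperm, hspan⟩ := hX
  obtain ⟨e, hcore⟩ := H
  obtain ⟨k, hk, hk1⟩ := h1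
  have hmem := hcore.poly_mem hk
  rw [hk1, hspan] at hmem
  have hle : Ideal.span {g | g ∈ gs} ≤ Ideal.span {f | f ∈ F} :=
    Ideal.span_mono fun g hg => hperm.subset (List.mem_append_left _ hg)
  have h := isGroebnerBasis_singleton (m := m) (one_ne_zero (α := Pol n K))
  rwa [show Ideal.span {(1 : Pol n K)} = Ideal.span {f | f ∈ F} by
    rw [Ideal.span_singleton_one, (Ideal.eq_top_iff_one _).2 (hle hmem)]] at h

/-! ### The measure of a stage -/

/-- The number of times that `p` can be top-reduced, up to a constant. -/
noncomputable def weight (m : MonomialOrder (Fin n)) (p : Pol n K) : ℕ :=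
  open Classical in
  -- Weight 1 for 0 makes discarding it a decrease; at least 2 for nonzero polynomials lets a
  -- completed one be counted with 1.
  if p = 0 then 1 else {τ | τ.degree = (m.degree p).degree ∧ τ ≺[m] m.degree p}.ncard + 2

theorem one_le_weight (p : Pol n K) : 1 ≤ weight m p := by
  unfold weight
  split_ifs <;> omega

theorem two_le_weight {p : Pol n K} (hp : p ≠ 0) : 2 ≤ weight m p := by
  rw [weight, if_neg hp]
  omega

theorem weight_lt {p q : Pol n K} (hq : q ≠ 0)
    (h : p = 0 ∨ (m.degree p).degree = (m.degree q).degree ∧ m.degree p ≺[m] m.degree q) :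
    weight m p < weight m q := by
  by_cases hp : p = 0
  · rw [weight, if_pos hp]
    exact two_le_weight hq
  obtain ⟨hd, hlt⟩ := h.resolve_left hp
  rw [weight, if_neg hp, weight, if_neg hq, add_lt_add_iff_right]
  refine Set.ncard_lt_ncard ⟨fun τ hτ => ⟨hτ.1.trans hd, hτ.2.trans hlt⟩, fun hsub => ?_⟩
    ((finite_degree_le n (m.degree q).degree).subset fun τ hτ => hτ.1.le)
  exact lt_irrefl _ (hsub (show _ ∧ _ from ⟨hd, hlt⟩)).2

theorem weight_monic (p : Pol n K) : weight m (monic m p) = weight m p := by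
  by_cases hp : p = 0
  · rw [hp, monic_zero]
  · rw [weight, weight, if_neg hp, if_neg (monic_ne_zero hp), degree_monic]

/-- The measure that decreases with every step within a stage, if `N` is a bound for the number of
rules. -/
noncomputable def stageMeasure (m : MonomialOrder (Fin n)) (N : ℕ) :
    MConfig n K → ℕ ×ₗ ℕ ×ₗ ℕ
  -- A selection moves at least one pair, trading 5 for 1 per pair and adding the offset 3, which is
  -- a decrease. The offsets 3, 2, 1, 0 let each change of phase decrease the measure.
  | .loop _ D => toLex (N - D.rules.length, toLex (0, 5 * D.pairs.card))
  | .spol _ D P new => toLex (N - D.rules.length, toLex (∑ k ∈ new, weight m (D.poly k),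
      5 * D.pairs.card + P.card + 3))
  | .reduce _ D todo completed => toLex (N - D.rules.length,
      toLex (∑ k ∈ todo, weight m (D.poly k) + completed.card, 5 * D.pairs.card + 2))
  | .update _ D Q => toLex (N - D.rules.length, toLex (Q.card, 5 * D.pairs.card + 1))
  | _ => toLex (0, toLex (0, 0))

theorem lex_lt_of_snd {a b c a' b' c' : ℕ} (h1 : a' = a) (h2 : b' < b ∨ b' = b ∧ c' < c) :
    (toLex (a', toLex (b', c')) : ℕ ×ₗ ℕ ×ₗ ℕ) < toLex (a, toLex (b, c)) := by
  subst h1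
  rw [Prod.Lex.toLex_lt_toLex]
  refine Or.inr ⟨rfl, ?_⟩
  rw [Prod.Lex.toLex_lt_toLex]
  exact h2

theorem lex_lt_of_fst {a b c a' b' c' : ℕ} (h : a' < a) :
    (toLex (a', toLex (b', c')) : ℕ ×ₗ ℕ ×ₗ ℕ) < toLex (a, toLex (b, c)) := by
  rw [Prod.Lex.toLex_lt_toLex]
  exact Or.inl h

end Stages

section Runs

variable {n : ℕ} {K : Type*} [Field K] {m : MonomialOrder (Fin n)}

/-- The invariant within a stage. -/
inductive StageInv (X : StageData K m) (fs : List (Pol n K)) : MConfig n K → Prop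
  | loop {D : MStage n K} (H : LoopInv X D) : StageInv X fs (.loop fs D)
  | spol {D : MStage n K} {P : Finset (CritPair n)} {new : Finset ℕ} (H : SpolInv X D P new) :
      StageInv X fs (.spol fs D P new)
  | reduce {D : MStage n K} {todo completed : Finset ℕ} (H : ReduceInv X D todo completed) :
      StageInv X fs (.reduce fs D todo completed)
  | update {D : MStage n K} {Q : Finset ℕ} (H : UpdateInv X D Q) : StageInv X fs (.update fs D Q)

/-- The invariant of a run on the input `F`. -/
inductive RunInv (m : MonomialOrder (Fin n)) (F : List (Pol n K)) : MConfig n K → Prop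
  | start : RunInv m F (.start F)
  | outer {fs gs : List (Pol n K)} {B : Set (Pol n K)} {prev : Finset ℕ}
      {r : List (Labeled n K (MSig n))} {rules : MRules n} (H : OuterInv m F fs B prev r gs) :
      RunInv m F (.outer fs B prev r rules)
  | stage {fs : List (Pol n K)} {X : StageData K m} {x : MConfig n K} (hX : Link F fs X)
      (H : StageInv X fs x) : RunInv m F x
  | done {B : Set (Pol n K)} (H : IsGroebnerBasis m (Ideal.span {f | f ∈ F}) B) :
      RunInv m F (.done B)

variable {X : StageData K m} {F fs gs : List (Pol n K)} {x y : MConfig n K} {D : MStage n K}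
  {ch : PrevChoice}

theorem StageInv.exists_core (H : StageInv X fs x) (hx : x.stage? = some D) :
    ∃ U A e, Core X D U A e := by
  cases H with
  | loop H =>
    cases hx
    obtain ⟨e, h⟩ := H
    exact ⟨_, _, e, h⟩
  | spol H =>
    cases hx
    obtain ⟨e, h, -⟩ := H
    exact ⟨_, _, e, h⟩
  | reduce H =>
    cases hx
    obtain ⟨e, h⟩ := H
    exact ⟨_, _, e, h.core⟩
  | update H =>
    cases hx
    obtain ⟨e, h, -⟩ := H
    exact ⟨_, _, e, h⟩

theorem eq_zero_of_isNormalForm_zero {G : Set (Pol n K)} {h : Pol n K}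
    (hh : IsNormalForm m G 0 h) : h = 0 := by
  rcases Relation.ReflTransGen.cases_head hh.1 with h1 | ⟨q, ⟨g, -, -, a, ha, -⟩, -⟩
  · exact h1.symm
  · simp at ha

/-- Invariance and descent are proved together, since the bound `N` on the rules is available only
for states that satisfy the invariant. -/
theorem StageInv.step (H : StageInv X fs x) (hX : Link F fs X) {N : ℕ}
    (hN : ∀ (D : MStage n K) (U : Finset (CritPair n)) (A : Finset ℕ) (e : ℕ),
      Core X D U A e → D.rules.length ≤ N)
    (hxy : Step (withoutSetup K m ch) x y) :
    (StageInv X fs y ∧ stageMeasure m N y < stageMeasure m N x) ∨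
      (∃ B prev r rules gs, y = .outer fs B prev r rules ∧ OuterInv m F fs B prev r gs) ∨
        ∃ B, y = .done B ∧ IsGroebnerBasis m (Ideal.span {f | f ∈ F}) B := by
  classical
  cases hxy with
  | sort => cases H
  | ret => cases H
  | enter => cases H
  | retOne _ D hp h1 =>
    cases H with
    | loop H => exact Or.inr (Or.inr ⟨_, rfl, H.isGroebnerBasis_one hX h1⟩)
  | leave _ D hp h1 B prev r rules hB hr =>
    cases H with
    | loop H =>
      obtain ⟨gs, h⟩ := H.leave hX hp hB hr
      exact Or.inr (Or.inl ⟨B, prev, r, rules, gs, rfl, h⟩)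
  | select _ D c hc hmin =>
    cases H with
    | loop H =>
      refine Or.inl ⟨.spol (H.select hc hmin), lex_lt_of_snd rfl (Or.inr ⟨by simp, ?_⟩)⟩
      have h1 := Finset.card_filter_add_card_filter_not (s := D.pairs)
        (fun c' => c'.t.degree = c.t.degree)
      have h2 : 0 < (D.pairs.filter fun c' => c'.t.degree = c.t.degree).card :=
        Finset.card_pos.2 ⟨c, Finset.mem_filter.2 ⟨hc, rfl⟩⟩
      simp only [ne_eq] at h1 ⊢
      omega
  | spolSkip _ D P new c hc hmin hrew =>
    cases H with
    | spol H =>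
      refine Or.inl ⟨.spol (H.skip ch hc hrew), lex_lt_of_snd rfl (Or.inr ⟨rfl, ?_⟩)⟩
      have := Finset.card_erase_lt_of_mem hc
      omega
  | spolAdd _ D P new c hc hmin hu hv s hs =>
    cases H with
    | spol H =>
      subst hs
      have h := H.add ch hc hu hv
      refine Or.inl ⟨.spol h, lex_lt_of_fst ?_⟩
      obtain ⟨e, h, -⟩ := h
      -- The lengthened list still has at most `N` rules, so the truncated difference really drops.
      have h1 := hN _ _ _ _ h
      have h2 : ∀ (s : MSig n) p, (D.append (withoutSetup K m ch) s p).rules.length =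
          D.rules.length + 1 := fun s p => by simp [Stage.append, withoutSetup]
      rw [h2] at h1 ⊢
      omega
  | spolEnd _ D new =>
    cases H with
    | spol H =>
      exact Or.inl ⟨.reduce H.finish, lex_lt_of_snd rfl (Or.inr ⟨by simp, by simp⟩)⟩
  | reduceZero _ D D' todo completed k h hk hmin hh hD' h0 =>
    cases H with
    | reduce H =>
      obtain ⟨e, H⟩ := H
      subst hD' h0
      have H' := H.normalForm hk hh
      refine Or.inl ⟨.reduce ⟨e, H'.zero hk (poly_setPoly_self (H.lt_length hk))⟩,
        lex_lt_of_snd rfl (Or.inl ?_)⟩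
      have h1 : ∑ i ∈ todo.erase k, weight m ((D.setPoly k 0).poly i) =
          ∑ i ∈ todo.erase k, weight m (D.poly i) :=
        Finset.sum_congr rfl fun i hi => by rw [poly_setPoly_of_ne (Finset.ne_of_mem_erase hi)]
      have h2 := Finset.add_sum_erase todo (fun i => weight m (D.poly i)) hk
      have h3 := one_le_weight (m := m) (D.poly k)
      omega
  | reduceDone _ D D' todo completed k h hk hmin hh hD' h0 hJ =>
    cases H with
    | reduce H =>
      obtain ⟨e, H⟩ := H
      subst hD'
      have hlen := H.lt_length hk
      have hk0 : D.poly k ≠ 0 := fun hz => h0 (eq_zero_of_isNormalForm_zero (hz ▸ hh))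
      have hlen' : k < (D.setPoly k h).r.length := by simpa [Stage.setPoly] using hlen
      have H1 := H.normalForm hk hh
      have hpk : (D.setPoly k h).poly k = h := poly_setPoly_self hlen
      have H2 : ReduceCore X ((D.setPoly k h).setPoly k (monic m h)) todo completed e := by
        refine H1.setPoly hk fun σ hσ => ?_
        obtain ⟨c, hc, hrep⟩ := H1.core.rule_rep _ hσ
        rw [hpk] at hrep
        exact hrep.monic hc
      have hne : ∀ j ∈ D.curr ∪ completed, j ≠ k := by
        rintro j hj rfl
        rcases Finset.mem_union.1 hj with hj | hj
        · exact H.core.disj j (Finset.mem_union_left _ hk) hj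
        · exact H.disj j hk hj
      have hpk' : ((D.setPoly k h).setPoly k (monic m h)).poly k = monic m h :=
        poly_setPoly_self hlen'
      have hpj : ∀ j ∈ D.curr ∪ completed,
          ((D.setPoly k h).setPoly k (monic m h)).poly j = (D.setPoly k h).poly j :=
        fun j hj => poly_setPoly_of_ne (hne j hj)
      have H3 := H2.complete hk (by rw [hpk']; exact monic_ne_zero h0)
        (fun k' hk' => by
          rw [sig_setPoly, sig_setPoly, sig_setPoly, sig_setPoly]
          exact hmin k' hk') (fun l hl hle => by
          have hdeg : m.degree (monic m h) = m.degree ((D.setPoly k h).poly k) := by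
            rw [hpk, degree_monic]
          rw [hpk', hpj l hl, hdeg] at hle
          have hdead := H1.deadPair_of_not_isReductor ch hk hJ hl hle
          unfold DeadPair at hdead ⊢
          rw [hpk', hpj l hl, hdeg]
          have hcongr : ∀ {u : Mon n} {i : ℕ}, DeadComp m (D.setPoly k h) u i →
              DeadComp m ((D.setPoly k h).setPoly k (monic m h)) u i := fun hd =>
            hd.congr rfl (fun b hb => hpj b (Finset.mem_union_left _ (H.core.prev_sub hb)))
              sig_setPoly fun _ h => h
          exact hdead.imp hcongr hcongr)
      refine Or.inl ⟨.reduce ⟨e, H3⟩, lex_lt_of_snd rfl (Or.inl ?_)⟩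
      have h1 : ∑ i ∈ todo.erase k,
            weight m (((D.setPoly k h).setPoly k (monic m h)).poly i) =
          ∑ i ∈ todo.erase k, weight m (D.poly i) :=
        Finset.sum_congr rfl fun i hi => by
          rw [poly_setPoly_of_ne (Finset.ne_of_mem_erase hi),
            poly_setPoly_of_ne (Finset.ne_of_mem_erase hi)]
      have h2 := Finset.add_sum_erase todo (fun i => weight m (D.poly i)) hk
      have h3 := two_le_weight (m := m) hk0
      have h4 := Finset.card_insert_of_notMem (H.disj k hk)
      omega
  | reduceSmaller _ D D' todo completed k h hk hmin hh hD' h0 j u hJ p hp hsmall =>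
    cases H with
    | reduce H =>
      obtain ⟨e, H⟩ := H
      subst hD' hp
      have hlen := H.lt_length hk
      have hk0 : D.poly k ≠ 0 := fun hz => h0 (eq_zero_of_isNormalForm_zero (hz ▸ hh))
      have hlen' : k < (D.setPoly k h).r.length := by simpa [Stage.setPoly] using hlen
      have H1 := H.normalForm hk hh
      have hpk : (D.setPoly k h).poly k = h := poly_setPoly_self hlen
      have H2 := H1.replace ch hk (by rwa [hpk]) hJ hsmall
      have hj0 : (D.setPoly k h).poly j ≠ 0 := by
        rcases Finset.mem_union.1 hJ.1 with hj | hj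
        · exact H1.core.poly_ne j hj
        · exact H1.ne_zero j hj
      have hdeg : m.degree h = u + m.degree ((D.setPoly k h).poly j) := by
        obtain ⟨-, hle, hu, -⟩ := hJ
        rw [hu, tsub_add_cancel_of_le hle, hpk]
      rw [hpk] at H2
      refine Or.inl ⟨.reduce ⟨e, H2⟩, lex_lt_of_snd rfl (Or.inl ?_)⟩
      have hlt : weight m (((D.setPoly k h).setPoly k (monic m (h - monomial u
          (m.leadingCoeff h / m.leadingCoeff ((D.setPoly k h).poly j)) *
            (D.setPoly k h).poly j))).poly k) < weight m (D.poly k) := by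
        have hd2 := H2.pending_degree (Finset.mem_union_left _ hk)
        rw [poly_setPoly_self hlen', degree_monic] at hd2
        rw [poly_setPoly_self hlen', weight_monic]
        -- Normal form and top-reduction stay in degree `e`, and the latter lowers the head strictly
        -- unless it gives 0.
        refine weight_lt hk0 (or_iff_not_imp_left.2 fun hp0 => ⟨?_, ?_⟩)
        · rw [hd2 (monic_ne_zero hp0), H.pending_degree (Finset.mem_union_left _ hk) hk0]
        · exact ((degree_topReduce_lt h0 hj0 hdeg).resolve_left hp0).trans_le
            (degree_le_of_reds hh.1)
      refine Nat.add_lt_add_right (Finset.sum_lt_sum (fun i hi => ?_) ⟨k, hk, hlt⟩) _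
      by_cases hik : i = k
      · rw [hik]
        exact hlt.le
      · rw [poly_setPoly_of_ne hik, poly_setPoly_of_ne hik]
  | reduceLarger _ D D' todo completed k h hk hmin hh hD' h0 j u hJ p hp hlarge =>
    cases H with
    | reduce H =>
      obtain ⟨e, H⟩ := H
      subst hD' hp
      have H1 := H.normalForm hk hh
      have hpk : (D.setPoly k h).poly k = h := poly_setPoly_self (H.lt_length hk)
      have H2 := H1.append ch hk (by rwa [hpk]) hJ hlarge
      rw [hpk] at H2
      refine Or.inl ⟨.reduce ⟨e, H2⟩, lex_lt_of_fst ?_⟩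
      have h1 := hN _ _ _ _ H2.core
      have h2 : ∀ (s : MSig n) p, ((D.setPoly k h).append (withoutSetup K m ch) s p).rules.length =
          D.rules.length + 1 := fun s p => by simp [Stage.append, Stage.setPoly, withoutSetup]
      rw [h2] at h1 ⊢
      omega
  | reduceEnd _ D completed =>
    cases H with
    | reduce H =>
      exact Or.inl ⟨.update H.finish, lex_lt_of_snd rfl (Or.inr ⟨by simp, by simp⟩)⟩
  | update _ D Q k hk =>
    cases H with
    | update H =>
      exact Or.inl ⟨.update (H.update ch hk),
        lex_lt_of_snd rfl (Or.inl (Finset.card_erase_lt_of_mem hk))⟩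
  | updateEnd _ D =>
    cases H with
    | update H =>
      exact Or.inl ⟨.loop H.finish, lex_lt_of_snd rfl (Or.inr ⟨by simp, by simp⟩)⟩

/-- The hypotheses about the input. -/
def InputOK (F : List (Pol n K)) : Prop :=
  F ≠ [] ∧ (∀ f ∈ F, f ≠ 0) ∧ ∀ f ∈ F, ∃ d : ℕ, f.IsHomogeneous d

theorem RunInv.step (hF : InputOK F) (H : RunInv m F x)
    (hxy : Step (withoutSetup K m ch) x y) : RunInv m F y := by
  obtain ⟨-, hF0, hhom⟩ := hF
  cases H with
  | start =>
    cases hxy with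
    | sort _ f fs hperm hsort =>
      have hf := hperm.subset List.mem_cons_self
      exact .outer (OuterInv.sort (hF0 f hf) (hhom f hf) hperm)
  | outer H =>
    cases hxy with
    | ret =>
      have hperm := H.perm
      rw [List.append_nil] at hperm
      refine .done ?_
      have h := H.gb
      simp only [hperm.mem_iff] at h
      exact h
    | enter f fs =>
      have hf : f ∈ F := H.perm.subset (by simp)
      obtain ⟨X, hX, h⟩ := H.enter (hF0 f hf) (hhom f hf) ch _
      exact .stage hX (.loop h)
  | @stage fs X _ hX H =>
    obtain ⟨N, hN⟩ := Core.exists_length_le X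
    rcases H.step hX hN hxy with ⟨h, -⟩ | ⟨B, prev, r, rules, gs, rfl, h⟩ | ⟨B, rfl, h⟩
    · exact .stage hX h
    · exact .outer h
    · exact .done h
  | done H => cases hxy

theorem RunInv.of_reaches (hF : InputOK F) (h : Reaches (withoutSetup K m ch) F x) :
    RunInv m F x := by
  induction h with
  | refl => exact .start
  | tail _ hxy ih => exact ih.step hF hxy

/-! ### Termination -/

theorem StageInv.acc (hX : Link F fs X)
    (hout : ∀ B prev r rules gs, OuterInv m F fs B prev r gs →
      Acc (fun y x => Step (withoutSetup K m ch) x y) (.outer fs B prev r rules))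
    (H : StageInv X fs x) : Acc (fun y x => Step (withoutSetup K m ch) x y) x := by
  obtain ⟨N, hN⟩ := Core.exists_length_le X
  obtain ⟨μ, hμ⟩ : ∃ μ, stageMeasure m N x = μ := ⟨_, rfl⟩
  induction μ using WellFoundedLT.induction generalizing x with
  | _ μ ih =>
  refine Acc.intro _ fun y hxy => ?_
  rcases H.step hX hN hxy with ⟨h, hlt⟩ | ⟨B, prev, r, rules, gs, rfl, h⟩ | ⟨B, rfl, -⟩
  · exact ih _ (hμ ▸ hlt) h rfl
  · exact hout B prev r rules gs h
  · exact Acc.intro _ fun y hy => by cases hy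

theorem OuterInv.acc (hF : InputOK F) {B : Set (Pol n K)} {prev : Finset ℕ}
    {r : List (Labeled n K (MSig n))} (rules : MRules n) (H : OuterInv m F fs B prev r gs) :
    Acc (fun y x => Step (withoutSetup K m ch) x y) (.outer fs B prev r rules) := by
  induction fs generalizing B prev r rules gs with
  | nil =>
    refine Acc.intro _ fun y hxy => ?_
    cases hxy with
    | ret => exact Acc.intro _ fun y hy => by cases hy
  | cons f fs ih =>
    refine Acc.intro _ fun y hxy => ?_
    cases hxy with
    | enter =>
      have hf : f ∈ F := H.perm.subset (by simp)
      obtain ⟨X, hX, h⟩ := H.enter (hF.2.1 f hf) (hF.2.2 f hf) ch rules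
      exact StageInv.acc hX (fun B prev r rules gs h => ih rules h) (.loop h)

theorem acc_start (hF : InputOK F) :
    Acc (fun y x => Step (withoutSetup K m ch) x y) (.start F) := by
  refine Acc.intro _ fun y hxy => ?_
  cases hxy with
  | sort _ f fs hperm hsort =>
    have hf := hperm.subset List.mem_cons_self
    exact (OuterInv.sort (hF.2.1 f hf) (hF.2.2 f hf) hperm).acc hF _

/-! ### Progress -/

theorem exists_sorted_perm (m : MonomialOrder (Fin n)) (F : List (Pol n K)) :
    ∃ l : List (Pol n K), l.Perm F ∧ l.Pairwise (InputLE m) := by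
  classical
  let key : Pol n K → ℕ ×ₗ m.syn := fun p => toLex (p.totalDegree, m.toSyn (m.degree p))
  have hkey : ∀ p q : Pol n K, InputLE m p q ↔ key p ≤ key q := fun p q => by
    rw [Prod.Lex.toLex_le_toLex]
    rfl
  have htotal : Std.Total (InputLE (K := K) m) :=
    ⟨fun p q => by simp only [hkey]; exact le_total _ _⟩
  have htrans : IsTrans _ (InputLE (K := K) m) :=
    ⟨fun p q s => by simp only [hkey]; exact le_trans⟩
  exact ⟨F.insertionSort (InputLE m), List.perm_insertionSort _ F, List.pairwise_insertionSort _ F⟩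

/-- The one obstacle to progress would be a missing interreduction at the end of a stage; it exists
because `G_curr` then gives a Gröbner basis. Minimal choices exist because the sets are finite. -/
theorem StageInv.exists_step (H : StageInv X fs x) : ∃ y, Step (withoutSetup K m ch) x y := by
  classical
  cases H with
  | @loop D H =>
    by_cases hp : D.pairs = ∅
    · by_cases h1 : ∃ k ∈ D.curr, D.poly k = 1
      · exact ⟨_, .retOne _ _ hp h1⟩
      · push Not at h1
        have hgb := H.isGroebnerBasis hp
        obtain ⟨B, hB⟩ := hgb.exists_isInterreduction
        have hfin := (hgb.interreduction hB.1).1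
        cases ch with
        | reduced =>
          exact ⟨_, .leave _ _ hp h1 B (Finset.range hfin.toFinset.toList.length)
            (hfin.toFinset.toList.map fun p => ⟨none, p⟩) [] hB
            ⟨rfl, hfin.toFinset.toList, Finset.nodup_toList _, by ext; simp, rfl, rfl⟩⟩
        | unreduced =>
          exact ⟨_, .leave _ _ hp h1 B D.curr (D.r.map fun x => ⟨none, x.poly⟩) [] hB
            ⟨rfl, rfl, rfl⟩⟩
    · obtain ⟨c, hc, hmin⟩ := Finset.exists_min_image D.pairs (fun c => c.t.degree)
        (Finset.nonempty_iff_ne_empty.2 hp)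
      exact ⟨_, .select _ _ c hc hmin⟩
  | @spol D P new H =>
    rcases P.eq_empty_or_nonempty with rfl | hP
    · exact ⟨_, .spolEnd _ _ _⟩
    · obtain ⟨c, hc, hmin⟩ := Finset.exists_min_image P (fun c => m.toSyn c.t) hP
      by_cases hrew : (withoutSetup K m ch).spolReject D c.u c.k ∨
          (withoutSetup K m ch).spolReject D c.v c.l
      · exact ⟨_, .spolSkip _ _ _ _ c hc hmin hrew⟩
      · rw [not_or] at hrew
        exact ⟨_, .spolAdd _ _ _ _ c hc hmin hrew.1 hrew.2 _ rfl⟩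
  | @reduce D todo completed H =>
    rcases todo.eq_empty_or_nonempty with rfl | hT
    · exact ⟨_, .reduceEnd _ _ _⟩
    · obtain ⟨e, H⟩ := H
      obtain ⟨k, hk, hmin⟩ := Finset.exists_min_image todo
        (fun k => m.toSyn (MSig.mon (D.sig k))) hT
      have hmin' : ∀ k' ∈ todo, ¬ (withoutSetup K m ch).lt (D.sig k') (D.sig k) := by
        intro k' hk' hlt
        have h1 := hmin k' hk'
        obtain ⟨σ, -, hσ, -⟩ := H.exists_sig hk
        obtain ⟨σ', -, hσ', -⟩ := H.exists_sig hk'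
        rw [hσ, hσ'] at hlt h1
        exact absurd hlt (not_lt.2 h1)
      obtain ⟨h, hh⟩ := exists_isNormalForm m D.B (D.poly k)
      by_cases h0 : h = 0
      · exact ⟨_, .reduceZero _ _ _ _ _ k h hk hmin' hh rfl h0⟩
      by_cases hJ : ∃ j u, IsReductor (withoutSetup K m ch) (D.setPoly k h)
          (D.curr ∪ completed) k j u
      · obtain ⟨j, u, hJ⟩ := hJ
        by_cases hlt : (withoutSetup K m ch).lt
            ((withoutSetup K m ch).mul u ((D.setPoly k h).sig j)) ((D.setPoly k h).sig k)
        · exact ⟨_, .reduceSmaller _ _ _ _ _ k h hk hmin' hh rfl h0 j u hJ _ rfl hlt⟩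
        · exact ⟨_, .reduceLarger _ _ _ _ _ k h hk hmin' hh rfl h0 j u hJ _ rfl hlt⟩
      · push Not at hJ
        exact ⟨_, .reduceDone _ _ _ _ _ k h hk hmin' hh rfl h0 hJ⟩
  | @update D Q H =>
    rcases Q.eq_empty_or_nonempty with rfl | ⟨k, hk⟩
    · exact ⟨_, .updateEnd _ _⟩
    · exact ⟨_, .update _ _ _ k hk⟩

theorem RunInv.exists_step (hF : InputOK F) (H : RunInv m F x) :
    (∃ B, x = .done B) ∨ ∃ y, Step (withoutSetup K m ch) x y := by
  cases H with
  | start =>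
    obtain ⟨l, hperm, hsort⟩ := exists_sorted_perm m F
    cases l with
    | nil => exact absurd hperm.nil_eq.symm hF.1
    | cons f fs => exact Or.inr ⟨_, .sort F f fs hperm hsort⟩
  | @outer fs gs B prev r rules H =>
    cases fs with
    | nil => exact Or.inr ⟨_, .ret _ _ _ _⟩
    | cons f fs => exact Or.inr ⟨_, .enter _ _ _ _ _ _⟩
  | stage hX H => exact Or.inr H.exists_step
  | @done B H => exact Or.inl ⟨B, rfl⟩

/-- Every run of the reformulated algorithm ends. -/
theorem terminates (hF : InputOK F) : Terminates (withoutSetup K m ch) F := by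
  refine ⟨?_, fun x hx hstuck => ?_⟩
  · rintro ⟨c, h0, hc⟩
    refine not_acc_iff_exists_descending_chain.2 ⟨c, h0, hc⟩ (acc_start (m := m) (ch := ch) hF)
  · exact ((RunInv.of_reaches hF hx).exists_step (ch := ch) hF).resolve_right
      fun ⟨y, hy⟩ => hstuck y hy

theorem RunInv.exists_core (H : RunInv m F x) (hx : x.stage? = some D) :
    ∃ (X : StageData K m) (U : Finset (CritPair n)) (A : Finset ℕ) (e : ℕ), Core X D U A e := by
  cases H with
  | start => cases hx
  | outer => cases hx
  | done => cases hx
  | stage hX H => exact ⟨_, H.exists_core hx⟩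

end Runs

end F5C

theorem mainTheorem6 {K : Type*} [Field K] {n : ℕ} (m : MonomialOrder (Fin n))
    (F : List (F5C.Pol n K)) (hF : F ≠ []) (hF0 : ∀ f ∈ F, f ≠ 0)
    (hhom : ∀ f ∈ F, ∃ d : ℕ, f.IsHomogeneous d) (c : F5C.PrevChoice) :
    -- whatever the reformulated algorithm returns is a Gröbner basis of the input ideal
    (∀ B : Set (F5C.Pol n K), F5C.Returns (F5C.withoutSetup K m c) F B →
      F5C.IsGroebnerBasis m (Ideal.span {f | f ∈ F}) B) ∧
    -- if the original F5C terminates, so does the reformulated algorithm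
    ((∃ B : Set (F5C.Pol n K), F5C.Returns (F5C.original K m) F B) →
      F5C.Terminates (F5C.withoutSetup K m c) F) ∧
    -- the rules record only signatures of polynomials created in the current stage
    (∀ (x : F5C.Config n K (F5C.MSig n) (F5C.MRules n))
        (D : F5C.Stage n K (F5C.MSig n) (F5C.MRules n)),
      F5C.Reaches (F5C.withoutSetup K m c) F x → x.stage? = some D →
      ∀ ρ ∈ D.rules, ρ.2 ∉ D.prev ∧ ρ.2 < D.r.length ∧ D.sig ρ.2 = some ρ.1) ∧
    -- at the head of the main loop these are in `G_curr`, unless they have been reduced to zero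
    (∀ (fs : List (F5C.Pol n K)) (D : F5C.Stage n K (F5C.MSig n) (F5C.MRules n)),
      F5C.Reaches (F5C.withoutSetup K m c) F (.loop fs D) →
      ∀ ρ ∈ D.rules, ρ.2 ∈ D.curr \ D.prev ∨ D.poly ρ.2 = 0) := by
  have hok : F5C.InputOK F := ⟨hF, hF0, hhom⟩
  refine ⟨fun B hB => ?_, fun _ => F5C.terminates hok, fun x D hx hD ρ hρ => ?_,
    fun fs D hx ρ hρ => ?_⟩
  · cases F5C.RunInv.of_reaches hok hB with
    | done H => exact H
    | stage hX H => cases H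
  · obtain ⟨X, U, A, e, h⟩ := (F5C.RunInv.of_reaches hok hx).exists_core hD
    exact ⟨h.rule_notMem_prev hρ, (h.rule_idx ρ hρ).2, h.rule_sig ρ hρ⟩
  · cases F5C.RunInv.of_reaches hok hx with
    | stage hX H =>
      cases H with
      | loop H =>
        obtain ⟨e, h⟩ := H
        rcases h.rule_mem ρ hρ with h1 | h1 | h1
        · exact Or.inl (Finset.mem_sdiff.2 ⟨h1, h.rule_notMem_prev hρ⟩)
        · exact absurd h1 (Finset.notMem_empty _)
        · exact Or.inr h1
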